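/- Let $2\le n\le p<\infty$ ($n$ an integer, $p$ real). **(A)** Let $f:\mathbb R^n\to[0,\infty)$ satisfy $f(0)=0$ and: (a) $f(\eta)=|\eta|^p f(\eta/|\eta|)>0$ for $\eta\neq0$; (b) $f\in C^2(\mathbb R^n\setminus\{0\})$; (c) there is $c_*\ge1$ with $c_*^{-1}|\xi|^2\le\sum_{j,k}f_{\eta_j\eta_k}(\eta)\xi_j\xi_k\le c_*|\xi|^2$ whenever $1/2<|\eta|<1$ and $\xi\in\mathbb R^n$. Let $\Omega\subset\mathbb R^n$ be open and let $u$ be a positive weak solution of $\Delta_f u=\nabla\cdot Df(\nabla u)=0$ in $\Omega$, that is, $u\in W^{1,p}(\Omega)$, $u>0$ a.e. in $\Omega$, and $\int_\Omega\langle Df(\nabla u),\nabla\phi\rangle\,dx=0$ for all $\phi\in C_0^\infty(\Omega)$. Put $$\tilde L\zeta=\sum_{j,k=1}^n\frac{\partial}{\partial x_k}\Big(a_{jk}\frac{\partial\zeta}{\partial x_j}\Big),\qquad a_{jk}(x)=\begin{cases}f_{\eta_j\eta_k}(\nabla u(x)),&\nabla u(x)\ne0,\\ \delta_{jk},&\nabla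 u(x)=0.\end{cases}$$ For an open set $D\subset\Omega$, say that $\tilde L\zeta\ge0$ weakly in $D$ (that is, $\zeta$ is locally a weak subsolution in $D$) if $\zeta\in W^{1,2}_{\rm loc}(D)$ and, for every non-negative $\phi\in C_0^\infty(D)$, the function $\sum_{j,k}a_{jk}\zeta_{x_j}\phi_{x_k}$ is integrable on $D$ with $\int_D\sum_{j,k}a_{jk}\zeta_{x_j}\phi_{x_k}\,dx\le0$. Then: 1. $v=\log f(\nabla u)$ satisfies $\tilde Lv\ge0$ weakly in the open set where $\nabla u$ does not vanish. Here $\nabla u$ is an element of $L^p(\Omega)$, and this set consists of the points $x\in\Omega$ near which $|\nabla u|$ is essentially bounded below by a positive constant; if $\nabla u$ has a continuous representative in $\Omega$, it is the set of points where that representative is nonzero. 2. For every $\theta\le-1$, the function $v'=\max\{\log f(\nabla u),\theta\}$ (equal to $\theta$ where $\nabla u=0$) is locally a weak subsolution, $\tilde Lv'\ge0$, in all of $\Omega$. **(B)** Let $A$ and $B$ be real symmetric $n\times n$ matrices, with $B$ positive definite and $\operatorname{tr}(AB)=0$. Then, for every nonzero row vector $\zeta\in\mathbb R^n$, $$\operatorname{tr}\big((BA)^2\big)-\frac{p}{p-1}\,\frac{\zeta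 BABAB\zeta^t}{\zeta B\zeta^t}\ \ge\ 0 .$$ -/

import Mathlib

open MeasureTheory

noncomputable section

namespace FLaplace

/-- Euclidean space of dimension `n`. -/
abbrev E (n : ℕ) : Type := EuclideanSpace ℝ (Fin n)

/-- The partial derivative in the `i`-th coordinate direction. -/
def pd {n : ℕ} (i : Fin n) (h : E n → ℝ) (x : E n) : ℝ :=
  fderiv ℝ h x (EuclideanSpace.single i 1)

/-- The matrix of second partial derivatives of `f` at `η`. -/
def hess {n : ℕ} (f : E n → ℝ) (η : E n) : Matrix (Fin n) (Fin n) ℝ :=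
  Matrix.of fun j k => pd k (pd j f) η

/-- The integrands `f`: positive and homogeneous of degree `p` off the origin, `f 0 = 0`,
twice continuously differentiable off the origin, and uniformly convex on the open shell
`1/2 < |η| < 1`. -/
structure IsAdmissible {n : ℕ} (p : ℝ) (f : E n → ℝ) : Prop where
  map_zero : f 0 = 0
  pos : ∀ η, η ≠ 0 → 0 < f η
  homogeneous : ∀ η, η ≠ 0 → f η = ‖η‖ ^ p * f (‖η‖⁻¹ • η)
  contDiffOn : ContDiffOn ℝ 2 f {0}ᶜ
  convex : ∃ c : ℝ, 1 ≤ c ∧ ∀ η : E n, 1 / 2 < ‖η‖ → ‖η‖ < 1 → ∀ ξ : E n,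
    c⁻¹ * ‖ξ‖ ^ 2 ≤ ∑ j, ∑ k, hess f η j k * ξ j * ξ k ∧
      ∑ j, ∑ k, hess f η j k * ξ j * ξ k ≤ c * ‖ξ‖ ^ 2

/-- `φ` belongs to `C_0^∞(D)`. -/
structure IsTest {n : ℕ} (D : Set (E n)) (φ : E n → ℝ) : Prop where
  smooth : ContDiff ℝ (⊤ : ℕ∞) φ
  compact : HasCompactSupport φ
  supp : tsupport φ ⊆ D

/-- `g` is the distributional gradient of `h` in `D`. -/
structure IsWeakGrad {n : ℕ} (D : Set (E n)) (h : E n → ℝ) (g : E n → E n) : Prop where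
  locInt : LocallyIntegrableOn h D
  locInt_grad : LocallyIntegrableOn g D
  parts : ∀ φ : E n → ℝ, IsTest D φ → ∀ i : Fin n,
    ∫ x in D, h x * pd i φ x = -∫ x in D, g x i * φ x

/-- `u` is a positive weak solution of `∇ · Df(∇u) = 0` in `Ω` and `G` is (a representative of)
its distributional gradient: `u ∈ W^{1,p}(Ω)`, `u > 0`, and `∫ ⟨Df(∇u), ∇φ⟩ = 0` for all
`φ ∈ C_0^∞(Ω)`. As `Df(∇u)` lies in the dual Lebesgue space, this is the same as testing with all
of `W_0^{1,p}(Ω)`, the closure of `C_0^∞(Ω)`. At `η = 0` the derivative of an admissible `f`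
is `0`, for `p > 1`. -/
structure IsPosWeakSol {n : ℕ} (p : ℝ) (f : E n → ℝ) (Ω : Set (E n))
    (u : E n → ℝ) (G : E n → E n) : Prop where
  weakGrad : IsWeakGrad Ω u G
  memLp : MemLp u (ENNReal.ofReal p) (volume.restrict Ω)
  memLp_grad : MemLp G (ENNReal.ofReal p) (volume.restrict Ω)
  pos : ∀ᵐ x ∂(volume.restrict Ω), 0 < u x
  eqn : ∀ φ : E n → ℝ, IsTest Ω φ → ∫ x in Ω, ∑ k, pd k f (G x) * pd k φ x = 0

/-- The coefficient matrix of the linearised operator at gradient value `η`: the Hessian of `f`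
if `η ≠ 0`, and the identity matrix if `η = 0`. -/
def coeff {n : ℕ} (f : E n → ℝ) (η : E n) : Matrix (Fin n) (Fin n) ℝ :=
  open Classical in if η = 0 then 1 else hess f η

/-- `ζ` is locally a weak subsolution in `D` of `∑ ∂_k (a_{jk} ∂_j ζ) = 0`, that is,
`ζ ∈ W^{1,2}_loc(D)` and `∫ ∑ a_{jk} ζ_j φ_k ≤ 0` (an absolutely convergent integral) for all
non-negative `φ ∈ C_0^∞(D)`. -/
def IsWeakSubsol {n : ℕ} (D : Set (E n)) (a : E n → Matrix (Fin n) (Fin n) ℝ)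
    (ζ : E n → ℝ) : Prop :=
  ∃ g : E n → E n, IsWeakGrad D ζ g ∧
    (∀ K : Set (E n), IsCompact K → K ⊆ D →
      MemLp ζ 2 (volume.restrict K) ∧ MemLp g 2 (volume.restrict K)) ∧
    ∀ φ : E n → ℝ, IsTest D φ → (∀ x, 0 ≤ φ x) →
      IntegrableOn (fun x => ∑ k, ∑ j, a x j k * g x j * pd k φ x) D ∧
      ∫ x in D, ∑ k, ∑ j, a x j k * g x j * pd k φ x ≤ 0

/-- The (relatively open) set of points of `Ω` where the field `G`, given up to null sets, does
not vanish: near the point, `|G|` is essentially bounded below by a positive constant. If `G` has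
a representative that is continuous in `Ω`, this is the set where that representative is nonzero,
see `nonvanishing_eq`. -/
def nonvanishing {n : ℕ} (Ω : Set (E n)) (G : E n → E n) : Set (E n) :=
  {x | x ∈ Ω ∧ ∃ c > 0, ∃ ρ > 0, ∀ᵐ y ∂(volume.restrict (Metric.ball x ρ ∩ Ω)), c ≤ ‖G y‖}

theorem nonvanishing_eq {n : ℕ} {Ω : Set (E n)} (hΩ : IsOpen Ω) {G H : E n → E n}
    (hH : ContinuousOn H Ω) (hGH : G =ᵐ[volume.restrict Ω] H) :
    nonvanishing Ω G = {x | x ∈ Ω ∧ H x ≠ 0} := by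
  ext x
  constructor
  · rintro ⟨hx, c, hc, ρ, hρ, hae⟩
    refine ⟨hx, fun h0 => ?_⟩
    have hev : ∀ᶠ y in nhds x, ‖H y‖ < c := by
      have := (hH.continuousAt (hΩ.mem_nhds hx)).norm
      exact this.eventually_lt continuousAt_const (by simpa [h0] using hc)
    obtain ⟨δ, hδ, hball⟩ := Metric.eventually_nhds_iff_ball.1
      ((hev.and (hΩ.mem_nhds hx)).and (Metric.ball_mem_nhds x hρ))
    have h1 := ae_restrict_of_ae_restrict_of_subset
      (fun y hy => ⟨(hball y hy).2, (hball y hy).1.2⟩ :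
        Metric.ball x δ ⊆ Metric.ball x ρ ∩ Ω) hae
    have h2 := ae_restrict_of_ae_restrict_of_subset
      (fun y hy => (hball y hy).1.2 : Metric.ball x δ ⊆ Ω) hGH
    have h3 : ∀ᵐ y ∂(volume.restrict (Metric.ball x δ)), False := by
      filter_upwards [h1, h2, ae_restrict_mem Metric.isOpen_ball.measurableSet] with y a b d
      rw [b] at a
      exact absurd (hball y d).1.1 (not_lt.2 a)
    have h4 : volume (Metric.ball x δ) = 0 := by simpa [ae_iff] using h3
    exact (Metric.measure_ball_pos volume x hδ).ne' h4
  · rintro ⟨hx, h0⟩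
    have hpos : 0 < ‖H x‖ := norm_pos_iff.2 h0
    have hev : ∀ᶠ y in nhds x, ‖H x‖ / 2 < ‖H y‖ := by
      have := (hH.continuousAt (hΩ.mem_nhds hx)).norm
      exact continuousAt_const.eventually_lt this (by linarith)
    obtain ⟨δ, hδ, hball⟩ := Metric.eventually_nhds_iff_ball.1 hev
    refine ⟨hx, ‖H x‖ / 2, by positivity, δ, hδ, ?_⟩
    have h2 := ae_restrict_of_ae_restrict_of_subset
      (Set.inter_subset_right : Metric.ball x δ ∩ Ω ⊆ Ω) hGH
    filter_upwards [h2, ae_restrict_mem (Metric.isOpen_ball.inter hΩ).measurableSet] with y b d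
    rw [b]
    exact (hball y d.1).le

/-- `max {log f(η), θ}`, where `log f(0) = log 0 = -∞`. -/
def truncLog {n : ℕ} (f : E n → ℝ) (θ : ℝ) (η : E n) : ℝ :=
  open Classical in if η = 0 then θ else max (Real.log (f η)) θ

end FLaplace

end

/-! Write F = f(∇u), w = Df(∇u), B = D²f(∇u), a = D²u and g = ∇ log F. Then a w = F g, and Q = B a
is the Jacobian matrix of the field w. The equation says that w is divergence free, that is, tr Q =
0. Homogeneity of f gives Euler's relations B ∇u = (p-1) w and ⟨∇u, w⟩ = p F.

Part (B). Factor B = SᵀS. The matrix C = S A Sᵀ is symmetric and traceless, tr (BA)² = tr C², and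
the quotient equals |Cz|²/|z|² with z = Sζ. By Cauchy–Schwarz an eigenvalue λ of C satisfies n λ² ≤
(n-1) tr C², and p ≥ n gives p/(p-1) ≤ n/(n-1). For A = a and ζ = ∇u, Euler's relations turn the
inequality into tr Q² ≥ F ⟨Bg, g⟩ (`mul_dotProduct_le_trace_sq`).

Part (A). As w is divergence free, ∑ ∂_k c_j ∂_j w_k integrates to zero for compactly supported
fields c. Take c = φ (k(F)/F) w with a test function φ ≥ 0 and k ≥ 0. After the trace inequality
there remains ∫ k(F) ⟨Bg, ∇φ⟩ + φ F k'(F) ⟨Bg, g⟩ ≤ 0. When k approximates the indicator of (e^θ,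
∞), the increasing part of k contributes with a good sign, and the limit is the subsolution
inequality for max (log F) θ, whose gradient is g where F > e^θ and 0 elsewhere. Statement 1 follows
because, on a compact set where |∇u| is essentially bounded below, the truncation is inactive for θ
low enough.

To make this rigorous for weak solutions, difference quotients and strong monotonicity of Df show
that |∇u|^{(p-2)/2} ∇u has weak derivatives in L²_loc (`IsGlobalSol.exists_dq_radial_bound`).
Inverting this power map yields second derivatives a off the set where ∇u = 0, put equal to 0 on it,
with |∇u|^{(p-2)/2} a in L²_loc and a chain rule for functions of ∇u that vanish near 0 and near ∞
(`IsGlobalSol.exists_hasSecondDeriv`). The symmetry of a and the integral identity both rest on ∫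
∂₁c ∂₂b = ∫ ∂₂c ∂₁b, which difference quotients give without any second derivative of b or c
(`LocDiff.integral_mul_eq_integral_mul`). The chain rule forces k to have compact support in (0, ∞),
so k must also decrease at large values; this contribution disappears in the limit because
|∇u|^{p-2} |a|² is locally integrable (`IsGlobalSol.integral_truncGrad_le`). -/

noncomputable section

namespace FLaplace

/-! ### The trace inequality for symmetric matrices. -/

section

open Matrix in
-- Cauchy–Schwarz for the other n - 1 entries, whose sum is `-l i`.
theorem card_mul_sq_le_of_sum_eq_zero {n : ℕ} (l : Fin n → ℝ) (h : ∑ i, l i = 0) (i : Fin n) :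
    (n : ℝ) * l i ^ 2 ≤ (n - 1) * ∑ j, l j ^ 2 := by
  have h1 : ∑ j ∈ Finset.univ.erase i, l j = - l i := by
    have := Finset.add_sum_erase Finset.univ l (Finset.mem_univ i)
    linarith
  have h2 : ∑ j ∈ Finset.univ.erase i, l j ^ 2 = ∑ j, l j ^ 2 - l i ^ 2 := by
    have := Finset.add_sum_erase Finset.univ (fun j => l j ^ 2) (Finset.mem_univ i)
    linarith
  have h3 := sq_sum_le_card_mul_sum_sq (s := Finset.univ.erase i) (f := l)
  rw [h1, h2, Finset.card_erase_of_mem (Finset.mem_univ i), Finset.card_univ, Fintype.card_fin,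
    Nat.cast_sub (Fin.pos i)] at h3
  push_cast at h3
  nlinarith

open Matrix in
-- In an orthonormal eigenbasis |Aw|² = ∑ λᵢ² yᵢ², and the eigenvalues sum to zero, so
-- `card_mul_sq_le_of_sum_eq_zero` bounds each λᵢ².
theorem card_mul_mulVec_sq_le_trace {n : ℕ} {A : Matrix (Fin n) (Fin n) ℝ} (hA : A.IsHermitian)
    (htr : A.trace = 0) (w : Fin n → ℝ) :
    (n : ℝ) * ((A *ᵥ w) ⬝ᵥ (A *ᵥ w)) ≤ (n - 1) * (A * A).trace * (w ⬝ᵥ w) := by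
  set U : Matrix (Fin n) (Fin n) ℝ := (hA.eigenvectorUnitary : Matrix (Fin n) (Fin n) ℝ) with hU
  set l := hA.eigenvalues with hl
  have hAe : A = U * diagonal l * Uᵀ := by
    have := hA.spectral_theorem
    rw [Unitary.conjStarAlgAut_apply] at this
    simpa [hU, star_eq_conjTranspose, Function.comp_def] using this
  have hUU : Uᵀ * U = 1 := by
    have := Unitary.coe_star_mul_self hA.eigenvectorUnitary
    simpa [hU, star_eq_conjTranspose] using this
  have hUU' : U * Uᵀ = 1 := mul_eq_one_comm.1 hUU
  have hAA : A * A = U * diagonal (fun i => l i ^ 2) * Uᵀ := by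
    conv_lhs => rw [hAe]
    calc _ = U * diagonal l * (Uᵀ * U) * diagonal l * Uᵀ := by simp only [Matrix.mul_assoc]
      _ = _ := by
        rw [hUU, Matrix.mul_one, Matrix.mul_assoc U, diagonal_mul_diagonal]
        simp only [sq]
  have hs : ∑ i, l i = 0 := by
    rw [← htr, hAe, Matrix.trace_mul_comm, ← Matrix.mul_assoc, hUU, Matrix.one_mul,
      trace_diagonal]
  have htt : (A * A).trace = ∑ i, l i ^ 2 := by
    rw [hAA, Matrix.trace_mul_comm, ← Matrix.mul_assoc, hUU, Matrix.one_mul, trace_diagonal]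
  set y := Uᵀ *ᵥ w with hy
  have hw : w ⬝ᵥ w = ∑ i, y i ^ 2 := by
    have : w = U *ᵥ y := by rw [hy, mulVec_mulVec, hUU', one_mulVec]
    conv_lhs => rw [this]
    rw [dotProduct_mulVec, vecMul_mulVec, hUU, vecMul_one]
    simp [dotProduct, sq]
  have hAw : (A *ᵥ w) ⬝ᵥ (A *ᵥ w) = ∑ i, l i ^ 2 * y i ^ 2 := by
    have h1 : (A *ᵥ w) ⬝ᵥ (A *ᵥ w) = w ⬝ᵥ ((A * A) *ᵥ w) := by
      have hAT : Aᵀ = A := by simpa using hA.eq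
      rw [dotProduct_mulVec, vecMul_mulVec, hAT, ← dotProduct_mulVec]
    rw [h1, hAA, ← mulVec_mulVec, ← mulVec_mulVec, dotProduct_mulVec, ← mulVec_transpose, ← hy]
    simp only [dotProduct, mulVec_diagonal]
    exact Finset.sum_congr rfl fun i _ => by ring
  rw [hw, hAw, htt, Finset.mul_sum, Finset.mul_sum]
  refine Finset.sum_le_sum fun i _ => ?_
  have := card_mul_sq_le_of_sum_eq_zero l hs i
  nlinarith [sq_nonneg (y i)]

open Matrix in
/-- The algebraic inequality for a symmetric matrix `A` and a positive definite matrix `B` with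
`tr (A B) = 0`. -/
theorem trace_sq_sub_nonneg {n : ℕ} (hn : 2 ≤ n) {p : ℝ} (hp : (n : ℝ) ≤ p)
    {A B : Matrix (Fin n) (Fin n) ℝ} (hA : A.IsSymm) (hB : B.PosDef) (hAB : (A * B).trace = 0)
    {ζ : Fin n → ℝ} (hζ : ζ ≠ 0) :
    0 ≤ ((B * A) ^ 2).trace - p / (p - 1) *
      (ζ ⬝ᵥ ((B * A * B * A * B) *ᵥ ζ) / (ζ ⬝ᵥ (B *ᵥ ζ))) := by
  -- Passing to the congruent matrix `C = S A Sᵀ` and to `w = S ζ` removes `B`: then tr C = tr (AB)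
  -- = 0, tr C² = tr (BA)², and both quadratic forms become squared lengths.
  obtain ⟨S, hS⟩ : ∃ S : Matrix (Fin n) (Fin n) ℝ, B = Sᵀ * S := by
    open MatrixOrder in
    obtain ⟨S, hS⟩ := CStarAlgebra.nonneg_iff_eq_star_mul_self.mp hB.posSemidef.nonneg
    exact ⟨S, by simpa [star_eq_conjTranspose] using hS⟩
  have hAT : Aᵀ = A := hA
  set C := S * A * Sᵀ with hC
  have hCh : C.IsHermitian := by
    simp [hC, IsHermitian, hAT, Matrix.mul_assoc]
  have hCtr : C.trace = 0 := by
    rw [hC, Matrix.mul_assoc, Matrix.trace_mul_comm, Matrix.mul_assoc, ← hS, hAB]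
  have hCC : (C * C).trace = ((B * A) ^ 2).trace := by
    rw [hC, hS, sq]
    calc _ = (S * (A * Sᵀ * S * A * Sᵀ)).trace := by simp only [Matrix.mul_assoc]
      _ = _ := by
        rw [Matrix.trace_mul_comm]
        calc _ = (A * (Sᵀ * S * A * Sᵀ * S)).trace := by simp only [Matrix.mul_assoc]
          _ = _ := by rw [Matrix.trace_mul_comm]; simp only [Matrix.mul_assoc]
  set w := S *ᵥ ζ with hw
  have h1 : ζ ⬝ᵥ (B *ᵥ ζ) = w ⬝ᵥ w := by
    rw [hS, ← mulVec_mulVec, dotProduct_mulVec, vecMul_transpose]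
  have hCT : Cᵀ = C := by simpa using hCh.eq
  clear_value C
  have h2 : ζ ⬝ᵥ ((B * A * B * A * B) *ᵥ ζ) = (C *ᵥ w) ⬝ᵥ (C *ᵥ w) := by
    have : B * A * B * A * B = Sᵀ * (C * (C * S)) := by
      rw [hS, hC]; simp only [Matrix.mul_assoc]
    rw [this, ← mulVec_mulVec, ← mulVec_mulVec, ← mulVec_mulVec, dotProduct_mulVec,
      vecMul_transpose, ← hw, dotProduct_mulVec, ← mulVec_transpose, hCT]
  have h3 : 0 < w ⬝ᵥ w := by
    rw [← h1]
    simpa using hB.dotProduct_mulVec_pos hζ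
  have h4 := card_mul_mulVec_sq_le_trace hCh hCtr w
  rw [h1, h2, ← hCC]
  have hn' : (2 : ℝ) ≤ n := by exact_mod_cast hn
  have h5 : 0 ≤ (C *ᵥ w) ⬝ᵥ (C *ᵥ w) := by
    simpa using dotProduct_star_self_nonneg (C *ᵥ w)
  -- This is p/(p-1) ≤ n/(n-1), cleared of denominators: (n-1) p ≤ n (p-1) because n ≤ p.
  have h6 : p * ((C *ᵥ w) ⬝ᵥ (C *ᵥ w)) ≤ (p - 1) * ((C * C).trace * (w ⬝ᵥ w)) := by
    have h7 : ((n : ℝ) - 1) * (p * ((C *ᵥ w) ⬝ᵥ (C *ᵥ w))) ≤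
        (n - 1) * ((p - 1) * ((C * C).trace * (w ⬝ᵥ w))) := by
      have := mul_le_mul_of_nonneg_left h4 (by linarith : (0 : ℝ) ≤ p - 1)
      nlinarith
    exact le_of_mul_le_mul_left h7 (by linarith)
  rw [sub_nonneg, div_mul_div_comm, div_le_iff₀ (mul_pos (by linarith) h3)]
  linarith

end

/-! ### Positively homogeneous maps. -/

section

section Homogeneous

variable {X Y : Type*} [NormedAddCommGroup X] [NormedSpace ℝ X] [NormedAddCommGroup Y]
  [NormedSpace ℝ Y]

/-- Positive homogeneity of degree `d` off the origin. -/
def IsHomog (d : ℝ) (F : X → Y) : Prop := ∀ t : ℝ, 0 < t → ∀ x, x ≠ 0 → F (t • x) = t ^ d • F x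

/-- Differentiating F(ty) = t^d F(y) in y produces one extra factor t on the left. -/
theorem IsHomog.fderiv {d : ℝ} {F : X → Y} (hF : IsHomog d F) :
    IsHomog (d - 1) (fderiv ℝ F) := by
  intro t ht x hx
  have h1 : (fun y => F (t • y)) =ᶠ[nhds x] fun y => t ^ d • F y := by
    filter_upwards [isOpen_ne.mem_nhds hx] with y hy using hF t ht y hy
  have h2 := h1.fderiv_eq (𝕜 := ℝ)
  rw [_root_.fderiv_comp_smul] at h2
  have h3 : _root_.fderiv ℝ (fun y => t ^ d • F y) x = t ^ d • _root_.fderiv ℝ F x := by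
    have := congrFun (fderiv_const_smul_field (𝕜 := ℝ) (f := F) (t ^ d)) x
    simpa [Pi.smul_def] using this
  rw [h3] at h2
  rw [Real.rpow_sub_one ht.ne', div_eq_inv_mul, mul_smul, ← h2, inv_smul_smul₀ ht.ne']

theorem IsHomog.eq_smul {d : ℝ} {F : X → Y} (hF : IsHomog d F) {x : X} (hx : x ≠ 0) :
    F x = ‖x‖ ^ d • F (‖x‖⁻¹ • x) := by
  have h := hF ‖x‖ (norm_pos_iff.2 hx) (‖x‖⁻¹ • x)
    (smul_ne_zero (inv_ne_zero (norm_ne_zero_iff.2 hx)) hx)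
  rwa [smul_inv_smul₀ (norm_ne_zero_iff.2 hx)] at h

theorem norm_inv_smul_self {x : X} (hx : x ≠ 0) : ‖‖x‖⁻¹ • x‖ = 1 := by
  rw [norm_smul, norm_inv, norm_norm, inv_mul_cancel₀ (norm_ne_zero_iff.2 hx)]

theorem IsHomog.exists_bound [ProperSpace X] {d : ℝ} {F : X → Y} (hF : IsHomog d F)
    (hc : ContinuousOn F {0}ᶜ) : ∃ C : ℝ, 0 < C ∧ ∀ x, x ≠ 0 → ‖F x‖ ≤ C * ‖x‖ ^ d := by
  obtain ⟨C, hC⟩ := (isCompact_sphere (0 : X) 1).exists_bound_of_continuousOn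
    (hc.mono fun x hx => by
      simp only [mem_sphere_iff_norm, sub_zero] at hx
      simp only [Set.mem_compl_iff, Set.mem_singleton_iff]
      rintro rfl
      simp at hx)
  refine ⟨max C 1, by positivity, fun x hx => ?_⟩
  rw [hF.eq_smul hx, norm_smul, Real.norm_of_nonneg (by positivity), mul_comm]
  gcongr
  exact (hC _ (by simp [norm_inv_smul_self hx])).trans (le_max_left _ _)

theorem IsHomog.exists_lower_bound [ProperSpace X] {d : ℝ} {F : X → ℝ} (hF : IsHomog d F)
    (hc : ContinuousOn F {0}ᶜ) (hpos : ∀ x, x ≠ 0 → 0 < F x) :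
    ∃ c : ℝ, 0 < c ∧ ∀ x, x ≠ 0 → c * ‖x‖ ^ d ≤ F x := by
  by_cases hne : (Metric.sphere (0 : X) 1).Nonempty
  · have hs : ∀ x ∈ Metric.sphere (0 : X) 1, x ≠ 0 := by
      rintro x hx rfl
      simp at hx
    obtain ⟨x₀, hx₀, hmin⟩ := (isCompact_sphere (0 : X) 1).exists_isMinOn hne
      (hc.mono fun x hx => hs x hx)
    refine ⟨F x₀, hpos _ (hs _ hx₀), fun x hx => ?_⟩
    rw [hF.eq_smul hx, smul_eq_mul, mul_comm]
    gcongr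
    exact hmin (by simp [norm_inv_smul_self hx])
  · refine ⟨1, one_pos, fun x hx => absurd ⟨‖x‖⁻¹ • x, ?_⟩ hne⟩
    simp [norm_inv_smul_self hx]

/-- A homogeneous map of degree `d ≥ 1` which is `C^1` off the origin is locally Lipschitz, with
the natural growth of the constant. -/
theorem IsHomog.exists_lipschitz [ProperSpace X] {d : ℝ} (hd : 1 ≤ d) {F : X → Y}
    (hF : IsHomog d F) (hF0 : F 0 = 0) (hc : ContDiffOn ℝ 1 F {0}ᶜ) :
    ∃ C : ℝ, 0 < C ∧ ∀ a b, ‖F a - F b‖ ≤ C * (‖a‖ + ‖b‖) ^ (d - 1) * ‖a - b‖ := by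
  have ho : IsOpen ({0}ᶜ : Set X) := isOpen_compl_singleton
  obtain ⟨C₁, hC₁, h₁⟩ := hF.exists_bound hc.continuousOn
  obtain ⟨C₂, hC₂, h₂⟩ := hF.fderiv.exists_bound (hc.continuousOn_fderiv_of_isOpen ho le_rfl)
  have h₁' : ∀ x, ‖F x‖ ≤ C₁ * ‖x‖ ^ d := by
    intro x
    by_cases hx : x = 0
    · simp [hx, hF0, Real.zero_rpow (by linarith : d ≠ 0)]
    · exact h₁ x hx
  refine ⟨max (2 * C₁) C₂, by positivity, fun a b => ?_⟩
  -- `F` need not be differentiable at the origin. If the segment meets it, then |a - b| = |a| + |b|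
  -- and the growth of `F` alone suffices; otherwise the mean value inequality applies along the
  -- segment.
  by_cases h0 : (0 : X) ∈ segment ℝ a b
  · have hab : ‖a - b‖ = ‖a‖ + ‖b‖ := by
      have := dist_add_dist_of_mem_segment h0
      simpa [dist_eq_norm, add_comm] using this.symm
    rw [hab]
    have hsum : (‖a‖ + ‖b‖) ^ (d - 1) * (‖a‖ + ‖b‖) = (‖a‖ + ‖b‖) ^ d := by
      rcases (by positivity : 0 ≤ ‖a‖ + ‖b‖).eq_or_lt with h | h
      · rw [← h, mul_zero, Real.zero_rpow (by linarith)]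
      · rw [Real.rpow_sub_one h.ne', div_mul_cancel₀ _ h.ne']
    rw [mul_assoc, hsum]
    have ha : ‖a‖ ^ d ≤ (‖a‖ + ‖b‖) ^ d :=
      Real.rpow_le_rpow (norm_nonneg _) (by linarith [norm_nonneg b]) (by linarith)
    have hb : ‖b‖ ^ d ≤ (‖a‖ + ‖b‖) ^ d :=
      Real.rpow_le_rpow (norm_nonneg _) (by linarith [norm_nonneg a]) (by linarith)
    calc ‖F a - F b‖ ≤ ‖F a‖ + ‖F b‖ := norm_sub_le _ _
      _ ≤ C₁ * ‖a‖ ^ d + C₁ * ‖b‖ ^ d := add_le_add (h₁' a) (h₁' b)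
      _ ≤ C₁ * (‖a‖ + ‖b‖) ^ d + C₁ * (‖a‖ + ‖b‖) ^ d := by gcongr
      _ = 2 * C₁ * (‖a‖ + ‖b‖) ^ d := by ring
      _ ≤ _ := by gcongr; exact le_max_left _ _
  · have hne : ∀ x ∈ segment ℝ a b, x ≠ 0 := fun x hx h => h0 (h ▸ hx)
    have hbd : ∀ x ∈ segment ℝ a b,
        ‖_root_.fderiv ℝ F x‖ ≤ max (2 * C₁) C₂ * (‖a‖ + ‖b‖) ^ (d - 1) := by
      intro x hx
      refine (h₂ x (hne x hx)).trans ?_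
      have hxn : ‖x‖ ≤ ‖a‖ + ‖b‖ := by
        obtain ⟨s, t, hs, ht, hst, rfl⟩ := hx
        calc ‖s • a + t • b‖ ≤ ‖s • a‖ + ‖t • b‖ := norm_add_le _ _
          _ = s * ‖a‖ + t * ‖b‖ := by
            rw [norm_smul, norm_smul, Real.norm_of_nonneg hs, Real.norm_of_nonneg ht]
          _ ≤ _ := by nlinarith [norm_nonneg a, norm_nonneg b]
      have := Real.rpow_le_rpow (norm_nonneg x) hxn (by linarith : 0 ≤ d - 1)
      gcongr
      exact le_max_right _ _
    have hdf : ∀ x ∈ segment ℝ a b, DifferentiableAt ℝ F x := fun x hx =>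
      (hc.differentiableOn one_ne_zero).differentiableAt (ho.mem_nhds (hne x hx))
    have := (convex_segment (𝕜 := ℝ) a b).norm_image_sub_le_of_norm_fderiv_le hdf hbd
      (right_mem_segment ℝ a b) (left_mem_segment ℝ a b)
    exact this

theorem IsHomog.euler {d : ℝ} {F : X → Y} (hF : IsHomog d F) {x : X} (hx : x ≠ 0)
    (hd : DifferentiableAt ℝ F x) : _root_.fderiv ℝ F x x = d • F x := by
  have h1 : HasDerivAt (fun t : ℝ => F (t • x)) (_root_.fderiv ℝ F x x) 1 := by
    have h : HasDerivAt (fun t : ℝ => t • x) x 1 := by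
      simpa using (hasDerivAt_id (1 : ℝ)).smul_const x
    exact HasFDerivAt.comp_hasDerivAt_of_eq 1 hd.hasFDerivAt h (by simp)
  have h2 : HasDerivAt (fun t : ℝ => F (t • x)) (d • F x) 1 := by
    have h : HasDerivAt (fun t : ℝ => t ^ d • F x) (d • F x) 1 := by
      simpa using (Real.hasDerivAt_rpow_const (x := 1) (p := d) (Or.inl one_ne_zero)).smul_const
        (F x)
    refine h.congr_of_eventuallyEq ?_
    filter_upwards [lt_mem_nhds (zero_lt_one (α := ℝ))] with t ht using hF t ht x hx
  exact h1.unique h2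

end Homogeneous

end

/-! ### The integrand: growth, ellipticity, Euler relations and strong monotonicity. -/

section

variable {n : ℕ} {p : ℝ} {f : E n → ℝ}

theorem fderiv_apply_eq_sum (F : E n → ℝ) (x v : E n) :
    fderiv ℝ F x v = ∑ i, v i * pd i F x := by
  conv_lhs => rw [← (EuclideanSpace.basisFun (Fin n) ℝ).sum_repr v]
  simp [pd]

theorem IsAdmissible.isHomog (hf : IsAdmissible p f) : IsHomog p f := by
  intro t ht x hx
  have h : (t * ‖x‖)⁻¹ * t = ‖x‖⁻¹ := by
    rw [mul_inv, mul_right_comm, inv_mul_cancel₀ ht.ne', one_mul]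
  rw [hf.homogeneous (t • x) (smul_ne_zero ht.ne' hx), hf.homogeneous x hx, norm_smul,
    Real.norm_of_nonneg ht.le, Real.mul_rpow ht.le (norm_nonneg x), smul_smul, h,
    smul_eq_mul, mul_assoc]

theorem IsAdmissible.contDiffOn_fderiv (hf : IsAdmissible p f) :
    ContDiffOn ℝ 1 (fderiv ℝ f) {0}ᶜ :=
  hf.contDiffOn.fderiv_of_isOpen isOpen_compl_singleton (by norm_num)

theorem IsAdmissible.differentiableAt (hf : IsAdmissible p f) {η : E n} (hη : η ≠ 0) :
    DifferentiableAt ℝ f η :=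
  (hf.contDiffOn.differentiableOn two_ne_zero).differentiableAt
    (isOpen_compl_singleton.mem_nhds hη)

theorem IsAdmissible.differentiableAt_fderiv (hf : IsAdmissible p f) {η : E n} (hη : η ≠ 0) :
    DifferentiableAt ℝ (fderiv ℝ f) η :=
  (hf.contDiffOn_fderiv.differentiableOn one_ne_zero).differentiableAt
    (isOpen_compl_singleton.mem_nhds hη)

theorem IsAdmissible.contDiffOn_pd (hf : IsAdmissible p f) (i : Fin n) :
    ContDiffOn ℝ 1 (pd i f) {0}ᶜ :=
  hf.contDiffOn_fderiv.clm_apply contDiffOn_const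

theorem IsAdmissible.exists_bounds (hf : IsAdmissible p f) :
    ∃ c C : ℝ, 0 < c ∧ 0 < C ∧ ∀ η, η ≠ 0 → c * ‖η‖ ^ p ≤ f η ∧ f η ≤ C * ‖η‖ ^ p := by
  obtain ⟨c, hc, h1⟩ := hf.isHomog.exists_lower_bound hf.contDiffOn.continuousOn hf.pos
  obtain ⟨C, hC, h2⟩ := hf.isHomog.exists_bound hf.contDiffOn.continuousOn
  exact ⟨c, C, hc, hC, fun η hη => ⟨h1 η hη, (le_abs_self _).trans (h2 η hη)⟩⟩

/-- The growth bound |f(η)| ≤ C |η|^p with p > 1 makes `f` of order o(|η|) at the origin. -/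
theorem IsAdmissible.fderiv_zero (hf : IsAdmissible p f) (hp : 2 ≤ p) : fderiv ℝ f 0 = 0 := by
  obtain ⟨C, hC, h⟩ := hf.isHomog.exists_bound hf.contDiffOn.continuousOn
  refine HasFDerivAt.fderiv (HasFDerivAt.of_isLittleO ?_)
  have h1 : (fun x : E n => f x - f 0 - (0 : E n →L[ℝ] ℝ) (x - 0)) =O[nhds 0]
      fun x => ‖x‖ ^ p := by
    refine Asymptotics.IsBigO.of_bound C (Filter.Eventually.of_forall fun x => ?_)
    by_cases hx : x = 0
    · simp [hx, hf.map_zero]; positivity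
    · have := h x hx
      simpa [hf.map_zero, abs_of_nonneg (Real.rpow_nonneg (norm_nonneg x) p)] using this
  refine h1.trans_isLittleO ?_
  have h2 : (fun x : E n => ‖x‖ ^ p) = fun x => ‖x‖ ^ (p - 1) * ‖x‖ := by
    funext x
    by_cases hx : x = 0
    · simp [hx, Real.zero_rpow (by linarith : p ≠ 0)]
    · rw [Real.rpow_sub_one (norm_ne_zero_iff.2 hx), div_mul_cancel₀ _ (norm_ne_zero_iff.2 hx)]
  rw [h2]
  have h3 : (fun x : E n => ‖x‖ ^ (p - 1)) =o[nhds 0] fun _ => (1 : ℝ) := by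
    rw [Asymptotics.isLittleO_one_iff]
    have : ContinuousAt (fun x : E n => ‖x‖ ^ (p - 1)) 0 :=
      continuous_norm.continuousAt.rpow_const (Or.inr (by linarith))
    simpa [ContinuousAt, Real.zero_rpow (by linarith : p - 1 ≠ 0)] using this
  have h4 := h3.mul_isBigO (Asymptotics.isBigO_refl (fun x : E n => ‖x‖) (nhds 0))
  simp only [one_mul] at h4
  simpa using h4.of_norm_right

theorem IsAdmissible.exists_lipschitz_fderiv (hf : IsAdmissible p f) (hp : 2 ≤ p) :
    ∃ C : ℝ, 0 < C ∧
      ∀ a b, ‖fderiv ℝ f a - fderiv ℝ f b‖ ≤ C * (‖a‖ + ‖b‖) ^ (p - 2) * ‖a - b‖ := by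
  have := hf.isHomog.fderiv.exists_lipschitz (by linarith) (hf.fderiv_zero hp)
    hf.contDiffOn_fderiv
  simpa [show p - 1 - 1 = p - 2 by ring] using this

theorem IsAdmissible.exists_fderiv_bound (hf : IsAdmissible p f) (hp : 2 ≤ p) :
    ∃ C : ℝ, 0 < C ∧ ∀ η, ‖fderiv ℝ f η‖ ≤ C * ‖η‖ ^ (p - 1) := by
  obtain ⟨C, hC, h⟩ := hf.isHomog.fderiv.exists_bound hf.contDiffOn_fderiv.continuousOn
  refine ⟨C, hC, fun η => ?_⟩
  by_cases hη : η = 0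
  · simp [hη, hf.fderiv_zero hp]; positivity
  · exact h η hη

theorem IsAdmissible.continuous_fderiv (hf : IsAdmissible p f) (hp : 2 ≤ p) :
    Continuous (fderiv ℝ f) := by
  rw [continuous_iff_continuousAt]
  intro x
  by_cases hx : x = 0
  · obtain ⟨C, hC, h⟩ := hf.exists_fderiv_bound hp
    subst hx
    rw [ContinuousAt, hf.fderiv_zero hp]
    refine squeeze_zero_norm h ?_
    have : ContinuousAt (fun x : E n => C * ‖x‖ ^ (p - 1)) 0 :=
      continuousAt_const.mul (continuous_norm.continuousAt.rpow_const (Or.inr (by linarith)))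
    simpa [ContinuousAt, Real.zero_rpow (by linarith : p - 1 ≠ 0)] using this
  · exact (hf.differentiableAt_fderiv hx).continuousAt

theorem IsAdmissible.exists_hessian_bound (hf : IsAdmissible p f) :
    ∃ C : ℝ, 0 < C ∧ ∀ η, η ≠ 0 → ‖fderiv ℝ (fderiv ℝ f) η‖ ≤ C * ‖η‖ ^ (p - 2) := by
  have h := hf.isHomog.fderiv.fderiv.exists_bound
    (hf.contDiffOn_fderiv.continuousOn_fderiv_of_isOpen isOpen_compl_singleton le_rfl)
  simpa [show p - 1 - 1 = p - 2 by ring] using h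

theorem IsAdmissible.hess_apply (hf : IsAdmissible p f) {η : E n} (hη : η ≠ 0) (j k : Fin n) :
    hess f η j k = fderiv ℝ (fderiv ℝ f) η (EuclideanSpace.single k 1)
      (EuclideanSpace.single j 1) := by
  have : HasFDerivAt (pd j f) ((fderiv ℝ (fderiv ℝ f) η).flip (EuclideanSpace.single j 1)) η := by
    have h := (hf.differentiableAt_fderiv hη).hasFDerivAt.clm_apply
      (hasFDerivAt_const (EuclideanSpace.single j (1 : ℝ)) η)
    rw [ContinuousLinearMap.comp_zero, zero_add] at h
    exact h
  simp only [hess, Matrix.of_apply]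
  rw [pd, this.fderiv]
  rfl

theorem fderiv_pd (f : E n → ℝ) (η : E n) (j : Fin n) (v : E n) :
    fderiv ℝ (pd j f) η v = ∑ k, hess f η j k * v k := by
  rw [fderiv_apply_eq_sum]
  exact Finset.sum_congr rfl fun k _ => mul_comm _ _

theorem IsAdmissible.hess_symm (hf : IsAdmissible p f) {η : E n} (hη : η ≠ 0) :
    (hess f η).IsSymm := by
  ext j k
  rw [Matrix.transpose_apply, hf.hess_apply hη, hf.hess_apply hη]
  have h : ContDiffAt ℝ 2 f η := hf.contDiffOn.contDiffAt (isOpen_compl_singleton.mem_nhds hη)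
  exact (h.isSymmSndFDerivAt (by simp)).eq _ _

theorem clm_apply_eq_sum (L : E n →L[ℝ] E n →L[ℝ] ℝ) (ξ ζ : E n) :
    L ξ ζ = ∑ j, ∑ k, L (EuclideanSpace.single k 1) (EuclideanSpace.single j 1) * ζ j * ξ k := by
  conv_lhs => rw [← (EuclideanSpace.basisFun (Fin n) ℝ).sum_repr ξ,
    ← (EuclideanSpace.basisFun (Fin n) ℝ).sum_repr ζ]
  simp only [map_sum, map_smul, sum_apply, smul_apply,
    EuclideanSpace.basisFun_apply, EuclideanSpace.basisFun_repr, smul_eq_mul, Finset.mul_sum]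
  exact Finset.sum_congr rfl fun j _ => Finset.sum_congr rfl fun k _ => by ring

theorem IsAdmissible.sum_hess (hf : IsAdmissible p f) {η : E n} (hη : η ≠ 0) (ξ ζ : E n) :
    ∑ j, ∑ k, hess f η j k * ζ j * ξ k = fderiv ℝ (fderiv ℝ f) η ξ ζ := by
  rw [clm_apply_eq_sum]
  simp only [hf.hess_apply hη]

/-- The Hessian is homogeneous of degree p - 2, so the convexity assumed on the shell spreads to all
η ≠ 0. -/
theorem IsAdmissible.exists_elliptic (hf : IsAdmissible p f) :
    ∃ c : ℝ, 0 < c ∧ ∀ η, η ≠ 0 → ∀ ξ,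
      c * ‖η‖ ^ (p - 2) * ‖ξ‖ ^ 2 ≤ fderiv ℝ (fderiv ℝ f) η ξ ξ := by
  obtain ⟨c, hc, h⟩ := hf.convex
  -- The vector is rescaled to length 3/4, inside the shell; scaling back by 4/3 · |η| gives the
  -- constant.
  refine ⟨c⁻¹ * (4 / 3 : ℝ) ^ (p - 2), by positivity, fun η hη ξ => ?_⟩
  set η' : E n := (3 / 4 : ℝ) • (‖η‖⁻¹ • η) with hη'
  have hn : ‖η'‖ = 3 / 4 := by
    rw [hη', norm_smul, norm_inv_smul_self hη]; norm_num
  have hη'0 : η' ≠ 0 := by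
    intro h0; rw [h0, norm_zero] at hn; norm_num at hn
  have h1 := (h η' (by rw [hn]; norm_num) (by rw [hn]; norm_num) ξ).1
  rw [hf.sum_hess hη'0] at h1
  have hpos : 0 < 4 / 3 * ‖η‖ := by have := norm_pos_iff.2 hη; positivity
  have h2 : η = (4 / 3 * ‖η‖) • η' := by
    rw [hη', smul_smul, smul_smul]
    have : (4 / 3 * ‖η‖ * (3 / 4) * ‖η‖⁻¹ : ℝ) = 1 := by
      have := norm_ne_zero_iff.2 hη
      field_simp
    rw [this, one_smul]
  have h3 := hf.isHomog.fderiv.fderiv _ hpos η' hη'0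
  rw [← h2, show p - 1 - 1 = p - 2 by ring] at h3
  rw [h3, smul_apply, smul_apply, smul_eq_mul,
    Real.mul_rpow (by norm_num) (norm_nonneg _)]
  calc _ = (4 / 3 : ℝ) ^ (p - 2) * ‖η‖ ^ (p - 2) * (c⁻¹ * ‖ξ‖ ^ 2) := by ring
    _ ≤ _ := by gcongr

theorem IsAdmissible.hess_posDef (hf : IsAdmissible p f) {η : E n} (hη : η ≠ 0) :
    (hess f η).PosDef := by
  obtain ⟨c, hc, h⟩ := hf.exists_elliptic
  refine Matrix.PosDef.of_dotProduct_mulVec_pos ?_ fun x hx => ?_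
  · rw [Matrix.IsHermitian, Matrix.conjTranspose_eq_transpose_of_trivial]
    exact hf.hess_symm hη
  · have h1 := h η hη (WithLp.toLp 2 x)
    rw [← hf.sum_hess hη] at h1
    have hx' : (WithLp.toLp 2 x : E n) ≠ 0 := by simpa using hx
    have h2 : 0 < c * ‖η‖ ^ (p - 2) * ‖(WithLp.toLp 2 x : E n)‖ ^ 2 := by
      have := norm_pos_iff.2 hη
      have := norm_pos_iff.2 hx'
      positivity
    refine h2.trans_le (h1.trans_eq ?_)
    simp only [dotProduct, Matrix.mulVec, Finset.mul_sum, star_trivial]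
    exact Finset.sum_congr rfl fun j _ => Finset.sum_congr rfl fun k _ => by ring

/-- Euler's relation for the partial derivatives, homogeneous of degree p - 1. Together with
`IsAdmissible.sum_pd_mul_self` it singles out ∇u as the vector to insert in the trace inequality. -/
theorem IsAdmissible.hess_mulVec_self (hf : IsAdmissible p f) {η : E n} (hη : η ≠ 0) (j : Fin n) :
    ∑ k, hess f η j k * η k = (p - 1) * pd j f η := by
  rw [← fderiv_pd]
  have h : IsHomog (p - 1) (pd j f) := fun t ht x hx => by
    simp only [pd, hf.isHomog.fderiv t ht x hx, smul_apply]
  have hd : DifferentiableAt ℝ (pd j f) η :=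
    ((hf.contDiffOn_pd j).differentiableOn one_ne_zero).differentiableAt
      (isOpen_compl_singleton.mem_nhds hη)
  simpa using h.euler hη hd

theorem IsAdmissible.sum_pd_mul_self (hf : IsAdmissible p f) {η : E n} (hη : η ≠ 0) :
    ∑ k, η k * pd k f η = p * f η := by
  rw [← fderiv_apply_eq_sum]
  simpa using hf.isHomog.euler hη (hf.differentiableAt hη)

/-- By symmetry let |b| ≤ |a| and follow ⟨Df, a - b⟩ along the segment from b to a. On its last
quarter the points have norm at least (|a| + |b|)/4, so ellipticity gives a quantitative increase
there; on the rest it is enough that the function does not decrease. -/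
theorem IsAdmissible.exists_monotone (hf : IsAdmissible p f) (hp : 2 ≤ p) :
    ∃ c : ℝ, 0 < c ∧ ∀ a b,
      c * (‖a‖ + ‖b‖) ^ (p - 2) * ‖a - b‖ ^ 2 ≤ (fderiv ℝ f a - fderiv ℝ f b) (a - b) := by
  obtain ⟨c, hc, hell⟩ := hf.exists_elliptic
  have hkey : ∀ a b : E n, ‖b‖ ≤ ‖a‖ →
      c * (1 / 4 : ℝ) ^ (p - 2) * (1 / 4) * (‖a‖ + ‖b‖) ^ (p - 2) * ‖a - b‖ ^ 2 ≤
        (fderiv ℝ f a - fderiv ℝ f b) (a - b) := by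
    intro a b hab
    by_cases heq : a = b
    · simp [heq]
    have hsub : a - b ≠ 0 := sub_ne_zero.2 heq
    set γ : ℝ → E n := fun s => b + s • (a - b) with hγ
    have hγc : Continuous γ := by fun_prop
    set g : ℝ → ℝ := fun s => fderiv ℝ f (γ s) (a - b) with hg
    have hgc : Continuous g := ((hf.continuous_fderiv hp).comp hγc).clm_apply continuous_const
    have hgd : ∀ s, γ s ≠ 0 →
        HasDerivAt g (fderiv ℝ (fderiv ℝ f) (γ s) (a - b) (a - b)) s := by
      intro s hs
      have h1 : HasDerivAt γ (a - b) s := by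
        have h := ((hasDerivAt_id s).smul_const (a - b)).const_add b
        rw [one_smul] at h
        exact h
      have h2 := (hf.differentiableAt_fderiv hs).hasFDerivAt.comp_hasDerivAt s h1
      have h3 := h2.clm_apply (hasDerivAt_const s (a - b))
      exact h3.congr_deriv (by rw [((fderiv ℝ f ∘ γ) s).map_zero, add_zero])
    have hinc : ∀ D s t : ℝ, s ≤ t → (∀ r ∈ Set.Ioo s t, γ r ≠ 0) →
        (∀ r ∈ Set.Ioo s t, D ≤ fderiv ℝ (fderiv ℝ f) (γ r) (a - b) (a - b)) →
        D * (t - s) ≤ g t - g s := by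
      intro D s t hst h0 hD
      refine (convex_Icc s t).mul_sub_le_image_sub_of_le_deriv hgc.continuousOn ?_ ?_ s
        (Set.left_mem_Icc.2 hst) t (Set.right_mem_Icc.2 hst) hst
      · rw [interior_Icc]
        exact fun r hr => (hgd r (h0 r hr)).differentiableAt.differentiableWithinAt
      · rw [interior_Icc]
        intro r hr
        rw [(hgd r (h0 r hr)).deriv]
        exact hD r hr
    have hnn : ∀ s t : ℝ, s ≤ t → (∀ r ∈ Set.Ioo s t, γ r ≠ 0) → g s ≤ g t := by
      intro s t hst h0
      have := hinc 0 s t hst h0 fun r hr =>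
        le_trans (by positivity) (hell (γ r) (h0 r hr) (a - b))
      linarith
    have h1 : g 0 ≤ g (3 / 4) := by
      -- The segment meets the origin at most once. As `g` is continuous there, monotonicity on the
      -- two sides can be joined.
      by_cases hz : ∃ s₀ ∈ Set.Ioo (0 : ℝ) (3 / 4), γ s₀ = 0
      · obtain ⟨s₀, hs₀, hz⟩ := hz
        have huniq : ∀ r, r ≠ s₀ → γ r ≠ 0 := by
          intro r hr h0
          have : (r - s₀) • (a - b) = γ r - γ s₀ := by simp only [hγ, sub_smul]; abel
          rw [h0, hz, sub_zero] at this
          rcases smul_eq_zero.1 this with h | h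
          · exact hr (sub_eq_zero.1 h)
          · exact hsub h
        exact (hnn 0 s₀ hs₀.1.le fun r hr => huniq r hr.2.ne).trans
          (hnn s₀ _ hs₀.2.le fun r hr => huniq r hr.1.ne')
      · push Not at hz
        exact hnn 0 _ (by norm_num) hz
    have hlow : ∀ s ∈ Set.Ioo (3 / 4 : ℝ) 1, 1 / 4 * (‖a‖ + ‖b‖) ≤ ‖γ s‖ := by
      intro s hs
      have e : γ s = s • a - (-(1 - s)) • b := by simp only [hγ]; module
      have := norm_sub_norm_le (s • a) ((-(1 - s)) • b)
      rw [← e, norm_smul, norm_smul, norm_neg, Real.norm_of_nonneg (by linarith [hs.1]),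
        Real.norm_of_nonneg (by linarith [hs.2])] at this
      nlinarith [hs.1, hs.2, norm_nonneg a, norm_nonneg b]
    have hpos : 0 < ‖a‖ + ‖b‖ := by
      rcases (by positivity : 0 ≤ ‖a‖ + ‖b‖).eq_or_lt with h | h
      · have ha : a = 0 := norm_eq_zero.1 (by linarith [norm_nonneg a, norm_nonneg b])
        have hb : b = 0 := norm_eq_zero.1 (by linarith [norm_nonneg a, norm_nonneg b])
        exact absurd (ha.trans hb.symm) heq
      · exact h
    have hne : ∀ r ∈ Set.Ioo (3 / 4 : ℝ) 1, γ r ≠ 0 := fun r hr =>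
      norm_pos_iff.1 (lt_of_lt_of_le (by positivity) (hlow r hr))
    have h2 := hinc (c * (1 / 4 * (‖a‖ + ‖b‖)) ^ (p - 2) * ‖a - b‖ ^ 2) (3 / 4) 1 (by norm_num) hne
      fun r hr => by
        refine le_trans ?_ (hell (γ r) (hne r hr) (a - b))
        have := Real.rpow_le_rpow (by positivity) (hlow r hr) (by linarith : 0 ≤ p - 2)
        gcongr
    have h3 : (fderiv ℝ f a - fderiv ℝ f b) (a - b) = g 1 - g 0 := by
      simp [hg, hγ]
    rw [h3]
    rw [Real.mul_rpow (by norm_num) (by positivity)] at h2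
    nlinarith
  refine ⟨c * (1 / 4 : ℝ) ^ (p - 2) * (1 / 4), by positivity, fun a b => ?_⟩
  rcases le_total ‖b‖ ‖a‖ with h | h
  · exact hkey a b h
  · have := hkey b a h
    rw [add_comm ‖b‖, norm_sub_rev b a] at this
    refine this.trans_eq ?_
    rw [← neg_sub (fderiv ℝ f a), ← neg_sub a b, map_neg, neg_apply, neg_neg]

end

/-! ### Translations, difference quotients and weak derivatives in L^q. -/

section

open Filter Topology ENNReal

variable {n : ℕ}

/-- Smooth functions with compact support on the whole space. -/
structure IsBumpFun (φ : E n → ℝ) : Prop where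
  smooth : ContDiff ℝ (⊤ : ℕ∞) φ
  compact : HasCompactSupport φ

/-- `g` is the distributional derivative of `h` in the direction `e` on the whole space. -/
def IsWeakDeriv (e : E n) (h g : E n → ℝ) : Prop :=
  ∀ φ : E n → ℝ, IsBumpFun φ → ∫ x, h x * fderiv ℝ φ x e = -∫ x, g x * φ x

/-- The difference quotient of `h` in the direction `e`, with step `t`. -/
def dq (e : E n) (t : ℝ) (h : E n → ℝ) (x : E n) : ℝ := t⁻¹ * (h (x + t • e) - h x)

theorem IsBumpFun.comp_add {φ : E n → ℝ} (hφ : IsBumpFun φ) (y : E n) :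
    IsBumpFun fun x => φ (x + y) :=
  ⟨hφ.smooth.comp (contDiff_id.add contDiff_const),
    hφ.compact.comp_homeomorph (Homeomorph.addRight y)⟩

theorem IsBumpFun.continuous {φ : E n → ℝ} (hφ : IsBumpFun φ) : Continuous φ := hφ.smooth.continuous

theorem IsBumpFun.differentiable {φ : E n → ℝ} (hφ : IsBumpFun φ) : Differentiable ℝ φ :=
  hφ.smooth.differentiable (by simp)

theorem IsBumpFun.memLp {φ : E n → ℝ} (hφ : IsBumpFun φ) (q : ℝ≥0∞) : MemLp φ q :=
  hφ.continuous.memLp_of_hasCompactSupport hφ.compact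

theorem IsBumpFun.continuous_fderiv {φ : E n → ℝ} (hφ : IsBumpFun φ) (e : E n) :
    Continuous fun x => fderiv ℝ φ x e :=
  (hφ.smooth.continuous_fderiv (by simp)).clm_apply continuous_const

theorem IsBumpFun.hasCompactSupport_fderiv {φ : E n → ℝ} (hφ : IsBumpFun φ) (e : E n) :
    HasCompactSupport fun x => fderiv ℝ φ x e :=
  hφ.compact.fderiv_apply ℝ e

theorem fderiv_translate (φ : E n → ℝ) (x y : E n) :
    fderiv ℝ (fun z => φ (z + y)) x = fderiv ℝ φ (x + y) := fderiv_comp_add_right y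

theorem integral_mul_translate (h φ : E n → ℝ) (y : E n) :
    ∫ x, h (x + y) * φ x = ∫ x, h x * φ (x - y) := by
  rw [← integral_add_right_eq_self (fun x => h x * φ (x - y)) y]
  simp

/-- The integral is the convolution of `h` with y ↦ φ(-y) at the point s e, and a convolution is
differentiated on its smooth factor. Hence `h` only has to be locally integrable. -/
theorem hasDerivAt_integral_translate {h φ : E n → ℝ} (hh : LocallyIntegrable h)
    (hφ : IsBumpFun φ) (e : E n) (t : ℝ) :
    HasDerivAt (fun s : ℝ => ∫ x, h x * φ (x - s • e))
      (-∫ x, h x * fderiv ℝ φ (x - t • e) e) t := by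
  have hφ1 : ContDiff ℝ 1 (fun y => φ (-y)) := (hφ.smooth.comp contDiff_neg).of_le (by simp)
  have hφc : HasCompactSupport (fun y => φ (-y)) := hφ.compact.comp_homeomorph (Homeomorph.neg _)
  have h1 := hφc.hasFDerivAt_convolution_right (ContinuousLinearMap.mul ℝ ℝ) hh hφ1 (t • e)
  have h2 : HasDerivAt (fun s : ℝ => s • e) e t := by
    simpa using (hasDerivAt_id t).smul_const e
  have h3 := h1.comp_hasDerivAt t h2
  refine (h3.congr_deriv ?_).congr_of_eventuallyEq (Eventually.of_forall fun s => ?_)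
  · have hint : Integrable (fun x => ((ContinuousLinearMap.mul ℝ ℝ).precompR (E n)) (h x)
        (fderiv ℝ (fun y => φ (-y)) (t • e - x))) := by
      have := (hφc.fderiv (𝕜 := ℝ)).convolutionExists_right
        ((ContinuousLinearMap.mul ℝ ℝ).precompR (E n)) hh (hφ1.continuous_fderiv one_ne_zero)
      exact this (t • e)
    rw [convolution, ContinuousLinearMap.integral_apply hint, ← integral_neg]
    refine integral_congr_ae (Eventually.of_forall fun x => ?_)
    have : fderiv ℝ (fun y => φ (-y)) (t • e - x) = -fderiv ℝ φ (-(t • e - x)) := by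
      have := (hφ.differentiable (-(t • e - x))).hasFDerivAt.comp (t • e - x)
        (hasFDerivAt_id (t • e - x)).neg
      refine this.fderiv.trans ?_
      ext v
      simp
    simp only [ContinuousLinearMap.precompR_apply, this, neg_sub]
    simp
  · simp only [Function.comp, convolution, ContinuousLinearMap.mul_apply', neg_sub]

/-- Translation by `y` on `L^q`. -/
def transl (q : ℝ≥0∞) (y : E n) (h : Lp ℝ q (volume : Measure (E n))) :
    Lp ℝ q (volume : Measure (E n)) :=
  Lp.compMeasurePreserving (fun x => x + y) (measurePreserving_add_right volume y) h

theorem continuous_transl {q : ℝ≥0∞} [Fact (1 ≤ q)] (hq : q ≠ ∞)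
    (h : Lp ℝ q (volume : Measure (E n))) : Continuous fun y => transl q y h := by
  let g : C(E n, C(E n, E n)) :=
    (ContinuousMap.mk (fun a : E n × E n => a.2 + a.1) (by fun_prop)).curry
  exact continuous_const.compMeasurePreservingLp g.continuous
    (fun y => measurePreserving_add_right volume y) hq

theorem coeFn_transl {q : ℝ≥0∞} (y : E n) (h : Lp ℝ q (volume : Measure (E n))) :
    transl q y h =ᵐ[volume] fun x => h (x + y) :=
  Lp.coeFn_compMeasurePreserving _ _

theorem transl_toLp {q : ℝ≥0∞} {h : E n → ℝ} (hh : MemLp h q) (y : E n) :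
    transl q y (hh.toLp h) =
      (hh.comp_measurePreserving (measurePreserving_add_right volume y)).toLp _ := rfl

theorem transl_zero {q : ℝ≥0∞} (h : Lp ℝ q (volume : Measure (E n))) : transl q 0 h = h := by
  refine Lp.ext ((coeFn_transl 0 h).trans ?_)
  simp

section Pairing

variable (q q' : ℝ≥0∞) [Fact (1 ≤ q)] [Fact (1 ≤ q')] [ENNReal.HolderConjugate q' q]

/-- Integration against an `L^{q'}` function, as a functional on `L^q`. -/
def pairing (w : Lp ℝ q' (volume : Measure (E n))) : Lp ℝ q (volume : Measure (E n)) →L[ℝ] ℝ :=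
  (ContinuousLinearMap.mul ℝ ℝ).lpPairing volume q' q w

variable {q q'}

theorem pairing_toLp {w h : E n → ℝ} (hw : MemLp w q') (hh : MemLp h q) :
    pairing q q' (hw.toLp w) (hh.toLp h) = ∫ x, h x * w x := by
  rw [pairing, ContinuousLinearMap.lpPairing_eq_integral]
  refine integral_congr_ae ?_
  filter_upwards [hw.coeFn_toLp, hh.coeFn_toLp] with x h1 h2
  rw [h1, h2, ContinuousLinearMap.mul_apply', mul_comm]

end Pairing

theorem Lp.eq_of_forall_pairing {q q' : ℝ≥0∞} [Fact (1 ≤ q)] [Fact (1 ≤ q')]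
    [ENNReal.HolderConjugate q' q] {u v : Lp ℝ q (volume : Measure (E n))}
    (huv : ∀ φ (hφ : IsBumpFun φ), pairing q q' ((hφ.memLp q').toLp φ) u =
      pairing q q' ((hφ.memLp q').toLp φ) v) : u = v := by
  refine Lp.ext (ae_eq_of_integral_contDiff_smul_eq
    ((Lp.memLp u).locallyIntegrable Fact.out) ((Lp.memLp v).locallyIntegrable Fact.out) ?_)
  intro φ hφ hφc
  have := huv φ ⟨hφ, hφc⟩
  have e : ∀ z : Lp ℝ q (volume : Measure (E n)),
      pairing q q' ((IsBumpFun.memLp ⟨hφ, hφc⟩ q').toLp φ) z = ∫ x, φ x • z x := by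
    intro z
    conv_lhs => rw [← Lp.toLp_coeFn z (Lp.memLp z)]
    rw [pairing_toLp]
    simp only [smul_eq_mul, mul_comm]
  rwa [e, e] at this

theorem pairing_transl_toLp {q q' : ℝ≥0∞} [Fact (1 ≤ q)] [Fact (1 ≤ q')]
    [ENNReal.HolderConjugate q' q] {w h : E n → ℝ} (hw : MemLp w q') (hh : MemLp h q) (y : E n) :
    pairing q q' (hw.toLp w) (transl q y (hh.toLp h)) = ∫ x, h x * w (x - y) := by
  rw [transl_toLp, pairing_toLp]
  exact integral_mul_translate h w y

/-- The difference quotients of a function with a weak derivative converge in `L^q`. -/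
theorem tendsto_dq_of_isWeakDeriv {q q' : ℝ≥0∞} [Fact (1 ≤ q)] [Fact (1 ≤ q')]
    [ENNReal.HolderConjugate q' q] (hq : q ≠ ∞) {h g : E n → ℝ} (hh : MemLp h q)
    (hg : MemLp g q) {e : E n} (hw : IsWeakDeriv e h g) :
    Tendsto (fun t => eLpNorm (fun x => dq e t h x - g x) q volume) (𝓝[≠] 0) (𝓝 0) := by
  have hcont : Continuous fun s : ℝ => transl q (s • e) (hg.toLp g) :=
    (continuous_transl hq _).comp (by fun_prop)
  have hhl : LocallyIntegrable h := hh.locallyIntegrable Fact.out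
  -- The fundamental theorem of calculus as an identity in L^q, checked against test functions. Its
  -- right-hand side is the integral of a continuous curve, hence differentiable in L^q at t = 0,
  -- with derivative `g`.
  have key : ∀ t : ℝ, transl q (t • e) (hh.toLp h) = hh.toLp h +
      ∫ s in (0 : ℝ)..t, transl q (s • e) (hg.toLp g) := by
    intro t
    refine Lp.eq_of_forall_pairing (q' := q') fun φ hφ => ?_
    rw [map_add, ← ContinuousLinearMap.intervalIntegral_comp_comm _
      (hcont.intervalIntegrable _ _)]
    have hd : ∀ s : ℝ, HasDerivAt (fun s : ℝ => ∫ x, h x * φ (x - s • e))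
        (∫ x, g x * φ (x - s • e)) s := by
      intro s
      have h1 := hasDerivAt_integral_translate hhl hφ e s
      have h2 := hw _ (hφ.comp_add (-(s • e)))
      simp only [← sub_eq_add_neg] at h2
      have h3 : ∀ x, fderiv ℝ (fun x => φ (x - s • e)) x = fderiv ℝ φ (x - s • e) :=
        fun x => fderiv_comp_sub _
      simp only [h3] at h2
      rwa [h2, neg_neg] at h1
    have hc' : Continuous fun s : ℝ => ∫ x, g x * φ (x - s • e) := by
      have := (pairing q q' ((hφ.memLp q').toLp φ)).continuous.comp hcont
      simpa only [Function.comp_def, pairing_transl_toLp] using this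
    simp only [pairing_transl_toLp, pairing_toLp]
    rw [intervalIntegral.integral_eq_sub_of_hasDerivAt (fun s _ => hd s)
      (hc'.intervalIntegrable _ _)]
    simp
  have hder : HasDerivAt (fun t : ℝ => transl q (t • e) (hh.toLp h)) (hg.toLp g) 0 := by
    have h1 := (hcont.integral_hasStrictDerivAt 0 0).hasDerivAt
    simp only [zero_smul, transl_zero] at h1
    have h2 := h1.const_add (hh.toLp h)
    exact h2.congr_of_eventuallyEq (Eventually.of_forall key)
  rw [hasDerivAt_iff_tendsto_slope_zero, Lp.tendsto_Lp_iff_tendsto_eLpNorm] at hder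
  refine hder.congr fun t => eLpNorm_congr_ae ?_
  simp only [zero_add, zero_smul, transl_zero]
  filter_upwards [Lp.coeFn_smul (t⁻¹) (transl q (t • e) (hh.toLp h) - hh.toLp h),
    Lp.coeFn_sub (transl q (t • e) (hh.toLp h)) (hh.toLp h), hh.coeFn_toLp,
    (hh.comp_measurePreserving (measurePreserving_add_right volume (t • e))).coeFn_toLp]
    with x h1 h2 h3 h4
  rw [transl_toLp] at h1 h2 ⊢
  simp only [Pi.sub_apply, h1, Pi.smul_apply, h2, h3, h4, dq, smul_eq_mul, Function.comp]

/-- A square integrable function with bounded difference quotients has a weak derivative. -/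
theorem exists_isWeakDeriv_of_dq_bounded {h : E n → ℝ} (hh : MemLp h 2) (e : E n) (C : ℝ)
    (hb : ∀ᶠ t in 𝓝[≠] (0 : ℝ), eLpNorm (dq e t h) 2 volume ≤ ENNReal.ofReal C) :
    ∃ g : E n → ℝ, MemLp g 2 ∧ IsWeakDeriv e h g := by
  set D : ℝ → Lp ℝ 2 (volume : Measure (E n)) :=
    fun t => t⁻¹ • (transl 2 (t • e) (hh.toLp h) - hh.toLp h) with hD
  have hDae : ∀ t, D t =ᵐ[volume] dq e t h := by
    intro t
    filter_upwards [Lp.coeFn_smul (t⁻¹) (transl 2 (t • e) (hh.toLp h) - hh.toLp h),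
      Lp.coeFn_sub (transl 2 (t • e) (hh.toLp h)) (hh.toLp h), hh.coeFn_toLp,
      (hh.comp_measurePreserving (measurePreserving_add_right volume (t • e))).coeFn_toLp]
      with x h1 h2 h3 h4
    rw [transl_toLp] at h2
    rw [transl_toLp] at h1
    simp only [hD, transl_toLp, Pi.sub_apply, h1, Pi.smul_apply, h2, h3, h4, dq, smul_eq_mul,
      Function.comp]
  have hDn : ∀ᶠ t in 𝓝[≠] (0 : ℝ), ‖D t‖ ≤ max C 0 := by
    filter_upwards [hb] with t ht
    rw [Lp.norm_def, eLpNorm_congr_ae (hDae t)]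
    refine ENNReal.toReal_le_of_le_ofReal (le_max_right _ _) (ht.trans ?_)
    exact ENNReal.ofReal_le_ofReal (le_max_left _ _)
  -- Weak compactness: near t = 0 the quotients stay in a ball of the dual of L², compact for the
  -- weak-* topology by Banach–Alaoglu. An ultrafilter finer than the punctured neighbourhoods of 0
  -- selects a limit without extracting a sequence.
  set U : Ultrafilter ℝ := Ultrafilter.of (𝓝[≠] (0 : ℝ)) with hU
  have hUle : (U : Filter ℝ) ≤ 𝓝[≠] 0 := Ultrafilter.of_le _
  set T : ℝ → WeakDual ℝ (Lp ℝ 2 (volume : Measure (E n))) := fun t =>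
    StrongDual.toWeakDual (InnerProductSpace.toDual ℝ _ (D t)) with hT
  have hcpt := WeakDual.isCompact_closedBall (𝕜 := ℝ)
    (0 : StrongDual ℝ (Lp ℝ 2 (volume : Measure (E n)))) (max C 0)
  obtain ⟨ℓ, -, hℓ⟩ := hcpt.ultrafilter_le_nhds (U.map T) (by
    rw [le_principal_iff]
    refine hUle (hDn.mono fun t ht => ?_)
    simp only [Set.mem_preimage, mem_closedBall_zero_iff]
    exact ((InnerProductSpace.toDual ℝ _).norm_map (D t)).le.trans ht)
  set g := (InnerProductSpace.toDual ℝ _).symm (WeakDual.toStrongDual ℓ) with hg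
  have hlim : ∀ v, Tendsto (fun t => inner ℝ (D t) v) U (𝓝 (inner ℝ g v)) := by
    intro v
    have h1 : Tendsto (fun t => T t v) U (𝓝 (ℓ v)) :=
      ((WeakDual.eval_continuous v).tendsto ℓ).comp hℓ
    have h2 : inner ℝ g v = ℓ v := by
      rw [hg, InnerProductSpace.toDual_symm_apply]; rfl
    rw [h2]
    exact h1
  refine ⟨g, Lp.memLp g, fun φ hφ => ?_⟩
  have h1 := hlim ((hφ.memLp 2).toLp φ)
  have h2 : ∀ t, inner ℝ (D t) ((hφ.memLp 2).toLp φ) =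
      t⁻¹ • ((∫ x, h x * φ (x - (0 + t) • e)) - ∫ x, h x * φ (x - (0 : ℝ) • e)) := by
    intro t
    have hp : ∀ y, inner ℝ (transl 2 y (hh.toLp h)) ((hφ.memLp 2).toLp φ) =
        ∫ x, h x * φ (x - y) := by
      intro y
      rw [← integral_mul_translate, L2.inner_def, transl_toLp]
      refine integral_congr_ae ?_
      filter_upwards [(hh.comp_measurePreserving
        (measurePreserving_add_right volume y)).coeFn_toLp, (hφ.memLp 2).coeFn_toLp] with x a b
      rw [a, b]
      simp [mul_comm]
    rw [hD, inner_smul_left, inner_sub_left, hp, zero_add]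
    conv_lhs => rw [← transl_zero (hh.toLp h), hp]
    simp
  simp only [h2] at h1
  have h3 := (hasDerivAt_integral_translate (hh.locallyIntegrable (by norm_num)) hφ e
    0).tendsto_slope_zero.mono_left hUle
  have h4 := tendsto_nhds_unique h1 h3
  simp only [zero_smul, sub_zero] at h4
  rw [L2.inner_def] at h4
  have h5 : ∫ x, g x * φ x = ∫ x, inner ℝ (g x) (((hφ.memLp 2).toLp φ : Lp ℝ 2 volume) x) := by
    refine integral_congr_ae ?_
    filter_upwards [(hφ.memLp 2).coeFn_toLp] with x a
    rw [a]
    simp [mul_comm]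
  rw [h5, h4, neg_neg]

end

/-! ### Mollification, and testing divergence free fields with Sobolev functions. -/

section

open Filter Topology ENNReal

variable {n : ℕ}

theorem IsTest.isBumpFun {O : Set (E n)} {φ : E n → ℝ} (hφ : IsTest O φ) : IsBumpFun φ :=
  ⟨hφ.smooth, hφ.compact⟩

theorem IsTest.mono {O O' : Set (E n)} (h : O ⊆ O') {φ : E n → ℝ} (hφ : IsTest O φ) :
    IsTest O' φ :=
  ⟨hφ.smooth, hφ.compact, hφ.supp.trans h⟩

/-- The derivative of the mollification is the mollification of the weak derivative. -/
theorem fderiv_convolution_of_isWeakDeriv {η U Ξ : E n → ℝ} (hη : IsBumpFun η)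
    (hU : LocallyIntegrable U) {e : E n} (hw : IsWeakDeriv e U Ξ) (x : E n) :
    fderiv ℝ (convolution η U (ContinuousLinearMap.mul ℝ ℝ) volume) x e =
      ∫ t, η t * Ξ (x - t) := by
  have h1 := hη.compact.hasFDerivAt_convolution_left (ContinuousLinearMap.mul ℝ ℝ)
    (hη.smooth.of_le (by simp)) hU x
  have hint : Integrable (fun t => ((ContinuousLinearMap.mul ℝ ℝ).precompL (E n)) (fderiv ℝ η t)
      (U (x - t))) := by
    have := (hη.compact.fderiv (𝕜 := ℝ)).convolutionExists_left
      ((ContinuousLinearMap.mul ℝ ℝ).precompL (E n)) (hη.smooth.continuous_fderiv (by simp)) hU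
    exact this x
  rw [h1.fderiv, convolution, ContinuousLinearMap.integral_apply hint]
  simp only [ContinuousLinearMap.precompL_apply, ContinuousLinearMap.mul_apply']
  have hψ : IsBumpFun fun y => η (x - y) :=
    ⟨hη.smooth.comp (contDiff_const.sub contDiff_id),
      hη.compact.comp_homeomorph (Homeomorph.subLeft x)⟩
  have h2 := hw _ hψ
  have h3 : ∀ y, fderiv ℝ (fun y => η (x - y)) y e = -fderiv ℝ η (x - y) e := by
    intro y
    have := (hη.differentiable (x - y)).hasFDerivAt.comp y ((hasFDerivAt_id y).const_sub x)
    have h : fderiv ℝ (fun y => η (x - y)) y = _ := this.fderiv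
    rw [h]
    simp
  simp only [h3, mul_neg, integral_neg, neg_inj] at h2
  rw [← integral_sub_left_eq_self (fun t => fderiv ℝ η t e * U (x - t)) volume x,
    ← integral_sub_left_eq_self (fun t => η t * Ξ (x - t)) volume x]
  simp only [_root_.sub_sub_cancel]
  simp only [mul_comm] at h2 ⊢
  exact h2

/-- Integrability on the product, needed for Fubini. The inner integral of the absolute value is
|η(y)| times the pairing of |w| with a translate of |Ξ|, which is continuous in y, and η has compact
support. -/
theorem integrable_mul_mul_translate {q q' : ℝ≥0∞} [Fact (1 ≤ q)] [Fact (1 ≤ q')]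
    [ENNReal.HolderConjugate q' q] (hq : q ≠ ∞) {η w Ξ : E n → ℝ} (hη : IsBumpFun η)
    (hw : MemLp w q') (hΞ : MemLp Ξ q) :
    Integrable (fun z : E n × E n => w z.1 * (η z.2 * Ξ (z.1 - z.2))) (volume.prod volume) := by
  have hm : AEStronglyMeasurable (fun z : E n × E n => w z.1 * (η z.2 * Ξ (z.1 - z.2)))
      (volume.prod volume) :=
    hw.1.comp_fst.mul ((ContinuousLinearMap.mul ℝ ℝ).aestronglyMeasurable_comp₂
      (hη.continuous.aestronglyMeasurable.comp_snd)
      (hΞ.1.comp_quasiMeasurePreserving (quasiMeasurePreserving_sub_of_right_invariant _ _)))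
  have htr : ∀ y : E n, MemLp (fun x => Ξ (x - y)) q := fun y => by
    have := hΞ.comp_measurePreserving (measurePreserving_add_right volume (-y))
    simpa only [Function.comp_def, ← sub_eq_add_neg] using this
  rw [integrable_prod_iff' hm]
  constructor
  · refine Eventually.of_forall fun y => ?_
    have := (hw.integrable_mul (htr y)).const_mul (η y)
    refine this.congr (Eventually.of_forall fun x => ?_)
    simp only [Pi.mul_apply]
    ring
  · have hc : Continuous fun y : E n => pairing q q' (hw.abs.toLp _)
        (transl q (-y) (hΞ.abs.toLp _)) :=
      (pairing q q' _).continuous.comp ((continuous_transl hq _).comp continuous_neg)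
    have hi : Integrable fun y : E n => |η y| * pairing q q' (hw.abs.toLp _)
        (transl q (-y) (hΞ.abs.toLp _)) :=
      (hη.continuous.abs.mul hc).integrable_of_hasCompactSupport
        (hη.compact.abs.mul_right)
    refine hi.congr (Eventually.of_forall fun y => ?_)
    simp only
    rw [pairing_transl_toLp, ← integral_mul_translate, ← integral_const_mul]
    refine integral_congr_ae (Eventually.of_forall fun x => ?_)
    simp only [norm_mul, Real.norm_eq_abs, Pi.abs_apply, ← sub_eq_add_neg]
    ring

/-- A field in `L^{q'}` which is weakly divergence free in `O` is orthogonal to the gradients of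
all `W^{1,q}` functions with compact support in `O`. -/
theorem integral_eq_zero_of_divFree {q q' : ℝ≥0∞} [Fact (1 ≤ q)] [Fact (1 ≤ q')]
    [ENNReal.HolderConjugate q' q] (hq : q ≠ ∞) {S O : Set (E n)} (hS : IsCompact S)
    (hO : IsOpen O) (hSO : S ⊆ O) {w Ξ : Fin n → E n → ℝ} (hw : ∀ k, MemLp (w k) q')
    (hdiv : ∀ φ, IsTest O φ → ∫ x, ∑ k, w k x * pd k φ x = 0) {U : E n → ℝ} (hU : MemLp U q)
    (hΞ : ∀ k, MemLp (Ξ k) q) (hweak : ∀ k, IsWeakDeriv (EuclideanSpace.single k 1) U (Ξ k))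
    (hUS : ∀ x, x ∉ S → U x = 0) : ∫ x, ∑ k, w k x * Ξ k x = 0 := by
  have hUl : LocallyIntegrable U := hU.locallyIntegrable Fact.out
  -- `c y` pairs `w` with the translate of `Ξ` by y. A mollification of `U` at a small scale is a
  -- test function in `O`, and testing with it says that the corresponding average of `c` around 0
  -- vanishes; continuity of `c` then gives `c 0 = 0`.
  set c : E n → ℝ := fun y => ∑ k, pairing q q' ((hw k).toLp _) (transl q y ((hΞ k).toLp _))
    with hc
  have hcc : Continuous c := continuous_finsetSum _ fun k _ =>
    (pairing q q' _).continuous.comp (continuous_transl hq _)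
  have hc0 : c 0 = ∫ x, ∑ k, w k x * Ξ k x := by
    have hi : ∀ k, Integrable fun x => w k x * Ξ k x := fun k => (hw k).integrable_mul (hΞ k)
    rw [integral_finsetSum _ fun k _ => hi k]
    refine Finset.sum_congr rfl fun k _ => ?_
    rw [transl_zero, pairing_toLp]
    simp only [mul_comm]
  rw [← hc0]
  obtain ⟨δ, hδ, hδO⟩ := hS.exists_cthickening_subset_open hO hSO
  have hzero : ∀ b : ContDiffBump (0 : E n), b.rOut ≤ δ →
      convolution (b.normed volume) c (ContinuousLinearMap.lsmul ℝ ℝ) volume 0 = 0 := by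
    intro b hb
    set η := b.normed (volume : Measure (E n)) with hη
    have hηb : IsBumpFun η := ⟨b.contDiff_normed, b.hasCompactSupport_normed⟩
    set φ := convolution η U (ContinuousLinearMap.mul ℝ ℝ) volume with hφ
    have hsupp : tsupport φ ⊆ Metric.cthickening δ S := by
      refine closure_minimal (fun x hx => ?_) Metric.isClosed_cthickening
      obtain ⟨a, ha, s, hs, rfl⟩ := support_convolution_subset_swap _ hx
      have hsS : a ∈ S := by
        by_contra h
        exact ha (hUS a h)
      have hsn : s ∈ Metric.ball (0 : E n) b.rOut := by
        rwa [hη, ContDiffBump.support_normed_eq] at hs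
      refine Metric.mem_cthickening_of_dist_le _ a δ S hsS ?_
      rw [dist_eq_norm]
      simp only [add_sub_cancel_left]
      rw [mem_ball_zero_iff] at hsn
      linarith
    have hφt : IsTest O φ :=
      ⟨hηb.compact.contDiff_convolution_left _ hηb.smooth hUl,
        hS.cthickening.of_isClosed_subset (isClosed_tsupport _) hsupp, hsupp.trans hδO⟩
    have h1 := hdiv φ hφt
    have h2 : ∀ k x, pd k φ x = ∫ t, η t * Ξ k (x - t) := fun k x =>
      fderiv_convolution_of_isWeakDeriv hηb hUl (hweak k) x
    have hint : ∀ k, Integrable (fun z : E n × E n => w k z.1 * (η z.2 * Ξ k (z.1 - z.2)))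
        (volume.prod volume) := fun k => integrable_mul_mul_translate hq hηb (hw k) (hΞ k)
    have hint' : ∀ k, Integrable fun x => w k x * ∫ t, η t * Ξ k (x - t) := by
      intro k
      have := (hint k).integral_prod_left
      simpa only [integral_const_mul] using this
    simp only [h2] at h1
    rw [integral_finsetSum _ fun k _ => hint' k] at h1
    rw [convolution, ← h1]
    simp only [ContinuousLinearMap.lsmul_apply, smul_eq_mul, zero_sub, hc, Finset.mul_sum]
    have hi2 : ∀ k, Integrable fun t => η t * pairing q q' ((hw k).toLp _)
        (transl q (-t) ((hΞ k).toLp _)) := fun k =>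
      (hηb.continuous.mul ((pairing q q' _).continuous.comp
        ((continuous_transl hq _).comp continuous_neg))).integrable_of_hasCompactSupport
          hηb.compact.mul_right
    rw [integral_finsetSum _ fun k _ => hi2 k]
    refine Finset.sum_congr rfl fun k _ => ?_
    have hsw := integral_integral_swap (f := fun x t => w k x * (η t * Ξ k (x - t))) (hint k)
    simp only [integral_const_mul] at hsw
    rw [hsw]
    refine integral_congr_ae (Eventually.of_forall fun t => ?_)
    simp only
    rw [pairing_transl_toLp, ← integral_mul_translate, ← integral_const_mul]
    refine integral_congr_ae (Eventually.of_forall fun x => ?_)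
    simp only [← sub_eq_add_neg]
    ring
  by_contra hne
  have hpos : 0 < |c 0| / 2 := by positivity
  obtain ⟨r, hr, hball⟩ := Metric.continuousAt_iff.1 hcc.continuousAt _ hpos
  have hm : 0 < min r δ := lt_min hr hδ
  let b : ContDiffBump (0 : E n) := ⟨min r δ / 2, min r δ, by positivity, by linarith⟩
  have h3 := b.dist_normed_convolution_le (μ := volume) (g := c) (x₀ := 0)
    hcc.aestronglyMeasurable (ε := |c 0| / 2)
    (fun x hx => (hball (lt_of_lt_of_le (Metric.mem_ball.1 hx) (min_le_left _ _))).le)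
  rw [hzero b (min_le_right _ _), dist_zero_left, Real.norm_eq_abs] at h3
  linarith

end

/-! ### Local L² limits of difference quotients, and the chain rule. -/

section

open Filter Topology ENNReal

variable {n : ℕ}

theorem tendsto_eLpNorm_two_of_dominated {α ι : Type*} [MeasurableSpace α] {ν : Measure α}
    {l : Filter ι} [l.IsCountablyGenerated] {F : ι → α → ℝ} {b : α → ℝ} (hb : MemLp b 2 ν)
    (hF : ∀ᶠ i in l, AEStronglyMeasurable (F i) ν) (hbd : ∀ᶠ i in l, ∀ᵐ x ∂ν, |F i x| ≤ b x)
    (hlim : ∀ᵐ x ∂ν, Tendsto (fun i => F i x) l (𝓝 0)) :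
    Tendsto (fun i => eLpNorm (F i) 2 ν) l (𝓝 0) := by
  have e : ∀ f : α → ℝ, eLpNorm f 2 ν ^ (2 : ℝ) = ∫⁻ x, ‖f x‖ₑ ^ (2 : ℝ) ∂ν := fun f => by
    simpa using eLpNorm_nnreal_pow_eq_lintegral (f := f) (μ := ν) (p := 2) two_ne_zero
  have h1 : Tendsto (fun i => ∫⁻ x, ‖F i x‖ₑ ^ (2 : ℝ) ∂ν) l (𝓝 (∫⁻ _, 0 ∂ν)) := by
    refine tendsto_lintegral_filter_of_dominated_convergence' (fun x => ‖b x‖ₑ ^ (2 : ℝ))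
      ?_ ?_ ?_ ?_
    · filter_upwards [hF] with i hi using hi.enorm.pow_const _
    · filter_upwards [hbd] with i hi
      filter_upwards [hi] with x hx
      gcongr
      exact enorm_le_iff_norm_le.2 (hx.trans (le_abs_self _))
    · rw [← e]
      exact (ENNReal.rpow_lt_top_of_nonneg (by norm_num) hb.2.ne).ne
    · filter_upwards [hlim] with x hx
      have := (ENNReal.continuous_rpow_const (y := 2)).continuousAt.tendsto.comp
        ((continuous_enorm.tendsto (0 : ℝ)).comp hx)
      simpa [Function.comp_def] using this
  simp only [lintegral_zero, ← e] at h1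
  have h2 := ((ENNReal.continuous_rpow_const (y := 2⁻¹)).tendsto 0).comp h1
  simp only [Function.comp_def, ← ENNReal.rpow_mul] at h2
  simpa using h2

theorem tendsto_eLpNorm_zero_mono {α ι : Type*} [MeasurableSpace α] {ν : Measure α}
    {l : Filter ι} {q : ℝ≥0∞} {F : ι → α → ℝ} {B : ι → ℝ≥0∞} (hB : Tendsto B l (𝓝 0))
    (h : ∀ᶠ i in l, eLpNorm (F i) q ν ≤ B i) : Tendsto (fun i => eLpNorm (F i) q ν) l (𝓝 0) :=
  tendsto_of_tendsto_of_tendsto_of_le_of_le' tendsto_const_nhds hB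
    (Eventually.of_forall fun _ => zero_le) h

theorem tendsto_integral_mul_of_tendsto_eLpNorm {α ι : Type*} [MeasurableSpace α] {ν : Measure α}
    {l : Filter ι} {A B : ι → α → ℝ} {a b : α → ℝ} (hA : ∀ᶠ i in l, MemLp (A i) 2 ν)
    (hB : ∀ᶠ i in l, MemLp (B i) 2 ν) (ha : MemLp a 2 ν) (hb : MemLp b 2 ν)
    (h1 : Tendsto (fun i => eLpNorm (fun x => A i x - a x) 2 ν) l (𝓝 0))
    (h2 : Tendsto (fun i => eLpNorm (fun x => B i x - b x) 2 ν) l (𝓝 0)) :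
    Tendsto (fun i => ∫ x, A i x * B i x ∂ν) l (𝓝 (∫ x, a x * b x ∂ν)) := by
  have hmul : ∀ {f g : α → ℝ}, AEStronglyMeasurable f ν → AEStronglyMeasurable g ν →
      eLpNorm (fun x => f x * g x) 1 ν ≤ eLpNorm f 2 ν * eLpNorm g 2 ν := fun hf hg => by
    simpa using eLpNorm_le_eLpNorm_mul_eLpNorm_of_nnnorm (p := 2) (q := 2) (r := 1) hf hg
      (fun x y : ℝ => x * y) 1 (Eventually.of_forall fun x => by simp)
  refine tendsto_integral_of_L1' _ (ha.1.mul hb.1) ?_ ?_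
  · filter_upwards [hA, hB] with i hi hi' using hi.integrable_mul hi'
  · have hlim : Tendsto (fun i => eLpNorm (fun x => A i x - a x) 2 ν *
        eLpNorm (fun x => B i x - b x) 2 ν + eLpNorm (fun x => A i x - a x) 2 ν * eLpNorm b 2 ν +
        eLpNorm a 2 ν * eLpNorm (fun x => B i x - b x) 2 ν) l (𝓝 0) := by
      have t1 := ENNReal.Tendsto.mul h1 (Or.inr ENNReal.zero_ne_top) h2 (Or.inr ENNReal.zero_ne_top)
      have t2 := ENNReal.Tendsto.mul_const (b := eLpNorm b 2 ν) h1 (Or.inr hb.2.ne)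
      have t3 := ENNReal.Tendsto.const_mul (a := eLpNorm a 2 ν) h2 (Or.inr ha.2.ne)
      simpa using (t1.add t2).add t3
    refine tendsto_eLpNorm_zero_mono hlim ?_
    filter_upwards [hA, hB] with i hi hi'
    have mA := hi.1.sub ha.1
    have mB := hi'.1.sub hb.1
    have e : ((fun x => A i x * B i x) - a * b) =
        (fun x => (A i x - a x) * (B i x - b x)) + (fun x => (A i x - a x) * b x) +
          fun x => a x * (B i x - b x) := by
      funext x; simp only [Pi.sub_apply, Pi.add_apply, Pi.mul_apply]; ring
    rw [e]
    refine (eLpNorm_add_le ((mA.mul mB).add (mA.mul hb.1)) (ha.1.mul mB) le_rfl).trans ?_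
    refine add_le_add ((eLpNorm_add_le (mA.mul mB) (mA.mul hb.1) le_rfl).trans ?_) (hmul ha.1 mB)
    exact add_le_add (hmul mA mB) (hmul mA hb.1)

/-- `g` is the derivative in `Ω` of `h` in the direction `e`, as a local `L^2` limit of difference
quotients. -/
structure LocDiff (Ω : Set (E n)) (e : E n) (h g : E n → ℝ) : Prop where
  memLp : ∀ K, IsCompact K → MemLp h 2 (volume.restrict K)
  memLp_deriv : ∀ K, IsCompact K → K ⊆ Ω → MemLp g 2 (volume.restrict K)
  tendsto : ∀ K, IsCompact K → K ⊆ Ω →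
    Tendsto (fun t => eLpNorm (fun x => dq e t h x - g x) 2 (volume.restrict K)) (𝓝[≠] 0) (𝓝 0)

/-- The translate of K may leave Ω; this is why `LocDiff` asks for square integrability of the
function on all compact sets, not just those in Ω. -/
theorem memLp_comp_add {h : E n → ℝ} (hh : ∀ K, IsCompact K → MemLp h 2 (volume.restrict K))
    (y : E n) (K : Set (E n)) (hK : IsCompact K) :
    MemLp (fun x => h (x + y)) 2 (volume.restrict K) := by
  have hmp := (measurePreserving_add_right (volume : Measure (E n)) y).restrict_image_emb
    (Homeomorph.addRight y).measurableEmbedding K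
  exact (hh _ (hK.image (continuous_add_const y))).comp_measurePreserving hmp

theorem memLp_dq {h : E n → ℝ} (hh : ∀ K, IsCompact K → MemLp h 2 (volume.restrict K))
    (e : E n) (t : ℝ) (K : Set (E n)) (hK : IsCompact K) :
    MemLp (dq e t h) 2 (volume.restrict K) :=
  ((memLp_comp_add hh (t • e) K hK).sub (hh K hK)).const_mul t⁻¹

theorem isFiniteMeasure_restrict_of_isCompact {K : Set (E n)} (hK : IsCompact K) :
    IsFiniteMeasure (volume.restrict K) := ⟨by simpa using hK.measure_lt_top⟩

theorem LocDiff.of_isWeakDeriv {e : E n} {h g : E n → ℝ} (hh : MemLp h 2) (hg : MemLp g 2)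
    (hw : IsWeakDeriv e h g) : LocDiff Set.univ e h g where
  memLp K _ := hh.restrict K
  memLp_deriv K _ _ := hg.restrict K
  tendsto K _ _ := by
    have := tendsto_dq_of_isWeakDeriv (q := 2) (q' := 2) (by norm_num) hh hg hw
    exact tendsto_eLpNorm_zero_mono this (Eventually.of_forall fun t =>
      eLpNorm_mono_measure _ Measure.restrict_le_self)

theorem LocDiff.congr_deriv {Ω : Set (E n)} {e : E n} {h g g' : E n → ℝ} (hd : LocDiff Ω e h g)
    (hg : g =ᵐ[volume.restrict Ω] g') : LocDiff Ω e h g' where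
  memLp := hd.memLp
  memLp_deriv K hK hKΩ :=
    (hd.memLp_deriv K hK hKΩ).ae_eq (ae_restrict_of_ae_restrict_of_subset hKΩ hg)
  tendsto K hK hKΩ := by
    refine (hd.tendsto K hK hKΩ).congr fun t => eLpNorm_congr_ae ?_
    filter_upwards [ae_restrict_of_ae_restrict_of_subset hKΩ hg] with x hx
    rw [hx]

theorem eventually_smul_small (e : E n) {δ : ℝ} (hδ : 0 < δ) :
    ∀ᶠ t in 𝓝[≠] (0 : ℝ), ‖t • e‖ < δ := by
  have : Tendsto (fun t : ℝ => ‖t • e‖) (𝓝[≠] 0) (𝓝 0) := by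
    have h : Continuous fun t : ℝ => ‖t • e‖ := by fun_prop
    simpa using (h.tendsto 0).mono_left nhdsWithin_le_nhds
  exact this.eventually_lt_const hδ

theorem mem_cthickening_of_norm_le {S : Set (E n)} {x y : E n} {δ : ℝ} (hx : x + y ∈ S)
    (hy : ‖y‖ ≤ δ) : x ∈ Metric.cthickening δ S := by
  refine Metric.mem_cthickening_of_dist_le _ (x + y) δ S hx ?_
  simpa [dist_eq_norm] using hy

/-- Difference quotients see only the values near a set. -/
theorem eventually_dq_eq {e : E n} {h h' : E n → ℝ} {K O : Set (E n)} (hK : IsCompact K)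
    (hO : IsOpen O) (hKO : K ⊆ O) (hh : ∀ x ∈ O, h x = h' x) :
    ∀ᶠ t in 𝓝[≠] (0 : ℝ), ∀ x ∈ K, dq e t h x = dq e t h' x := by
  obtain ⟨δ, hδ, hδO⟩ := hK.exists_cthickening_subset_open hO hKO
  filter_upwards [eventually_smul_small e hδ] with t ht x hx
  have h1 : x + t • e ∈ O := hδO (mem_cthickening_of_norm_le (y := -(t • e)) (by simpa using hx)
    (by rw [norm_neg]; exact ht.le))
  rw [dq, dq, hh _ h1, hh _ (hKO hx)]

theorem LocDiff.congr_of_eqOn {Ω O : Set (E n)} {e : E n} {h h' g : E n → ℝ} {K : Set (E n)}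
    (hd : LocDiff Ω e h' g) (hK : IsCompact K) (hKΩ : K ⊆ Ω) (hO : IsOpen O) (hKO : K ⊆ O)
    (hh : ∀ x ∈ O, h x = h' x) :
    Tendsto (fun t => eLpNorm (fun x => dq e t h x - g x) 2 (volume.restrict K)) (𝓝[≠] 0)
      (𝓝 0) := by
  refine (hd.tendsto K hK hKΩ).congr' ?_
  filter_upwards [eventually_dq_eq hK hO hKO hh] with t ht
  refine eLpNorm_congr_ae ?_
  filter_upwards [ae_restrict_mem hK.measurableSet] with x hx
  rw [ht x hx]

theorem eq_sum_smul_single {m : ℕ} (z : E m) :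
    z = ∑ j, z j • EuclideanSpace.single j (1 : ℝ) := by
  conv_lhs => rw [← (EuclideanSpace.basisFun (Fin m) ℝ).sum_repr z]
  simp

theorem norm_le_sum_abs {m : ℕ} (z : E m) : ‖z‖ ≤ ∑ j, |z j| := by
  conv_lhs => rw [eq_sum_smul_single z]
  refine (norm_sum_le _ _).trans (Finset.sum_le_sum fun j _ => ?_)
  simp [norm_smul]

theorem memLp_of_components {m : ℕ} {α : Type*} [MeasurableSpace α] {ν : Measure α} {q : ℝ≥0∞}
    {Z : α → E m} (hZ : ∀ j, MemLp (fun x => Z x j) q ν) : MemLp Z q ν := by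
  have h1 : MemLp (fun x => ∑ j, |Z x j|) q ν := memLp_finsetSum _ fun j _ => (hZ j).abs
  refine h1.mono' ?_ (Eventually.of_forall fun x => norm_le_sum_abs _)
  have : Z = fun x => ∑ j, Z x j • EuclideanSpace.single j (1 : ℝ) :=
    funext fun x => eq_sum_smul_single (Z x)
  rw [this]
  exact Finset.aestronglyMeasurable_fun_sum _ fun j _ => (hZ j).1.smul_const _

theorem aestronglyMeasurable_fderiv_apply {m : ℕ} {α : Type*} [MeasurableSpace α] {ν : Measure α}
    {V W : α → E m} (Φ : E m → ℝ) (hV : AEStronglyMeasurable V ν)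
    (hW : ∀ j, AEStronglyMeasurable (fun x => W x j) ν) :
    AEStronglyMeasurable (fun x => fderiv ℝ Φ (V x) (W x)) ν := by
  have : (fun x => fderiv ℝ Φ (V x) (W x)) = fun x =>
      ∑ j, W x j * fderiv ℝ Φ (V x) (EuclideanSpace.single j 1) := by
    funext x
    exact fderiv_apply_eq_sum Φ (V x) (W x)
  rw [this]
  refine Finset.aestronglyMeasurable_fun_sum _ fun j _ => (hW j).mul ?_
  exact ((measurable_fderiv_apply_const ℝ Φ _).comp_aemeasurable
    hV.aemeasurable).aestronglyMeasurable

theorem eLpNorm_sum_norm_const_mul_le {α ι : Type*} [Fintype ι] [MeasurableSpace α]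
    {ν : Measure α} {f : ι → α → ℝ} (hf : ∀ j, AEStronglyMeasurable (f j) ν) (L : NNReal) :
    eLpNorm (fun x => ∑ j, ‖(L : ℝ) * f j x‖) 2 ν ≤ ∑ j, (L : ℝ≥0∞) * eLpNorm (f j) 2 ν := by
  have e : (fun x => ∑ j, ‖(L : ℝ) * f j x‖) = ∑ j, fun x => ‖(L : ℝ) * f j x‖ := by
    funext x; simp
  rw [e]
  refine (eLpNorm_sum_le (fun j _ => ((hf j).const_mul (L : ℝ)).norm) one_le_two).trans
    (Finset.sum_le_sum fun j _ => ?_)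
  rw [eLpNorm_norm]
  have := eLpNorm_const_smul (L : ℝ) (f j) 2 ν
  refine this.le.trans_eq ?_
  simp

/-- Chain rule. -/
theorem LocDiff.comp {m : ℕ} {Ω : Set (E n)} {e : E n} {V W : E n → E m}
    (hV : ∀ j, LocDiff Ω e (fun x => V x j) fun x => W x j) {Φ : E m → ℝ} {L : NNReal}
    (hL : LipschitzWith L Φ) (hΦ : Differentiable ℝ Φ) :
    LocDiff Ω e (fun x => Φ (V x)) fun x => fderiv ℝ Φ (V x) (W x) := by
  have hb : ∀ z : E m, ‖fderiv ℝ Φ z‖ ≤ L := fun z => norm_fderiv_le_of_lipschitz ℝ hL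
  have hVm : ∀ K, IsCompact K → MemLp V 2 (volume.restrict K) := fun K hK =>
    memLp_of_components fun j => (hV j).memLp K hK
  have hWm : ∀ K, IsCompact K → K ⊆ Ω → MemLp W 2 (volume.restrict K) := fun K hK hKΩ =>
    memLp_of_components fun j => (hV j).memLp_deriv K hK hKΩ
  have hDm : ∀ K, IsCompact K → K ⊆ Ω →
      AEStronglyMeasurable (fun x => fderiv ℝ Φ (V x) (W x)) (volume.restrict K) :=
    fun K hK hKΩ => aestronglyMeasurable_fderiv_apply Φ (hVm K hK).1
      fun j => ((hV j).memLp_deriv K hK hKΩ).1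
  refine ⟨fun K hK => ?_, fun K hK hKΩ => ?_, fun K hK hKΩ => ?_⟩
  · have hfin := isFiniteMeasure_restrict_of_isCompact hK
    have h1 : MemLp (fun x => |Φ 0| + L * ‖V x‖) 2 (volume.restrict K) :=
      (memLp_const |Φ 0|).add ((hVm K hK).norm.const_mul (L : ℝ))
    refine h1.mono' (hL.continuous.comp_aestronglyMeasurable (hVm K hK).1)
      (Eventually.of_forall fun x => ?_)
    have := hL.dist_le_mul (V x) 0
    rw [dist_zero_right, Real.dist_eq] at this
    have h3 := abs_sub_abs_le_abs_sub (Φ (V x)) (Φ 0)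
    rw [Real.norm_eq_abs]
    linarith
  · refine ((hWm K hK hKΩ).norm.const_mul (L : ℝ)).mono' (hDm K hK hKΩ)
      (Eventually.of_forall fun x => ?_)
    refine ((fderiv ℝ Φ (V x)).le_opNorm (W x)).trans ?_
    gcongr
    exact hb _
  · set ν := volume.restrict K with hν
    have hVs : ∀ y, AEStronglyMeasurable (fun x => V (x + y)) ν := fun y =>
      (memLp_of_components fun j => memLp_comp_add (hV j).memLp y K hK).1
    -- `R` is the error of the chain rule along the line V + tW: it tends to 0 pointwise and is
    -- dominated by 2L|W|. `Q` compares V(x + te) with V + tW and is controlled by the Lipschitz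
    -- constant and the convergence of the quotients of `V`.
    set R : ℝ → E n → ℝ := fun t x =>
      t⁻¹ * (Φ (V x + t • W x) - Φ (V x)) - fderiv ℝ Φ (V x) (W x) with hR
    set Q : ℝ → E n → ℝ := fun t x => t⁻¹ * (Φ (V (x + t • e)) - Φ (V x + t • W x)) with hQ
    have hdec : ∀ t x, dq e t (fun x => Φ (V x)) x - fderiv ℝ Φ (V x) (W x) = Q t x + R t x := by
      intro t x; simp only [dq, hQ, hR]; ring
    have hQm : ∀ t, AEStronglyMeasurable (Q t) ν := fun t =>
      ((hL.continuous.comp_aestronglyMeasurable (hVs _)).sub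
        (hL.continuous.comp_aestronglyMeasurable
          ((hVm K hK).1.add ((hWm K hK hKΩ).1.const_smul t)))).const_mul _
    have hRm : ∀ t, AEStronglyMeasurable (R t) ν := fun t =>
      (((hL.continuous.comp_aestronglyMeasurable
          ((hVm K hK).1.add ((hWm K hK hKΩ).1.const_smul t))).sub
        (hL.continuous.comp_aestronglyMeasurable (hVm K hK).1)).const_mul _).sub (hDm K hK hKΩ)
    have hRt : Tendsto (fun t => eLpNorm (R t) 2 ν) (𝓝[≠] 0) (𝓝 0) := by
      refine tendsto_eLpNorm_two_of_dominated ((hWm K hK hKΩ).norm.const_mul (2 * L : ℝ))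
        (Eventually.of_forall hRm) ?_ (Eventually.of_forall fun x => ?_)
      · filter_upwards [self_mem_nhdsWithin] with t ht
        refine Eventually.of_forall fun x => ?_
        have h1 := hL.dist_le_mul (V x + t • W x) (V x)
        rw [Real.dist_eq, dist_eq_norm, add_sub_cancel_left, norm_smul] at h1
        have h2 : |fderiv ℝ Φ (V x) (W x)| ≤ L * ‖W x‖ :=
          ((fderiv ℝ Φ (V x)).le_opNorm (W x)).trans (by gcongr; exact hb _)
        have h3 : |t⁻¹ * (Φ (V x + t • W x) - Φ (V x))| ≤ L * ‖W x‖ := by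
          rw [abs_mul, abs_inv]
          have ht' : 0 < |t| := abs_pos.2 ht
          rw [inv_mul_le_iff₀ ht']
          calc _ ≤ L * (‖t‖ * ‖W x‖) := h1
            _ = _ := by rw [Real.norm_eq_abs]; ring
        calc |R t x| ≤ _ := abs_sub _ _
          _ ≤ L * ‖W x‖ + L * ‖W x‖ := add_le_add h3 h2
          _ = _ := by ring
      · have h1 : HasDerivAt (fun t : ℝ => Φ (V x + t • W x)) (fderiv ℝ Φ (V x) (W x)) 0 := by
          have h2 : HasDerivAt (fun t : ℝ => V x + t • W x) (W x) 0 := by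
            have := ((hasDerivAt_id (0 : ℝ)).smul_const (W x)).const_add (V x)
            rw [one_smul] at this
            exact this
          exact HasFDerivAt.comp_hasDerivAt_of_eq 0 (hΦ (V x)).hasFDerivAt h2 (by simp)
        have h3 := h1.tendsto_slope_zero.sub_const (fderiv ℝ Φ (V x) (W x))
        simpa using h3
    have hQt : Tendsto (fun t => eLpNorm (Q t) 2 ν) (𝓝[≠] 0) (𝓝 0) := by
      have hB : Tendsto (fun t => ∑ j, (L : ℝ≥0∞) *
          eLpNorm (fun x => dq e t (fun x => V x j) x - W x j) 2 ν) (𝓝[≠] 0) (𝓝 0) := by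
        have := tendsto_finsetSum Finset.univ fun j _ =>
          ENNReal.Tendsto.const_mul (a := (L : ℝ≥0∞)) ((hV j).tendsto K hK hKΩ)
            (Or.inr ENNReal.coe_ne_top)
        simpa using this
      refine tendsto_eLpNorm_zero_mono hB ?_
      filter_upwards [self_mem_nhdsWithin] with t ht
      have ht' : 0 < |t| := abs_pos.2 ht
      have hm : ∀ j, AEStronglyMeasurable (fun x => dq e t (fun x => V x j) x - W x j) ν :=
        fun j => ((memLp_dq (hV j).memLp e t K hK).sub ((hV j).memLp_deriv K hK hKΩ)).1
      have hle : eLpNorm (Q t) 2 ν ≤ eLpNorm (fun x => ∑ j,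
          ‖(L : ℝ) * (dq e t (fun x => V x j) x - W x j)‖) 2 ν := by
        refine eLpNorm_mono_real fun x => ?_
        have h1 := hL.dist_le_mul (V (x + t • e)) (V x + t • W x)
        rw [Real.dist_eq, dist_eq_norm] at h1
        have h2 := norm_le_sum_abs (V (x + t • e) - (V x + t • W x))
        rw [Real.norm_eq_abs, hQ]
        simp only
        rw [abs_mul, abs_inv, inv_mul_le_iff₀ ht']
        refine h1.trans ((mul_le_mul_of_nonneg_left h2 L.coe_nonneg).trans_eq ?_)
        rw [Finset.mul_sum, Finset.mul_sum]
        refine Finset.sum_congr rfl fun j _ => ?_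
        have h3 : (V (x + t • e) - (V x + t • W x)) j =
            t * (dq e t (fun x => V x j) x - W x j) := by
          simp only [dq, PiLp.sub_apply, PiLp.add_apply, PiLp.smul_apply, smul_eq_mul]
          have : t ≠ 0 := ht
          field_simp
          ring
        rw [h3, norm_mul, abs_mul, Real.norm_of_nonneg L.coe_nonneg, Real.norm_eq_abs]
        ring
      exact hle.trans (eLpNorm_sum_norm_const_mul_le hm L)
    have hsum : Tendsto (fun t => eLpNorm (Q t) 2 ν + eLpNorm (R t) 2 ν) (𝓝[≠] 0) (𝓝 0) := by
      simpa using hQt.add hRt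
    refine tendsto_eLpNorm_zero_mono hsum (Eventually.of_forall fun t => ?_)
    simp only [hdec]
    exact eLpNorm_add_le (hQm t) (hRm t) (by norm_num)

end

/-! ### Product rule, integration by parts and the null Lagrangian identity. -/

section

open Filter Topology ENNReal

variable {n : ℕ}

theorem IsBumpFun.exists_abs_le {φ : E n → ℝ} (hφ : IsBumpFun φ) : ∃ M, 0 ≤ M ∧ ∀ x, |φ x| ≤ M := by
  obtain ⟨M, hM⟩ := hφ.compact.exists_bound_of_continuous hφ.continuous
  exact ⟨M, (norm_nonneg _).trans (hM 0), hM⟩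

theorem IsBumpFun.exists_lipschitz {φ : E n → ℝ} (hφ : IsBumpFun φ) : ∃ L, LipschitzWith L φ :=
  hφ.smooth.lipschitzWith_of_hasCompactSupport hφ.compact (by simp)

theorem memLp_mul_of_support {φ g : E n → ℝ} {S : Set (E n)} (hS : IsCompact S)
    (hφ : Continuous φ) (hφS : ∀ x, x ∉ S → φ x = 0) {q : ℝ≥0∞}
    (hg : MemLp g q (volume.restrict S)) : MemLp (fun x => φ x * g x) q := by
  obtain ⟨M, hM⟩ := hS.exists_bound_of_continuousOn hφ.continuousOn
  have e : (fun x => φ x * g x) = S.indicator fun x => φ x * g x := by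
    funext x
    by_cases hx : x ∈ S
    · rw [Set.indicator_of_mem hx]
    · rw [Set.indicator_of_notMem hx, hφS x hx, zero_mul]
  rw [e, memLp_indicator_iff_restrict hS.measurableSet]
  refine hg.of_le_mul (c := M) (hφ.aestronglyMeasurable.mul hg.1) ?_
  filter_upwards [ae_restrict_mem hS.measurableSet] with x hx
  rw [norm_mul]
  gcongr
  exact hM x hx

theorem dq_eq_zero_of_notMem_cthickening {e : E n} {t δ : ℝ} {S : Set (E n)} {c : E n → ℝ}
    (hc : ∀ x, x ∉ S → c x = 0) (ht : ‖t • e‖ ≤ δ) {x : E n} (hx : x ∉ Metric.cthickening δ S) :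
    dq e t c x = 0 := by
  have h1 : x ∉ S := fun h => hx (Metric.self_subset_cthickening S h)
  have h2 : x + t • e ∉ S := fun h => hx (mem_cthickening_of_norm_le h ht)
  rw [dq, hc _ h1, hc _ h2, sub_zero, mul_zero]

theorem abs_dq_le {φ : E n → ℝ} {L : NNReal} (hL : LipschitzWith L φ) (e : E n) {t : ℝ}
    (ht : t ≠ 0) (x : E n) : |dq e t φ x| ≤ L * ‖e‖ := by
  have h := hL.dist_le_mul (x + t • e) x
  rw [Real.dist_eq, dist_eq_norm, add_sub_cancel_left, norm_smul, Real.norm_eq_abs] at h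
  rw [dq, abs_mul, abs_inv, inv_mul_le_iff₀ (abs_pos.2 ht)]
  linarith

theorem tendsto_dq {φ : E n → ℝ} {x : E n} (hφ : DifferentiableAt ℝ φ x) (e : E n) :
    Tendsto (fun t => dq e t φ x) (𝓝[≠] 0) (𝓝 (fderiv ℝ φ x e)) := by
  have h2 : HasDerivAt (fun t : ℝ => x + t • e) e 0 := by
    have := ((hasDerivAt_id (0 : ℝ)).smul_const e).const_add x
    rw [one_smul] at this
    exact this
  have h1 : HasDerivAt (fun t : ℝ => φ (x + t • e)) (fderiv ℝ φ x e) 0 :=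
    HasFDerivAt.comp_hasDerivAt_of_eq 0 hφ.hasFDerivAt h2 (by simp)
  simpa [dq] using h1.tendsto_slope_zero

theorem LocDiff.mul_test {Ω : Set (E n)} (hΩ : IsOpen Ω) {e : E n} {h g φ : E n → ℝ}
    (hd : LocDiff Ω e h g) (hφ : IsTest Ω φ) :
    LocDiff Set.univ e (fun x => φ x * h x) fun x => fderiv ℝ φ x e * h x + φ x * g x := by
  have hb := hφ.isBumpFun
  set S := tsupport φ with hS
  have hSc : IsCompact S := hφ.compact
  have hφS : ∀ x, x ∉ S → φ x = 0 := fun x hx => image_eq_zero_of_notMem_tsupport hx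
  have hfS : ∀ x, x ∉ S → fderiv ℝ φ x e = 0 := fun x hx => by
    have : x ∉ tsupport (fderiv ℝ φ) := fun h => hx (tsupport_fderiv_subset ℝ h)
    rw [image_eq_zero_of_notMem_tsupport this, zero_apply]
  have hm1 : MemLp (fun x => φ x * h x) 2 :=
    memLp_mul_of_support hSc hb.continuous hφS (hd.memLp S hSc)
  have hm2 : MemLp (fun x => fderiv ℝ φ x e * h x + φ x * g x) 2 :=
    (memLp_mul_of_support hSc (hb.continuous_fderiv e) hfS (hd.memLp S hSc)).add
      (memLp_mul_of_support hSc hb.continuous hφS (hd.memLp_deriv S hSc hφ.supp))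
  refine ⟨fun K _ => hm1.restrict K, fun K _ _ => hm2.restrict K, fun K _ _ => ?_⟩
  -- For small steps the quotients of φh live in a thickening of the support that is still compact
  -- in Ω. Hence the product is controlled on the whole space.
  obtain ⟨δ, hδ, hδΩ⟩ := hSc.exists_cthickening_subset_open hΩ hφ.supp
  set S' := Metric.cthickening δ S with hS'
  have hS'c : IsCompact S' := hSc.cthickening
  set ν := volume.restrict S' with hν
  obtain ⟨M, hM0, hM⟩ := hb.exists_abs_le
  obtain ⟨L, hL⟩ := hb.exists_lipschitz
  have hfb : ∀ x, |fderiv ℝ φ x e| ≤ L * ‖e‖ := fun x =>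
    ((fderiv ℝ φ x).le_opNorm e).trans (by gcongr; exact norm_fderiv_le_of_lipschitz ℝ hL)
  -- `P` carries the L² convergence of the quotients of `h`; in `R` only the smooth factor φ varies
  -- with t, so dominated convergence applies.
  set P : ℝ → E n → ℝ := fun t x => φ (x + t • e) * (dq e t h x - g x) with hP
  set R : ℝ → E n → ℝ := fun t x =>
    (φ (x + t • e) - φ x) * g x + (dq e t φ x - fderiv ℝ φ x e) * h x with hR
  have hdec : ∀ t x, dq e t (fun x => φ x * h x) x - (fderiv ℝ φ x e * h x + φ x * g x) =
      P t x + R t x := by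
    intro t x; simp only [dq, hP, hR]; ring
  have hgν := hd.memLp_deriv S' hS'c hδΩ
  have hhν := hd.memLp S' hS'c
  have hφt : ∀ t : ℝ, Continuous fun x => φ (x + t • e) := fun t =>
    hb.continuous.comp (by fun_prop)
  have hPm : ∀ t, AEStronglyMeasurable (P t) ν := fun t =>
    (hφt t).aestronglyMeasurable.mul ((memLp_dq hd.memLp e t S' hS'c).sub hgν).1
  have hRm : ∀ t, AEStronglyMeasurable (R t) ν := fun t =>
    (((hφt t).sub hb.continuous).aestronglyMeasurable.mul hgν.1).add
      (((continuous_const.mul ((hφt t).sub hb.continuous)).sub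
        (hb.continuous_fderiv e)).aestronglyMeasurable.mul hhν.1)
  have hPt : Tendsto (fun t => eLpNorm (P t) 2 ν) (𝓝[≠] 0) (𝓝 0) := by
    have hB := ENNReal.Tendsto.const_mul (a := ENNReal.ofReal M) (hd.tendsto S' hS'c hδΩ)
      (Or.inr ENNReal.ofReal_ne_top)
    rw [mul_zero] at hB
    refine tendsto_eLpNorm_zero_mono hB (Eventually.of_forall fun t => ?_)
    refine eLpNorm_le_mul_eLpNorm_of_ae_le_mul (Eventually.of_forall fun x => ?_) 2
    rw [norm_mul]
    gcongr
    exact hM _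
  have hRt : Tendsto (fun t => eLpNorm (R t) 2 ν) (𝓝[≠] 0) (𝓝 0) := by
    refine tendsto_eLpNorm_two_of_dominated
      ((hgν.abs.const_mul (2 * M)).add (hhν.abs.const_mul (2 * (L * ‖e‖))))
      (Eventually.of_forall hRm) ?_ (Eventually.of_forall fun x => ?_)
    · filter_upwards [self_mem_nhdsWithin] with t ht
      refine Eventually.of_forall fun x => ?_
      have h1 : |φ (x + t • e) - φ x| ≤ 2 * M :=
        (abs_sub _ _).trans (by linarith [hM (x + t • e), hM x])
      have h2 : |dq e t φ x - fderiv ℝ φ x e| ≤ 2 * (L * ‖e‖) :=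
        (abs_sub _ _).trans (by linarith [abs_dq_le hL e ht x, hfb x])
      refine (abs_add_le _ _).trans ?_
      rw [abs_mul, abs_mul]
      simp only [Pi.add_apply, Pi.abs_apply]
      gcongr
    · have h1 : Tendsto (fun t : ℝ => φ (x + t • e) - φ x) (𝓝[≠] 0) (𝓝 0) := by
        have hc : Continuous fun t : ℝ => φ (x + t • e) - φ x :=
          (hb.continuous.comp (by fun_prop)).sub continuous_const
        simpa using (hc.tendsto 0).mono_left nhdsWithin_le_nhds
      have h2 := (tendsto_dq (hb.differentiable x) e).sub_const (fderiv ℝ φ x e)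
      rw [sub_self] at h2
      simpa using (h1.mul_const (g x)).add (h2.mul_const (h x))
  have hsum : Tendsto (fun t => eLpNorm (P t) 2 ν + eLpNorm (R t) 2 ν) (𝓝[≠] 0) (𝓝 0) := by
    simpa using hPt.add hRt
  refine tendsto_eLpNorm_zero_mono hsum ?_
  filter_upwards [eventually_smul_small e hδ] with t ht
  refine (eLpNorm_mono_measure _ Measure.restrict_le_self).trans ?_
  have hsupp : Function.support (fun x => dq e t (fun x => φ x * h x) x -
      (fderiv ℝ φ x e * h x + φ x * g x)) ⊆ S' := by
    intro x hx
    by_contra hxS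
    have hxS0 : x ∉ S := fun h => hxS (Metric.self_subset_cthickening S h)
    refine hx ?_
    simp only
    rw [dq_eq_zero_of_notMem_cthickening (S := S) (fun y hy => by simp [hφS y hy]) ht.le hxS,
      hfS x hxS0, hφS x hxS0]
    ring
  rw [← eLpNorm_restrict_eq_of_support_subset hsupp]
  simp only [hdec]
  exact eLpNorm_add_le (hPm t) (hRm t) (by norm_num)

theorem LocDiff.tendsto_integral_dq_mul_dq {Ω S : Set (E n)} (hΩ : IsOpen Ω) (hS : IsCompact S)
    (hSΩ : S ⊆ Ω) {e₁ e₂ : E n} {c c₁ b b₂ : E n → ℝ} (hc : LocDiff Set.univ e₁ c c₁)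
    (hb : LocDiff Ω e₂ b b₂) (hcS : ∀ x, x ∉ S → c x = 0) (hcS₁ : ∀ x, x ∉ S → c₁ x = 0) :
    Tendsto (fun t => ∫ x, dq e₁ t c x * dq e₂ t b x) (𝓝[≠] 0) (𝓝 (∫ x, c₁ x * b₂ x)) := by
  obtain ⟨δ, hδ, hδΩ⟩ := hS.exists_cthickening_subset_open hΩ hSΩ
  have hS'c : IsCompact (Metric.cthickening δ S) := hS.cthickening
  have h1 := tendsto_integral_mul_of_tendsto_eLpNorm
    (Eventually.of_forall fun t => memLp_dq hc.memLp e₁ t _ hS'c)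
    (Eventually.of_forall fun t => memLp_dq hb.memLp e₂ t _ hS'c)
    (hc.memLp_deriv _ hS'c (Set.subset_univ _)) (hb.memLp_deriv _ hS'c hδΩ)
    (hc.tendsto _ hS'c (Set.subset_univ _)) (hb.tendsto _ hS'c hδΩ)
  rw [setIntegral_eq_integral_of_forall_compl_eq_zero (fun x hx => by
    rw [hcS₁ x fun h => hx (Metric.self_subset_cthickening S h), zero_mul])] at h1
  refine h1.congr' ?_
  filter_upwards [eventually_smul_small e₁ hδ] with t ht
  exact setIntegral_eq_integral_of_forall_compl_eq_zero fun x hx => by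
    rw [dq_eq_zero_of_notMem_cthickening hcS ht.le hx, zero_mul]

theorem integrable_mul_comp_add {S : Set (E n)} (hS : IsCompact S) {c b : E n → ℝ}
    (hc : MemLp c 2 (volume.restrict S)) (hb : ∀ K, IsCompact K → MemLp b 2 (volume.restrict K))
    (hcS : ∀ x, x ∉ S → c x = 0) (y z : E n) : Integrable fun x => c (x + y) * b (x + z) := by
  have h1 : Integrable fun x => c x * b (x + (z - y)) := by
    have h2 : IntegrableOn (fun x => c x * b (x + (z - y))) S :=
      hc.integrable_mul (memLp_comp_add hb (z - y) S hS)
    exact h2.integrable_of_forall_notMem_eq_zero fun x hx => by rw [hcS x hx, zero_mul]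
  have h3 := h1.comp_add_right y
  simpa [add_assoc] using h3

theorem integral_mul_comp_add (c b : E n → ℝ) (y z : E n) :
    ∫ x, c (x + y) * b (x + z) = ∫ x, c x * b (x + (z - y)) := by
  rw [← integral_add_right_eq_self (fun x => c x * b (x + (z - y))) y]
  simp [add_assoc]

/-- Translation invariance moves all shifts onto `b`. What remains is a four-term combination of
values of the single function y ↦ ∫ c(x) b(x + y) dx, in which the roles of the two directions can
be compared. -/
theorem integral_dq_mul_dq {S : Set (E n)} (hS : IsCompact S) {c b : E n → ℝ}
    (hc : MemLp c 2 (volume.restrict S)) (hb : ∀ K, IsCompact K → MemLp b 2 (volume.restrict K))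
    (hcS : ∀ x, x ∉ S → c x = 0) (e₁ e₂ : E n) (t s : ℝ) :
    ∫ x, dq e₁ t c x * dq e₂ s b x = t⁻¹ * s⁻¹ * ((∫ x, c x * b (x + (s • e₂ - t • e₁))) -
      (∫ x, c x * b (x + (-(t • e₁)))) - (∫ x, c x * b (x + s • e₂)) + ∫ x, c x * b x) := by
  have hi := integrable_mul_comp_add hS hc hb hcS
  have e : ∀ x, dq e₁ t c x * dq e₂ s b x = t⁻¹ * s⁻¹ * (c (x + t • e₁) * b (x + s • e₂) -
      c (x + t • e₁) * b (x + 0) - c (x + 0) * b (x + s • e₂) + c (x + 0) * b (x + 0)) := by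
    intro x; simp only [dq, add_zero]; ring
  simp only [e]
  have i1 : Integrable fun x => c (x + t • e₁) * b (x + s • e₂) - c (x + t • e₁) * b (x + 0) :=
    (hi _ _).sub (hi _ _)
  have i2 : Integrable fun x => c (x + t • e₁) * b (x + s • e₂) - c (x + t • e₁) * b (x + 0) -
      c (x + 0) * b (x + s • e₂) := i1.sub (hi _ _)
  rw [integral_const_mul, integral_add i2 (hi _ _), integral_sub i1 (hi _ _),
    integral_sub (hi _ _) (hi _ _), integral_mul_comp_add, integral_mul_comp_add,
    integral_mul_comp_add, integral_mul_comp_add]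
  simp

/-- The Jacobian determinant is a null Lagrangian. -/
theorem LocDiff.integral_mul_eq_integral_mul {Ω S : Set (E n)} (hΩ : IsOpen Ω) (hS : IsCompact S)
    (hSΩ : S ⊆ Ω) {e₁ e₂ : E n} {c c₁ c₂ b b₁ b₂ : E n → ℝ}
    (hc₁ : LocDiff Set.univ e₁ c c₁) (hc₂ : LocDiff Set.univ e₂ c c₂)
    (hb₁ : LocDiff Ω e₁ b b₁) (hb₂ : LocDiff Ω e₂ b b₂) (hcS : ∀ x, x ∉ S → c x = 0)
    (hcS₁ : ∀ x, x ∉ S → c₁ x = 0) (hcS₂ : ∀ x, x ∉ S → c₂ x = 0) :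
    ∫ x, c₁ x * b₂ x = ∫ x, c₂ x * b₁ x := by
  have h1 := hc₁.tendsto_integral_dq_mul_dq hΩ hS hSΩ hb₂ hcS hcS₁
  have h2 := hc₂.tendsto_integral_dq_mul_dq hΩ hS hSΩ hb₁ hcS hcS₂
  -- Swapping e₁ and e₂ and replacing t by -t leaves the four-term expression of
  -- `integral_dq_mul_dq` unchanged. The two sides are therefore limits of the same quantity.
  have hneg : Tendsto (fun t : ℝ => -t) (𝓝[≠] 0) (𝓝[≠] 0) := by
    refine tendsto_nhdsWithin_iff.2 ⟨?_, ?_⟩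
    · have : Tendsto (fun t : ℝ => -t) (𝓝 0) (𝓝 (-0)) := continuous_neg.tendsto 0
      rw [neg_zero] at this
      exact this.mono_left nhdsWithin_le_nhds
    · filter_upwards [self_mem_nhdsWithin] with t ht using neg_ne_zero.2 ht
  have h3 := h2.comp hneg
  refine tendsto_nhds_unique h1 (h3.congr fun t => ?_)
  simp only [Function.comp]
  rw [integral_dq_mul_dq hS (hc₁.memLp S hS) hb₁.memLp hcS,
    integral_dq_mul_dq hS (hc₁.memLp S hS) hb₁.memLp hcS]
  simp only [neg_smul, neg_neg, inv_neg, neg_mul_neg, sub_neg_eq_add, add_comm (-(t • e₁)),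
    ← sub_eq_add_neg (t • e₂)]
  ring

/-- By translation invariance every difference quotient of the compactly supported `c` has integral
zero. -/
theorem LocDiff.integral_deriv_eq_zero {S : Set (E n)} (hS : IsCompact S) {e : E n}
    {c c₁ : E n → ℝ} (hc : LocDiff Set.univ e c c₁) (hcS : ∀ x, x ∉ S → c x = 0)
    (hcS₁ : ∀ x, x ∉ S → c₁ x = 0) : ∫ x, c₁ x = 0 := by
  have hS'c : IsCompact (Metric.cthickening 1 S) := hS.cthickening
  have hfin := isFiniteMeasure_restrict_of_isCompact hS'c
  have h1 := tendsto_integral_mul_of_tendsto_eLpNorm (B := fun _ _ => (1 : ℝ)) (b := fun _ => 1)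
    (Eventually.of_forall fun t => memLp_dq hc.memLp e t _ hS'c)
    (Eventually.of_forall fun t => memLp_const 1)
    (hc.memLp_deriv _ hS'c (Set.subset_univ _)) (memLp_const 1)
    (hc.tendsto _ hS'c (Set.subset_univ _)) (by simp)
  simp only [mul_one] at h1
  rw [setIntegral_eq_integral_of_forall_compl_eq_zero (fun x hx => by
    rw [hcS₁ x fun h => hx (Metric.self_subset_cthickening S h)])] at h1
  refine tendsto_nhds_unique h1 (tendsto_const_nhds.congr' ?_)
  filter_upwards [eventually_smul_small e zero_lt_one] with t ht
  rw [setIntegral_eq_integral_of_forall_compl_eq_zero fun x hx => by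
    rw [dq_eq_zero_of_notMem_cthickening hcS ht.le hx]]
  have hci : Integrable c := by
    have hfin' := isFiniteMeasure_restrict_of_isCompact hS
    have h2 : IntegrableOn c S := (hc.memLp S hS).integrable (by norm_num)
    exact h2.integrable_of_forall_notMem_eq_zero hcS
  simp only [dq]
  rw [integral_const_mul, integral_sub (hci.comp_add_right _) hci, integral_add_right_eq_self,
    sub_self, mul_zero]

theorem fderiv_apply_eq_zero_of_notMem_tsupport {φ : E n → ℝ} (e : E n) {x : E n}
    (hx : x ∉ tsupport φ) : fderiv ℝ φ x e = 0 := by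
  have : x ∉ tsupport (fderiv ℝ φ) := fun h => hx (tsupport_fderiv_subset ℝ h)
  rw [image_eq_zero_of_notMem_tsupport this, zero_apply]

theorem LocDiff.integral_mul_fderiv {Ω : Set (E n)} (hΩ : IsOpen Ω) {e : E n} {h g φ : E n → ℝ}
    (hd : LocDiff Ω e h g) (hφ : IsTest Ω φ) :
    ∫ x, h x * fderiv ℝ φ x e = -∫ x, g x * φ x := by
  have hSc : IsCompact (tsupport φ) := hφ.compact
  have hfin := isFiniteMeasure_restrict_of_isCompact hSc
  have hφS : ∀ x, x ∉ tsupport φ → φ x = 0 := fun x hx => image_eq_zero_of_notMem_tsupport hx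
  have hfS : ∀ x, x ∉ tsupport φ → fderiv ℝ φ x e = 0 := fun x hx =>
    fderiv_apply_eq_zero_of_notMem_tsupport e hx
  have h1 := (hd.mul_test hΩ hφ).integral_deriv_eq_zero hSc
    (fun x hx => by rw [hφS x hx, zero_mul]) (fun x hx => by
      rw [hφS x hx, hfS x hx, zero_mul, zero_mul, add_zero])
  have i1 : Integrable fun x => fderiv ℝ φ x e * h x := memLp_one_iff_integrable.1
    (memLp_mul_of_support hSc (hφ.isBumpFun.continuous_fderiv e) hfS
      ((hd.memLp _ hSc).mono_exponent (by norm_num)))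
  have i2 : Integrable fun x => φ x * g x := memLp_one_iff_integrable.1
    (memLp_mul_of_support hSc hφ.isBumpFun.continuous hφS
      ((hd.memLp_deriv _ hSc hφ.supp).mono_exponent (by norm_num)))
  rw [integral_add i1 i2] at h1
  simp only [mul_comm (h _), mul_comm (g _)]
  linarith

end

/-! ### Cutoffs, localisation of weak derivatives and gluing. -/

section

open Filter Topology ENNReal

variable {n : ℕ}

theorem exists_cutoff {K O : Set (E n)} (hK : IsCompact K) (hO : IsOpen O) (hKO : K ⊆ O) :
    ∃ ζ : E n → ℝ, IsTest O ζ ∧ (∀ x, 0 ≤ ζ x ∧ ζ x ≤ 1) ∧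
      ∃ O₁, IsOpen O₁ ∧ K ⊆ O₁ ∧ ∀ x ∈ O₁, ζ x = 1 := by
  obtain ⟨δ, hδ, hδO⟩ := hK.exists_cthickening_subset_open hO hKO
  have hint : K ⊆ interior (Metric.cthickening δ K) :=
    (Metric.self_subset_thickening hδ K).trans
      (interior_maximal (Metric.thickening_subset_cthickening δ K) Metric.isOpen_thickening)
  obtain ⟨ζ, h1, h0, h01⟩ := exists_contMDiffMap_one_nhds_of_subset_interior
    (n := (⊤ : ℕ∞)) (modelWithCornersSelf ℝ (E n)) hK.isClosed hint
  have hsupp : tsupport ζ ⊆ Metric.cthickening δ K :=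
    closure_minimal (fun x hx => by_contra fun h => hx (h0 x h)) Metric.isClosed_cthickening
  obtain ⟨O₁, hO₁, hKO₁, h⟩ := eventually_nhdsSet_iff_exists.1 h1
  exact ⟨ζ, ⟨ζ.contMDiff.contDiff, hK.cthickening.of_isClosed_subset (isClosed_tsupport _) hsupp,
    hsupp.trans hδO⟩, fun x => h01 x, O₁, hO₁, hKO₁, h⟩

/-- `g` is the distributional derivative of `h` in the direction `e` on `O`. -/
def IsWeakDerivOn (O : Set (E n)) (e : E n) (h g : E n → ℝ) : Prop :=
  ∀ φ : E n → ℝ, IsTest O φ → ∫ x, h x * fderiv ℝ φ x e = -∫ x, g x * φ x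

theorem IsWeakDerivOn.mul_test {O : Set (E n)} {e : E n} {h g ζ : E n → ℝ}
    (hw : IsWeakDerivOn O e h g) (hh : LocallyIntegrable h) (hg : LocallyIntegrable g)
    (hζ : IsTest O ζ) :
    IsWeakDeriv e (fun x => ζ x * h x) fun x => fderiv ℝ ζ x e * h x + ζ x * g x := by
  intro φ hφ
  have hζb := hζ.isBumpFun
  have ht : IsTest O fun x => ζ x * φ x :=
    ⟨hζ.smooth.mul hφ.smooth, hζ.compact.mul_right,
      (closure_mono (Function.support_mul_subset_left ζ φ)).trans hζ.supp⟩
  have h1 := hw _ ht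
  have hfd : ∀ x, fderiv ℝ (fun x => ζ x * φ x) x e =
      ζ x * fderiv ℝ φ x e + φ x * fderiv ℝ ζ x e := by
    intro x
    rw [fderiv_fun_mul (hζb.differentiable x) (hφ.differentiable x)]
    simp
  have i1 : Integrable fun x => (ζ x * fderiv ℝ φ x e) * h x :=
    hh.integrable_smul_left_of_hasCompactSupport (hζb.continuous.mul (hφ.continuous_fderiv e))
      hζ.compact.mul_right
  have i2 : Integrable fun x => (φ x * fderiv ℝ ζ x e) * h x :=
    hh.integrable_smul_left_of_hasCompactSupport (hφ.continuous.mul (hζb.continuous_fderiv e))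
      hφ.compact.mul_right
  have i3 : Integrable fun x => (ζ x * φ x) * g x :=
    hg.integrable_smul_left_of_hasCompactSupport (hζb.continuous.mul hφ.continuous)
      hζ.compact.mul_right
  have e1 : (fun x => h x * fderiv ℝ (fun x => ζ x * φ x) x e) = fun x =>
      (ζ x * fderiv ℝ φ x e) * h x + (φ x * fderiv ℝ ζ x e) * h x := by
    funext x; rw [hfd]; ring
  have e2 : (fun x => g x * (ζ x * φ x)) = fun x => (ζ x * φ x) * g x := by
    funext x; ring
  have e3 : (fun x => ζ x * h x * fderiv ℝ φ x e) = fun x => (ζ x * fderiv ℝ φ x e) * h x := by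
    funext x; ring
  have e4 : (fun x => (fderiv ℝ ζ x e * h x + ζ x * g x) * φ x) = fun x =>
      (φ x * fderiv ℝ ζ x e) * h x + (ζ x * φ x) * g x := by
    funext x; ring
  rw [e1, e2, integral_add i1 i2] at h1
  rw [e3, e4, integral_add i2 i3]
  linarith

/-- Multiplying by a cutoff that equals 1 near K reduces the claim to weak derivatives on the whole
space, where the difference quotients converge. -/
theorem IsWeakDerivOn.locDiff {O : Set (E n)} (hO : IsOpen O) {e : E n} {h g : E n → ℝ}
    (hw : IsWeakDerivOn O e h g) (hh : ∀ K, IsCompact K → MemLp h 2 (volume.restrict K))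
    (hg : ∀ K, IsCompact K → MemLp g 2 (volume.restrict K)) : LocDiff O e h g := by
  refine ⟨hh, fun K hK _ => hg K hK, fun K hK hKO => ?_⟩
  have hloc : ∀ {f : E n → ℝ}, (∀ K, IsCompact K → MemLp f 2 (volume.restrict K)) →
      LocallyIntegrable f := fun {f} hf => by
    rw [locallyIntegrable_iff]
    intro K hK
    have := isFiniteMeasure_restrict_of_isCompact hK
    exact (hf K hK).integrable (by norm_num)
  obtain ⟨ζ, hζ, -, O₁, hO₁, hKO₁, hone⟩ := exists_cutoff hK hO hKO
  have hζb := hζ.isBumpFun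
  have hS : ∀ x, x ∉ tsupport ζ → ζ x = 0 := fun x hx => image_eq_zero_of_notMem_tsupport hx
  have hd := LocDiff.of_isWeakDeriv
    (memLp_mul_of_support hζ.compact hζb.continuous hS (hh _ hζ.compact))
    ((memLp_mul_of_support hζ.compact (hζb.continuous_fderiv e)
      (fun x hx => fderiv_apply_eq_zero_of_notMem_tsupport e hx) (hh _ hζ.compact)).add
      (memLp_mul_of_support hζ.compact hζb.continuous hS (hg _ hζ.compact)))
    (hw.mul_test (hloc hh) (hloc hg) hζ)
  refine (hd.congr_of_eqOn hK (Set.subset_univ _) hO₁ hKO₁ (h := h) fun x hx => ?_).congr fun t =>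
    eLpNorm_congr_ae ?_
  · rw [hone x hx, one_mul]
  · filter_upwards [ae_restrict_mem hK.measurableSet] with x hx
    have h0 : fderiv ℝ ζ x = 0 := by
      have : ζ =ᶠ[𝓝 x] fun _ => 1 := by
        filter_upwards [hO₁.mem_nhds (hKO₁ hx)] with y hy using hone y hy
      rw [this.fderiv_eq]; simp
    simp [h0, hone x (hKO₁ hx)]

theorem ae_eq_of_tendsto_dq {α ι : Type*} [MeasurableSpace α] {ν : Measure α} {l : Filter ι}
    [l.NeBot] {F : ι → α → ℝ} {g g' : α → ℝ} (hF : ∀ i, AEStronglyMeasurable (F i) ν)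
    (hg : AEStronglyMeasurable g ν) (hg' : AEStronglyMeasurable g' ν)
    (h : Tendsto (fun i => eLpNorm (fun x => F i x - g x) 2 ν) l (𝓝 0))
    (h' : Tendsto (fun i => eLpNorm (fun x => F i x - g' x) 2 ν) l (𝓝 0)) : g =ᵐ[ν] g' := by
  have hle : ∀ i, eLpNorm (g - g') 2 ν ≤
      eLpNorm (fun x => F i x - g' x) 2 ν + eLpNorm (fun x => F i x - g x) 2 ν := by
    intro i
    have e : g - g' = (fun x => F i x - g' x) - fun x => F i x - g x := by
      funext x; simp
    rw [e]
    exact eLpNorm_sub_le ((hF i).sub hg') ((hF i).sub hg) (by norm_num)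
  have h0 : eLpNorm (g - g') 2 ν ≤ 0 := by
    have ht : Tendsto (fun i => eLpNorm (fun x => F i x - g' x) 2 ν +
        eLpNorm (fun x => F i x - g x) 2 ν) l (𝓝 0) := by simpa using h'.add h
    exact ge_of_tendsto' ht hle
  have h1 := (eLpNorm_eq_zero_iff (hg.sub hg') (by norm_num)).1 (nonpos_iff_eq_zero.1 h0)
  filter_upwards [h1] with x hx
  simpa [sub_eq_zero] using hx

/-- Local limits of difference quotients can be glued together. -/
theorem exists_locDiff {Ω : Set (E n)} (hΩ : IsOpen Ω) {e : E n} {h : E n → ℝ}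
    (hh : ∀ K, IsCompact K → MemLp h 2 (volume.restrict K))
    (hloc : ∀ K, IsCompact K → K ⊆ Ω → ∃ g, MemLp g 2 (volume.restrict K) ∧
      Tendsto (fun t => eLpNorm (fun x => dq e t h x - g x) 2 (volume.restrict K)) (𝓝[≠] 0)
        (𝓝 0)) : ∃ g, LocDiff Ω e h g := by
  classical
  obtain ⟨κ, hκc, hκΩ, hκmono, hκ⟩ : ∃ κ : ℕ → Set (E n), (∀ m, IsCompact (κ m)) ∧
      (∀ m, κ m ⊆ Ω) ∧ Monotone κ ∧ ∀ K, IsCompact K → K ⊆ Ω → ∃ m, K ⊆ κ m := by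
    have hlc : LocallyCompactSpace Ω := hΩ.locallyCompactSpace
    let X : CompactExhaustion Ω := CompactExhaustion.choice Ω
    refine ⟨fun m => Subtype.val '' X m, fun m => (X.isCompact m).image continuous_subtype_val,
      fun m => by rintro _ ⟨y, -, rfl⟩; exact y.2,
      fun a b hab => Set.image_mono (X.subset hab), fun K hK hKΩ => ?_⟩
    have hK' : IsCompact (Subtype.val ⁻¹' K : Set Ω) := by
      rw [Subtype.isCompact_iff, Subtype.image_preimage_coe, Set.inter_eq_right.2 hKΩ]
      exact hK
    obtain ⟨m, hm⟩ := X.exists_superset_of_isCompact hK'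
    exact ⟨m, fun x hx => ⟨⟨x, hKΩ hx⟩, hm hx, rfl⟩⟩
  choose g hgm hgt using fun m => hloc (κ m) (hκc m) (hκΩ m)
  -- Each point takes the limit belonging to the first set of the exhaustion that contains it.
  -- Limits on nested sets agree almost everywhere, so the choice does not matter.
  let G : E n → ℝ := fun x => if hx : ∃ m, x ∈ κ m then g (Nat.find hx) x else 0
  have huniq : ∀ j M, j ≤ M → g j =ᵐ[volume.restrict (κ j)] g M := by
    intro j M hjM
    have hsub := hκmono hjM
    refine ae_eq_of_tendsto_dq (l := 𝓝[≠] (0 : ℝ)) (F := fun t => dq e t h)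
      (fun t => (memLp_dq hh e t _ (hκc j)).1) (hgm j).1
      ((hgm M).mono_measure (Measure.restrict_mono_set _ hsub)).1 (hgt j) ?_
    exact tendsto_eLpNorm_zero_mono (hgt M) (Eventually.of_forall fun t =>
      eLpNorm_mono_measure _ (Measure.restrict_mono_set _ hsub))
  have hG : ∀ M, G =ᵐ[volume.restrict (κ M)] g M := by
    intro M
    have h1 : ∀ᵐ x ∂(volume : Measure (E n)), ∀ j, j ≤ M → x ∈ κ j → g j x = g M x := by
      rw [ae_all_iff]
      intro j
      by_cases hj : j ≤ M
      · filter_upwards [(ae_restrict_iff' (hκc j).measurableSet).1 (huniq j M hj)] with x hx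
        exact fun _ => hx
      · exact Eventually.of_forall fun x h => absurd h hj
    filter_upwards [ae_restrict_of_ae h1, ae_restrict_mem (hκc M).measurableSet] with x hx hxM
    have hex : ∃ m, x ∈ κ m := ⟨M, hxM⟩
    simp only [G, hex, dif_pos]
    exact hx _ (Nat.find_min' hex hxM) (Nat.find_spec hex)
  refine ⟨G, hh, fun K hK hKΩ => ?_, fun K hK hKΩ => ?_⟩
  · obtain ⟨m, hm⟩ := hκ K hK hKΩ
    exact ((hgm m).ae_eq (hG m).symm).mono_measure (Measure.restrict_mono_set _ hm)
  · obtain ⟨m, hm⟩ := hκ K hK hKΩ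
    have h1 : Tendsto (fun t => eLpNorm (fun x => dq e t h x - G x) 2 (volume.restrict (κ m)))
        (𝓝[≠] 0) (𝓝 0) := by
      refine (hgt m).congr fun t => eLpNorm_congr_ae ?_
      filter_upwards [hG m] with x hx
      rw [hx]
    exact tendsto_eLpNorm_zero_mono h1 (Eventually.of_forall fun t =>
      eLpNorm_mono_measure _ (Measure.restrict_mono_set _ hm))

end

/-! ### The power map |x|^a x and the pointwise Caccioppoli estimate. -/

section

open Filter Topology ENNReal

variable {n : ℕ} {p : ℝ} {f : E n → ℝ} {Ω : Set (E n)} {u : E n → ℝ} {G : E n → E n}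

/-- The radial power map `x ↦ |x|^a x`. -/
def radial (a : ℝ) (x : E n) : E n := ‖x‖ ^ a • x

theorem radial_zero (a : ℝ) : radial a (0 : E n) = 0 := by simp [radial]

theorem isHomog_radial (a : ℝ) : IsHomog (a + 1) (radial (n := n) a) := by
  intro t ht x hx
  rw [radial, radial, norm_smul, Real.norm_of_nonneg ht.le, Real.mul_rpow ht.le (norm_nonneg x),
    smul_smul, smul_smul, Real.rpow_add_one ht.ne']
  ring_nf

theorem contDiffOn_radial (a : ℝ) : ContDiffOn ℝ 1 (radial (n := n) a) {0}ᶜ := by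
  intro x hx
  have h1 : ContDiffAt ℝ 1 (fun x : E n => ‖x‖ ^ a) x :=
    (contDiffAt_norm ℝ hx).rpow_const_of_ne (norm_ne_zero_iff.2 hx)
  exact (h1.smul contDiffAt_id).contDiffWithinAt

theorem norm_radial {a : ℝ} {x : E n} (hx : x ≠ 0) : ‖radial a x‖ = ‖x‖ ^ (a + 1) := by
  rw [radial, norm_smul, Real.norm_of_nonneg (by positivity),
    Real.rpow_add_one (norm_ne_zero_iff.2 hx)]

theorem measurable_radial (a : ℝ) : Measurable (radial (n := n) a) :=
  (measurable_norm.pow_const a).smul measurable_id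

/-- Weak solutions of `∇ · Df(∇u) = 0` in `Ω` whose representatives are defined on the whole
space. -/
structure IsGlobalSol (p : ℝ) (f : E n → ℝ) (Ω : Set (E n)) (u : E n → ℝ) (G : E n → E n) :
    Prop where
  weakGrad : ∀ i, IsWeakDerivOn Ω (EuclideanSpace.single i 1) u fun x => G x i
  measurable_grad : Measurable G
  memLp : MemLp u (ENNReal.ofReal p)
  memLp_grad : MemLp G (ENNReal.ofReal p)
  eqn : ∀ φ : E n → ℝ, IsTest Ω φ → ∫ x, ∑ k, pd k f (G x) * pd k φ x = 0

theorem add_rpow_le_two_rpow_mul {a b : ℝ} (ha : 0 ≤ a) (hb : 0 ≤ b) (hp : 0 ≤ p) :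
    (a + b) ^ p ≤ 2 ^ p * (a ^ p + b ^ p) := by
  rcases le_total a b with h | h
  · calc (a + b) ^ p ≤ (2 * b) ^ p := Real.rpow_le_rpow (by positivity) (by linarith) hp
      _ = 2 ^ p * b ^ p := Real.mul_rpow (by norm_num) hb
      _ ≤ _ := by gcongr; linarith [Real.rpow_nonneg ha p]
  · calc (a + b) ^ p ≤ (2 * a) ^ p := Real.rpow_le_rpow (by positivity) (by linarith) hp
      _ = 2 ^ p * a ^ p := Real.mul_rpow (by norm_num) ha
      _ ≤ _ := by gcongr; linarith [Real.rpow_nonneg hb p]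

/-- The pointwise estimate behind the difference quotient version of Caccioppoli's inequality. -/
theorem IsAdmissible.exists_caccioppoli_pointwise (hf : IsAdmissible p f) (hp : 2 ≤ p) :
    ∃ c C : ℝ, 0 < c ∧ 0 < C ∧ ∀ (a b ξ : E n) (t z ζ : ℝ),
      c * (ζ ^ 2 * ‖t⁻¹ • (radial ((p - 2) / 2) a - radial ((p - 2) / 2) b)‖ ^ 2) ≤
        ζ ^ 2 * (t⁻¹ * (t⁻¹ * (fderiv ℝ f a - fderiv ℝ f b) (a - b))) +
          2 * ζ * z * (t⁻¹ * (fderiv ℝ f a - fderiv ℝ f b) ξ) +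
          C * ‖ξ‖ ^ 2 * ((‖a‖ + ‖b‖) ^ p + |z| ^ p) := by
  obtain ⟨c, hc, hmono⟩ := hf.exists_monotone hp
  obtain ⟨C, hC, hlip⟩ := hf.exists_lipschitz_fderiv hp
  obtain ⟨D, hD, hV⟩ := (isHomog_radial (n := n) ((p - 2) / 2)).exists_lipschitz (by linarith)
    (radial_zero _) (contDiffOn_radial _)
  -- Monotonicity supplies c ζ² Λ Q². Half of it controls the increment of the power map, whose
  -- Lipschitz constant is `D`; the other half absorbs the mixed term by completing a square, which
  -- costs 2C²/c.
  refine ⟨c / (2 * D ^ 2), 2 * C ^ 2 / c, by positivity, by positivity, fun a b ξ t z ζ => ?_⟩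
  set s := ‖a‖ + ‖b‖ with hs
  have hs0 : 0 ≤ s := by positivity
  set Λ := s ^ (p - 2) with hΛ
  have hΛ0 : 0 ≤ Λ := by positivity
  set Q := |t⁻¹| * ‖a - b‖ with hQ
  have h1 : c * Λ * Q ^ 2 ≤ t⁻¹ * (t⁻¹ * (fderiv ℝ f a - fderiv ℝ f b) (a - b)) := by
    have := mul_le_mul_of_nonneg_left (hmono a b) (sq_nonneg t⁻¹)
    calc c * Λ * Q ^ 2 = t⁻¹ ^ 2 * (c * Λ * ‖a - b‖ ^ 2) := by
          rw [hQ, mul_pow, sq_abs]; ring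
      _ ≤ _ := this
      _ = _ := by ring
  have h2 : |t⁻¹ * (fderiv ℝ f a - fderiv ℝ f b) ξ| ≤ C * Λ * Q * ‖ξ‖ := by
    rw [abs_mul]
    have := ((fderiv ℝ f a - fderiv ℝ f b).le_opNorm ξ).trans
      (mul_le_mul_of_nonneg_right (hlip a b) (norm_nonneg ξ))
    calc _ ≤ |t⁻¹| * (C * Λ * ‖a - b‖ * ‖ξ‖) := mul_le_mul_of_nonneg_left this (abs_nonneg _)
      _ = _ := by rw [hQ]; ring
  have h3 : ‖t⁻¹ • (radial ((p - 2) / 2) a - radial ((p - 2) / 2) b)‖ ^ 2 ≤ D ^ 2 * Λ * Q ^ 2 := by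
    have hΛs : (s ^ ((p - 2) / 2 + 1 - 1)) ^ 2 = Λ := by
      rw [hΛ, ← Real.rpow_natCast, ← Real.rpow_mul hs0]
      congr 1
      push_cast
      ring
    have h4 : ‖t⁻¹ • (radial ((p - 2) / 2) a - radial ((p - 2) / 2) b)‖ ≤
        D * s ^ ((p - 2) / 2 + 1 - 1) * Q := by
      rw [norm_smul, Real.norm_eq_abs]
      calc _ ≤ |t⁻¹| * (D * s ^ ((p - 2) / 2 + 1 - 1) * ‖a - b‖) :=
            mul_le_mul_of_nonneg_left (hV a b) (abs_nonneg _)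
        _ = _ := by rw [hQ]; ring
    calc _ ≤ (D * s ^ ((p - 2) / 2 + 1 - 1) * Q) ^ 2 := pow_le_pow_left₀ (norm_nonneg _) h4 2
      _ = _ := by rw [mul_pow, mul_pow, hΛs]
  -- With r the larger of s and |z|, the left side is at most r^(p-2) r² = r^p.
  have h5 : Λ * z ^ 2 ≤ s ^ p + |z| ^ p := by
    have hpow : ∀ r : ℝ, 0 ≤ r → r ^ (p - 2) * r ^ 2 = r ^ p := by
      intro r hr
      rw [← Real.rpow_natCast r 2, ← Real.rpow_add_of_nonneg hr (by linarith) (by norm_num)]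
      norm_num
    rcases le_total |z| s with h | h
    · have : Λ * z ^ 2 ≤ s ^ p := by
        rw [← hpow s hs0, ← sq_abs z]; gcongr
      linarith [Real.rpow_nonneg (abs_nonneg z) p]
    · have : Λ * z ^ 2 ≤ |z| ^ p := by
        rw [← hpow |z| (abs_nonneg z), ← sq_abs z, hΛ]
        have := Real.rpow_le_rpow hs0 h (by linarith : 0 ≤ p - 2)
        gcongr
      linarith [Real.rpow_nonneg hs0 p]
  have h6 : c / (2 * D ^ 2) * (ζ ^ 2 *
      ‖t⁻¹ • (radial ((p - 2) / 2) a - radial ((p - 2) / 2) b)‖ ^ 2) ≤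
      c / 2 * ζ ^ 2 * Λ * Q ^ 2 := by
    calc _ ≤ c / (2 * D ^ 2) * (ζ ^ 2 * (D ^ 2 * Λ * Q ^ 2)) := by gcongr
      _ = _ := by field_simp
  have h7 : 2 * C ^ 2 / c * ‖ξ‖ ^ 2 * (Λ * z ^ 2) ≤
      2 * C ^ 2 / c * ‖ξ‖ ^ 2 * (s ^ p + |z| ^ p) := by gcongr
  have h8 : -(2 * |ζ| * |z| * (C * Λ * Q * ‖ξ‖)) ≤
      2 * ζ * z * (t⁻¹ * (fderiv ℝ f a - fderiv ℝ f b) ξ) := by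
    have : |2 * ζ * z * (t⁻¹ * (fderiv ℝ f a - fderiv ℝ f b) ξ)| ≤
        2 * |ζ| * |z| * (C * Λ * Q * ‖ξ‖) := by
      rw [abs_mul, abs_mul, abs_mul, abs_two]
      gcongr
    exact (neg_le_neg this).trans (neg_abs_le _)
  have h9 : 0 ≤ c / 2 * ζ ^ 2 * Λ * Q ^ 2 - 2 * |ζ| * |z| * (C * Λ * Q * ‖ξ‖) +
      2 * C ^ 2 / c * ‖ξ‖ ^ 2 * (Λ * z ^ 2) := by
    have : c / 2 * ζ ^ 2 * Λ * Q ^ 2 - 2 * |ζ| * |z| * (C * Λ * Q * ‖ξ‖) +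
        2 * C ^ 2 / c * ‖ξ‖ ^ 2 * (Λ * z ^ 2) =
        Λ / (2 * c) * (c * |ζ| * Q - 2 * C * |z| * ‖ξ‖) ^ 2 := by
      rw [← sq_abs ζ, ← sq_abs z]
      field_simp
      ring
    rw [this]
    positivity
  have h10 := mul_le_mul_of_nonneg_left h1 (sq_nonneg ζ)
  linarith

end

/-! ### The differenced equation and L^p bounds for difference quotients of u. -/

section

open Filter Topology ENNReal

variable {n : ℕ} {p : ℝ} {f : E n → ℝ} {Ω : Set (E n)} {u : E n → ℝ} {G : E n → E n}

theorem eLpNorm_two_le_of_integral_sq_le {h : E n → ℝ} (hh : MemLp h 2) {C : ℝ}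
    (hC : ∫ x, h x ^ 2 ≤ C) : eLpNorm h 2 volume ≤ ENNReal.ofReal √C := by
  rw [hh.eLpNorm_eq_integral_rpow_norm (by norm_num) (by norm_num)]
  apply ENNReal.ofReal_le_ofReal
  rw [Real.sqrt_eq_rpow]
  simp only [toReal_ofNat, Real.rpow_ofNat, Real.norm_eq_abs, sq_abs, one_div]
  exact Real.rpow_le_rpow (integral_nonneg fun x => sq_nonneg _) hC (by norm_num)

theorem IsBumpFun.memLp_mul {φ g : E n → ℝ} (hφ : IsBumpFun φ) {q : ℝ≥0∞} (hg : MemLp g q) :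
    MemLp (fun x => φ x * g x) q :=
  memLp_mul_of_support hφ.compact hφ.continuous
    (fun _ hx => image_eq_zero_of_notMem_tsupport hx) (hg.restrict _)

theorem IsBumpFun.memLp_fderiv_mul {φ g : E n → ℝ} (hφ : IsBumpFun φ) {q : ℝ≥0∞}
    (hg : MemLp g q) (e : E n) : MemLp (fun x => fderiv ℝ φ x e * g x) q :=
  memLp_mul_of_support hφ.compact (hφ.continuous_fderiv e)
    (fun _ hx => fderiv_apply_eq_zero_of_notMem_tsupport e hx) (hg.restrict _)

theorem memLp_dq_global {h : E n → ℝ} {q : ℝ≥0∞} (hh : MemLp h q) (e : E n) (t : ℝ) :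
    MemLp (dq e t h) q :=
  ((hh.comp_measurePreserving (measurePreserving_add_right volume (t • e))).sub hh).const_mul t⁻¹

theorem integral_dq_mul {h φ : E n → ℝ} {q q' : ℝ≥0∞} [ENNReal.HolderConjugate q' q]
    (hh : MemLp h q') (hφ : MemLp φ q) (e : E n) (t : ℝ) :
    ∫ x, dq e t h x * φ x = t⁻¹ * ((∫ x, h x * φ (x - t • e)) - ∫ x, h x * φ x) := by
  have h1 := (hh.comp_measurePreserving (measurePreserving_add_right volume (t • e)))
  have i1 : Integrable fun x => h (x + t • e) * φ x := h1.integrable_mul hφ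
  have i2 : Integrable fun x => h x * φ x := hh.integrable_mul hφ
  rw [← integral_mul_translate, ← integral_sub i1 i2, ← integral_const_mul]
  refine integral_congr_ae (Eventually.of_forall fun x => ?_)
  simp only [dq]
  ring

theorem IsTest.comp_sub {O O' : Set (E n)} {φ : E n → ℝ} {y : E n} (hφ : IsTest O φ)
    (h : ∀ x ∈ O, x + y ∈ O') : IsTest O' fun x => φ (x - y) := by
  have hb : IsBumpFun fun x => φ (x + -y) := hφ.isBumpFun.comp_add (-y)
  simp only [← sub_eq_add_neg] at hb
  refine ⟨hb.smooth, hb.compact, fun x hx => ?_⟩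
  have hc : tsupport (fun x => φ (x - y)) ⊆ (fun x => x - y) ⁻¹' tsupport φ :=
    closure_minimal (fun z hz => subset_tsupport φ hz)
      ((isClosed_tsupport φ).preimage (continuous_id.sub continuous_const))
  simpa using h _ (hφ.supp (hc hx))

theorem fderiv_comp_sub_apply (φ : E n → ℝ) (x y v : E n) :
    fderiv ℝ (fun z => φ (z - y)) x v = fderiv ℝ φ (x - y) v := by
  have := fderiv_translate φ x (-y)
  simp only [← sub_eq_add_neg] at this
  rw [this]

theorem IsWeakDerivOn.dq {O O' : Set (E n)} {e v : E n} {t : ℝ} {h g : E n → ℝ} {q q' : ℝ≥0∞}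
    [ENNReal.HolderConjugate q' q] (hw : IsWeakDerivOn O' v h g) (hh : MemLp h q')
    (hg : MemLp g q') (hO : ∀ x ∈ O, x + t • e ∈ O') (hOO' : O ⊆ O') :
    IsWeakDerivOn O v (dq e t h) (dq e t g) := by
  intro φ hφ
  have hb := hφ.isBumpFun
  have hφ' : MemLp (fun x => fderiv ℝ φ x v) q :=
    (hb.continuous_fderiv v).memLp_of_hasCompactSupport (hb.hasCompactSupport_fderiv v)
  have h1 := hw _ (hφ.comp_sub hO)
  have h2 := hw _ (hφ.mono hOO')
  simp only [fderiv_comp_sub_apply] at h1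
  rw [integral_dq_mul hh hφ', integral_dq_mul hg (hb.memLp q), h1, h2]
  ring

/-- The growth |Df(η)| ≤ C |η|^{p-1} is what puts Df(∇u) in the dual exponent p/(p-1). -/
theorem IsGlobalSol.memLp_pd (hs : IsGlobalSol p f Ω u G) (hf : IsAdmissible p f) (hp : 2 ≤ p)
    (k : Fin n) : MemLp (fun x => pd k f (G x)) (ENNReal.ofReal (p / (p - 1))) := by
  obtain ⟨C, hC, hb⟩ := hf.exists_fderiv_bound hp
  have h0 : MemLp (fun x => ‖G x‖ ^ (p - 1)) (ENNReal.ofReal (p / (p - 1))) := by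
    have := hs.memLp_grad.norm_rpow_div (ENNReal.ofReal (p - 1))
    rwa [ENNReal.toReal_ofReal (by linarith), ← ENNReal.ofReal_div_of_pos (by linarith)] at this
  have hcont : Continuous (pd k f) := (hf.continuous_fderiv hp).clm_apply continuous_const
  refine (h0.const_mul C).mono' (hcont.measurable.comp hs.measurable_grad).aestronglyMeasurable
    (Eventually.of_forall fun x => ?_)
  calc ‖pd k f (G x)‖ ≤ ‖fderiv ℝ f (G x)‖ * ‖EuclideanSpace.single k (1 : ℝ)‖ :=
        ContinuousLinearMap.le_opNorm _ _
    _ ≤ _ := by simpa using hb (G x)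

theorem holderConjugate_ofReal (hp : 1 < p) :
    ENNReal.HolderConjugate (ENNReal.ofReal (p / (p - 1))) (ENNReal.ofReal p) := by
  have h : Real.HolderConjugate (p / (p - 1)) p := (Real.HolderConjugate.conjExponent hp).symm
  exact h.ennrealOfReal

/-- The equation is tested with φ and with its translate φ(· - te), both supported in Ω; subtracting
moves the quotient onto Df(∇u). -/
theorem IsGlobalSol.integral_dq_pd (hs : IsGlobalSol p f Ω u G) (hf : IsAdmissible p f)
    (hp : 2 ≤ p) {O : Set (E n)} {e : E n} {t : ℝ} (hO : ∀ x ∈ O, x + t • e ∈ Ω)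
    (hOΩ : O ⊆ Ω) {φ : E n → ℝ} (hφ : IsTest O φ) :
    ∫ x, ∑ k, dq e t (fun x => pd k f (G x)) x * pd k φ x = 0 := by
  have := holderConjugate_ofReal (p := p) (by linarith)
  have hb := hφ.isBumpFun
  have hm : ∀ {ψ : E n → ℝ}, IsBumpFun ψ → ∀ k, MemLp (pd k ψ) (ENNReal.ofReal p) :=
    fun {ψ} hψ k => (hψ.continuous_fderiv _).memLp_of_hasCompactSupport
      (hψ.hasCompactSupport_fderiv _)
  have hφ' := hm hb
  have hψ := hφ.comp_sub hO
  have h1 := hs.eqn _ hψ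
  have h2 := hs.eqn _ (hφ.mono hOΩ)
  have i1 : ∀ k, Integrable fun x => pd k f (G x) * pd k (fun z => φ (z - t • e)) x :=
    fun k => (hs.memLp_pd hf hp k).integrable_mul (hm hψ.isBumpFun k)
  have i2 : ∀ k, Integrable fun x => pd k f (G x) * pd k φ x :=
    fun k => (hs.memLp_pd hf hp k).integrable_mul (hφ' k)
  have i3 : ∀ k, Integrable fun x => dq e t (fun x => pd k f (G x)) x * pd k φ x :=
    fun k => (memLp_dq_global (hs.memLp_pd hf hp k) e t).integrable_mul (hφ' k)
  rw [integral_finsetSum _ fun k _ => i1 k] at h1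
  rw [integral_finsetSum _ fun k _ => i2 k] at h2
  rw [integral_finsetSum _ fun k _ => i3 k]
  have h3 : ∀ k, ∫ x, dq e t (fun x => pd k f (G x)) x * pd k φ x =
      t⁻¹ * ((∫ x, pd k f (G x) * pd k (fun z => φ (z - t • e)) x) -
        ∫ x, pd k f (G x) * pd k φ x) := by
    intro k
    rw [integral_dq_mul (hs.memLp_pd hf hp k) (hφ' k)]
    simp only [pd, fderiv_comp_sub_apply]
  rw [Finset.sum_congr rfl fun k _ => h3 k, ← Finset.mul_sum, Finset.sum_sub_distrib, h1, h2]
  simp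

theorem integral_norm_rpow_le {h : E n → ℝ} (hp : 0 < p) (hh : MemLp h (ENNReal.ofReal p))
    {B : ℝ≥0∞}
    (hB : B ≠ ∞) (hb : eLpNorm h (ENNReal.ofReal p) volume ≤ B) :
    ∫ x, |h x| ^ p ≤ B.toReal ^ p := by
  have h1 := hh.eLpNorm_eq_integral_rpow_norm (by simpa using hp) (by simp)
  rw [ENNReal.toReal_ofReal hp.le] at h1
  have h0 : 0 ≤ ∫ x, |h x| ^ p := integral_nonneg fun x => by positivity
  have h2 := ENNReal.toReal_mono hB hb
  rw [h1, ENNReal.toReal_ofReal (by positivity)] at h2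
  calc ∫ x, |h x| ^ p = ((∫ x, |h x| ^ p) ^ p⁻¹) ^ p := by
        rw [← Real.rpow_mul h0, inv_mul_cancel₀ hp.ne', Real.rpow_one]
    _ ≤ _ := Real.rpow_le_rpow (by positivity) h2 hp.le

theorem IsGlobalSol.memLp_grad_apply (hs : IsGlobalSol p f Ω u G) (i : Fin n) :
    MemLp (fun x => G x i) (ENNReal.ofReal p) :=
  hs.memLp_grad.mono (((EuclideanSpace.proj i : E n →L[ℝ] ℝ).continuous.measurable.comp
    hs.measurable_grad).aestronglyMeasurable) (Eventually.of_forall fun _ => PiLp.norm_apply_le _ _)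

/-- Local `L^p` bounds for the difference quotients of `u`. -/
theorem IsGlobalSol.exists_dq_bound (hs : IsGlobalSol p f Ω u G) (hp : 2 ≤ p) (hΩ : IsOpen Ω)
    {S : Set (E n)} (hS : IsCompact S) (hSΩ : S ⊆ Ω) (i : Fin n) :
    ∃ U : E n → ℝ, ∃ B : ℝ, MemLp U (ENNReal.ofReal p) ∧
      ∀ᶠ t in 𝓝[≠] (0 : ℝ), (∀ x ∈ S, dq (EuclideanSpace.single i 1) t u x =
          dq (EuclideanSpace.single i 1) t U x) ∧
        ∫ x, |dq (EuclideanSpace.single i 1) t U x| ^ p ≤ B := by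
  have hcj := holderConjugate_ofReal (p := p) (by linarith)
  have f1 : Fact (1 ≤ ENNReal.ofReal p) := ⟨by simpa using by linarith⟩
  have f2 : Fact (1 ≤ ENNReal.ofReal (p / (p - 1))) :=
    ⟨by rw [ENNReal.one_le_ofReal, le_div_iff₀ (by linarith)]; linarith⟩
  obtain ⟨ζ, hζ, -, O, hO, hSO, hone⟩ := exists_cutoff hS hΩ hSΩ
  have hb := hζ.isBumpFun
  have hGi := hs.memLp_grad_apply i
  have hU := hb.memLp_mul hs.memLp
  have hg : MemLp (fun x => fderiv ℝ ζ x (EuclideanSpace.single i 1) * u x + ζ x * G x i)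
      (ENNReal.ofReal p) :=
    (hb.memLp_fderiv_mul hs.memLp (EuclideanSpace.single i 1)).add (hb.memLp_mul hGi)
  have hw := (hs.weakGrad i).mul_test (hs.memLp.locallyIntegrable f1.out)
    (hGi.locallyIntegrable f1.out) hζ
  have ht := tendsto_dq_of_isWeakDeriv (q' := ENNReal.ofReal (p / (p - 1))) (by simp) hU hg hw
  -- `U` is `u` times a cutoff. Its difference quotients converge in L^p to the weak derivative, so
  -- their norms are eventually at most that of the limit plus 1.
  refine ⟨_, (eLpNorm (fun x => fderiv ℝ ζ x (EuclideanSpace.single i 1) * u x + ζ x * G x i)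
    (ENNReal.ofReal p) volume + 1).toReal ^ p, hU, ?_⟩
  filter_upwards [eventually_dq_eq (e := EuclideanSpace.single i 1) hS hO hSO
    (h := u) (h' := fun x => ζ x * u x) (fun x hx => by rw [hone x hx, one_mul]),
    ht.eventually_le_const (u := 1) (by simp)] with t h1 h2
  refine ⟨h1, integral_norm_rpow_le (by linarith) (memLp_dq_global hU _ t)
    (add_ne_top.2 ⟨hg.eLpNorm_ne_top, by simp⟩) ?_⟩
  have h3 := eLpNorm_add_le ((memLp_dq_global hU (EuclideanSpace.single i 1) t).sub hg).1 hg.1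
    f1.out
  rw [sub_add_cancel] at h3
  refine h3.trans ?_
  rw [add_comm]
  exact add_le_add le_rfl h2

end

/-! ### Square integrable derivatives of V(∇u) = |∇u|^{(p-2)/2} ∇u. -/

section

open Filter Topology ENNReal

variable {n : ℕ} {p : ℝ} {f : E n → ℝ} {Ω : Set (E n)} {u : E n → ℝ} {G : E n → E n}

theorem norm_radial_sq (hp : 0 < p) (x : E n) : ‖radial ((p - 2) / 2) x‖ ^ 2 = ‖x‖ ^ p := by
  rcases eq_or_ne x 0 with rfl | hx
  · simp [radial_zero, hp.ne']
  · rw [norm_radial hx, ← Real.rpow_natCast, ← Real.rpow_mul (norm_nonneg x)]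
    congr 1
    push_cast
    ring

theorem IsGlobalSol.memLp_radial (hs : IsGlobalSol p f Ω u G) (hp : 0 < p) (j : Fin n) :
    MemLp (fun x => radial ((p - 2) / 2) (G x) j) 2 := by
  have hm : Measurable fun x => radial ((p - 2) / 2) (G x) :=
    (measurable_radial _).comp hs.measurable_grad
  have h1 : MemLp (fun x => radial ((p - 2) / 2) (G x)) 2 := by
    rw [← integrable_norm_rpow_iff hm.aestronglyMeasurable (by norm_num) (by norm_num)]
    simp only [toReal_ofNat, Real.rpow_ofNat, norm_radial_sq hp]
    have := hs.memLp_grad.integrable_norm_rpow (by simpa using hp) (by simp)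
    rwa [ENNReal.toReal_ofReal hp.le] at this
  exact h1.mono (((EuclideanSpace.proj j : E n →L[ℝ] ℝ).continuous.measurable.comp
    hm).aestronglyMeasurable) (Eventually.of_forall fun _ => PiLp.norm_apply_le _ _)

/-- Testing the differenced equation with `ζ² D^t u`. -/
theorem IsGlobalSol.integral_caccioppoli (hs : IsGlobalSol p f Ω u G) (hf : IsAdmissible p f)
    (hp : 2 ≤ p) {O : Set (E n)} (hO : IsOpen O) {e : E n} {t : ℝ}
    (hOt : ∀ x ∈ O, x + t • e ∈ Ω) (hOΩ : O ⊆ Ω) {ζ : E n → ℝ} (hζ : IsTest O ζ) :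
    (∀ k, Integrable fun x => dq e t (fun x => pd k f (G x)) x *
      (2 * ζ x * pd k ζ x * dq e t u x + ζ x ^ 2 * dq e t (fun x => G x k) x)) ∧
    ∫ x, ∑ k, dq e t (fun x => pd k f (G x)) x *
      (2 * ζ x * pd k ζ x * dq e t u x + ζ x ^ 2 * dq e t (fun x => G x k) x) = 0 := by
  have hcj := holderConjugate_ofReal (p := p) (by linarith)
  have f1 : Fact (1 ≤ ENNReal.ofReal p) := ⟨by simpa using by linarith⟩
  have f2 : Fact (1 ≤ ENNReal.ofReal (p / (p - 1))) :=
    ⟨by rw [ENNReal.one_le_ofReal, le_div_iff₀ (by linarith)]; linarith⟩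
  have hζ2 : IsTest O fun x => ζ x * ζ x :=
    ⟨hζ.smooth.mul hζ.smooth, hζ.compact.mul_right,
      (closure_mono (Function.support_mul_subset_left ζ ζ)).trans hζ.supp⟩
  have hb := hζ2.isBumpFun
  have hu := memLp_dq_global hs.memLp e t
  have hG := fun k => memLp_dq_global (hs.memLp_grad_apply k) e t
  have hfd : ∀ k x, fderiv ℝ (fun x => ζ x * ζ x) x (EuclideanSpace.single k 1) =
      2 * ζ x * pd k ζ x := by
    intro k x
    rw [fderiv_fun_mul (hζ.isBumpFun.differentiable x) (hζ.isBumpFun.differentiable x)]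
    simp only [add_apply, smul_apply, smul_eq_mul, pd]
    ring
  have hΞ : ∀ k, MemLp (fun x => 2 * ζ x * pd k ζ x * dq e t u x +
      ζ x ^ 2 * dq e t (fun x => G x k) x) (ENNReal.ofReal p) := by
    intro k
    have : MemLp (fun x => fderiv ℝ (fun x => ζ x * ζ x) x (EuclideanSpace.single k 1) *
        dq e t u x + ζ x * ζ x * dq e t (fun x => G x k) x) (ENNReal.ofReal p) :=
      (hb.memLp_fderiv_mul hu _).add (hb.memLp_mul (hG k))
    simp only [hfd] at this
    simpa only [← pow_two] using this
  have hw : ∀ k, IsWeakDeriv (EuclideanSpace.single k 1) (fun x => ζ x * ζ x * dq e t u x)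
      fun x => 2 * ζ x * pd k ζ x * dq e t u x + ζ x ^ 2 * dq e t (fun x => G x k) x := by
    intro k
    have h1 := (hs.weakGrad k).dq (q := ENNReal.ofReal (p / (p - 1))) hs.memLp
      (hs.memLp_grad_apply k) hOt hOΩ
    have h2 := h1.mul_test (hu.locallyIntegrable f1.out) ((hG k).locallyIntegrable f1.out) hζ2
    simp only [hfd] at h2
    simpa only [← pow_two] using h2
  refine ⟨fun k => (memLp_dq_global (hs.memLp_pd hf hp k) e t).integrable_mul (hΞ k), ?_⟩
  -- The function ζ² D^t u is only of Sobolev class with compact support, so the equation has to be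
  -- extended beyond smooth test functions.
  exact integral_eq_zero_of_divFree (q := ENNReal.ofReal p) (q' := ENNReal.ofReal (p / (p - 1)))
    (by simp) hζ.compact hO hζ.supp
    (fun k => memLp_dq_global (hs.memLp_pd hf hp k) e t)
    (fun φ hφ => hs.integral_dq_pd hf hp hOt hOΩ hφ) (hb.memLp_mul hu) hΞ hw
    (fun x hx => by rw [image_eq_zero_of_notMem_tsupport hx]; ring)

theorem dq_mul_sq_le {ζ h : E n → ℝ} {L : NNReal} (hL : LipschitzWith L ζ) {e : E n}
    (he : ‖e‖ = 1) {t : ℝ} (ht : t ≠ 0) (x : E n) :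
    dq e t (fun x => ζ x * h x) x ^ 2 ≤
      2 * (L : ℝ) ^ 2 * h (x + t • e) ^ 2 + 2 * (ζ x ^ 2 * dq e t h x ^ 2) := by
  have h1 : dq e t (fun x => ζ x * h x) x = dq e t ζ x * h (x + t • e) + ζ x * dq e t h x := by
    simp only [dq]; ring
  have h2 := abs_dq_le hL e ht x
  rw [he, mul_one] at h2
  have h3 : dq e t ζ x ^ 2 ≤ (L : ℝ) ^ 2 := by
    rw [← sq_abs]; exact pow_le_pow_left₀ (abs_nonneg _) h2 2
  have h4 := mul_le_mul_of_nonneg_right h3 (sq_nonneg (h (x + t • e)))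
  rw [h1]
  nlinarith [sq_nonneg (dq e t ζ x * h (x + t • e) - ζ x * dq e t h x)]

/-- Difference quotients of `ζ V(∇u)`, with `V(η) = |η|^{(p-2)/2} η`, are bounded in `L²`. -/
theorem IsGlobalSol.exists_dq_radial_bound (hs : IsGlobalSol p f Ω u G) (hf : IsAdmissible p f)
    (hp : 2 ≤ p) (hΩ : IsOpen Ω) {ζ : E n → ℝ} (hζ : IsTest Ω ζ) (i j : Fin n) :
    ∃ C : ℝ, ∀ᶠ t in 𝓝[≠] (0 : ℝ), eLpNorm (dq (EuclideanSpace.single i 1) t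
      fun x => ζ x * radial ((p - 2) / 2) (G x) j) 2 volume ≤ ENNReal.ofReal C := by
  have hb := hζ.isBumpFun
  obtain ⟨L, hL⟩ := hb.exists_lipschitz
  obtain ⟨c, C, hc, hC, hpt⟩ := hf.exists_caccioppoli_pointwise (n := n) hp
  obtain ⟨U, B, hU, hUB⟩ := hs.exists_dq_bound hp hΩ hζ.compact hζ.supp i
  obtain ⟨δ, hδ, hδΩ⟩ := hζ.compact.exists_cthickening_subset_open hΩ hζ.supp
  set e : E n := EuclideanSpace.single i 1 with he
  have he1 : ‖e‖ = 1 := by simp [he]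
  let ξ : E n → E n := fun x => WithLp.toLp 2 fun k => pd k ζ x
  obtain ⟨M, hM0, hM⟩ : ∃ M, 0 ≤ M ∧ ∀ x, ‖ξ x‖ ^ 2 ≤ M := by
    have hcont : Continuous ξ :=
      (PiLp.continuous_toLp 2 _).comp (continuous_pi fun k => hb.continuous_fderiv _)
    have hcs : HasCompactSupport ξ := by
      refine HasCompactSupport.intro hb.compact fun x hx => ?_
      ext k
      exact fderiv_apply_eq_zero_of_notMem_tsupport _ hx
    obtain ⟨M, hM⟩ := hcs.exists_bound_of_continuous hcont
    exact ⟨M ^ 2, by positivity, fun x => pow_le_pow_left₀ (norm_nonneg _) (hM x) 2⟩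
  set N := ∫ x, ‖G x‖ ^ p with hN
  have iN : Integrable fun x => ‖G x‖ ^ p := by
    have := hs.memLp_grad.integrable_norm_rpow (by simpa using (by linarith : 0 < p)) (by simp)
    rwa [ENNReal.toReal_ofReal (by linarith)] at this
  -- Half of δ is kept in reserve: a step of length below δ/2 moves `O` within the δ-thickening,
  -- which lies in Ω.
  set O := Metric.thickening (δ / 2) (tsupport ζ) with hO
  -- The first term comes from the quotient falling on ζ in the discrete product rule. The second is
  -- the error of the pointwise estimate: `N` once for each of the gradients at x + te and x, and
  -- `B` for the quotient of `u`; the equation itself contributes zero.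
  refine ⟨√(2 * (L : ℝ) ^ 2 * N + 2 / c * (C * M * (2 ^ p * (N + N) + B))), ?_⟩
  filter_upwards [hUB, eventually_smul_small e (half_pos hδ), self_mem_nhdsWithin] with
    t ⟨hdu, hB⟩ htδ ht0
  have hOt : ∀ x ∈ O, x + t • e ∈ Ω := by
    intro x hx
    obtain ⟨z, hz, hxz⟩ := Metric.mem_thickening_iff.1 hx
    refine hδΩ (Metric.thickening_subset_cthickening _ _ (Metric.mem_thickening_iff.2 ⟨z, hz, ?_⟩))
    calc dist (x + t • e) z ≤ dist (x + t • e) x + dist x z := dist_triangle _ _ _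
      _ < δ / 2 + δ / 2 := by
        refine add_lt_add ?_ hxz
        simpa [dist_eq_norm] using htδ
      _ = δ := add_halves δ
  have hOΩ : O ⊆ Ω := (Metric.thickening_subset_cthickening_of_le (by linarith) _).trans hδΩ
  have hζO : IsTest O ζ := ⟨hζ.smooth, hζ.compact, Metric.self_subset_thickening (half_pos hδ) _⟩
  obtain ⟨iΞ, hΞ⟩ := hs.integral_caccioppoli hf hp Metric.isOpen_thickening hOt hOΩ hζO
  have iT : Integrable fun x => ‖G (x + t • e)‖ ^ p := iN.comp_add_right (t • e)
  have iU : Integrable fun x => |dq e t U x| ^ p := by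
    have := (memLp_dq_global hU e t).integrable_norm_rpow
      (by simpa using (by linarith : 0 < p)) (by simp)
    rwa [ENNReal.toReal_ofReal (by linarith)] at this
  have iS : Integrable fun x => ∑ k, dq e t (fun x => pd k f (G x)) x *
      (2 * ζ x * pd k ζ x * dq e t u x + ζ x ^ 2 * dq e t (fun x => G x k) x) :=
    integrable_finsetSum _ fun k _ => iΞ k
  have hmem : MemLp (dq e t fun x => ζ x * radial ((p - 2) / 2) (G x) j) 2 :=
    memLp_dq_global (hb.memLp_mul (hs.memLp_radial (by linarith) j)) e t
  refine eLpNorm_two_le_of_integral_sq_le hmem ?_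
  have hle : ∀ x, dq e t (fun x => ζ x * radial ((p - 2) / 2) (G x) j) x ^ 2 ≤
      2 * (L : ℝ) ^ 2 * ‖G (x + t • e)‖ ^ p + 2 / c *
        ((∑ k, dq e t (fun x => pd k f (G x)) x *
          (2 * ζ x * pd k ζ x * dq e t u x + ζ x ^ 2 * dq e t (fun x => G x k) x)) +
        C * M * (2 ^ p * (‖G (x + t • e)‖ ^ p + ‖G x‖ ^ p) + |dq e t U x| ^ p)) := by
    intro x
    refine (dq_mul_sq_le hL he1 ht0 x).trans ?_
    have h1 : radial ((p - 2) / 2) (G (x + t • e)) j ^ 2 ≤ ‖G (x + t • e)‖ ^ p := by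
      rw [← norm_radial_sq (by linarith), ← sq_abs]
      exact pow_le_pow_left₀ (abs_nonneg _)
        (PiLp.norm_apply_le (radial ((p - 2) / 2) (G (x + t • e))) j) 2
    have h2 : dq e t (fun x => radial ((p - 2) / 2) (G x) j) x ^ 2 ≤
        ‖t⁻¹ • (radial ((p - 2) / 2) (G (x + t • e)) - radial ((p - 2) / 2) (G x))‖ ^ 2 := by
      rw [← sq_abs]
      refine pow_le_pow_left₀ (abs_nonneg _) ?_ 2
      exact (PiLp.norm_apply_le (t⁻¹ • (radial ((p - 2) / 2) (G (x + t • e)) -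
        radial ((p - 2) / 2) (G x))) j)
    have h3 := hpt (G (x + t • e)) (G x) (ξ x) t (dq e t u x) (ζ x)
    have h4 : ζ x ^ 2 * (t⁻¹ * (t⁻¹ * (fderiv ℝ f (G (x + t • e)) - fderiv ℝ f (G x))
        (G (x + t • e) - G x))) + 2 * ζ x * dq e t u x *
        (t⁻¹ * (fderiv ℝ f (G (x + t • e)) - fderiv ℝ f (G x)) (ξ x)) =
        ∑ k, dq e t (fun x => pd k f (G x)) x *
          (2 * ζ x * pd k ζ x * dq e t u x + ζ x ^ 2 * dq e t (fun x => G x k) x) := by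
      simp only [sub_apply, fderiv_apply_eq_sum]
      rw [← Finset.sum_sub_distrib, ← Finset.sum_sub_distrib]
      simp only [Finset.mul_sum]
      rw [← Finset.sum_add_distrib]
      refine Finset.sum_congr rfl fun k _ => ?_
      simp only [dq, ξ, PiLp.sub_apply]
      ring
    have h5 : C * ‖ξ x‖ ^ 2 * ((‖G (x + t • e)‖ + ‖G x‖) ^ p + |dq e t u x| ^ p) ≤
        C * M * (2 ^ p * (‖G (x + t • e)‖ ^ p + ‖G x‖ ^ p) + |dq e t U x| ^ p) := by
      by_cases hx : x ∈ tsupport ζ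
      · rw [hdu x hx]
        gcongr
        · exact hM x
        · exact add_rpow_le_two_rpow_mul (norm_nonneg _) (norm_nonneg _) (by linarith)
      · have : ξ x = 0 := by
          ext k
          exact fderiv_apply_eq_zero_of_notMem_tsupport _ hx
        rw [this]
        simp only [norm_zero, ne_eq, OfNat.ofNat_ne_zero, not_false_eq_true, zero_pow, mul_zero,
          zero_mul]
        positivity
    have h6 := mul_le_mul_of_nonneg_left h2 (sq_nonneg (ζ x))
    rw [h4] at h3
    have h7 : ζ x ^ 2 * ‖t⁻¹ • (radial ((p - 2) / 2) (G (x + t • e)) -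
        radial ((p - 2) / 2) (G x))‖ ^ 2 ≤ 1 / c * ((∑ k, dq e t (fun x => pd k f (G x)) x *
          (2 * ζ x * pd k ζ x * dq e t u x + ζ x ^ 2 * dq e t (fun x => G x k) x)) +
        C * M * (2 ^ p * (‖G (x + t • e)‖ ^ p + ‖G x‖ ^ p) + |dq e t U x| ^ p)) := by
      rw [one_div, ← div_eq_inv_mul, le_div_iff₀ hc, mul_comm]
      exact h3.trans (add_le_add le_rfl h5)
    have h8 : 2 * (L : ℝ) ^ 2 * radial ((p - 2) / 2) (G (x + t • e)) j ^ 2 ≤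
      2 * (L : ℝ) ^ 2 * ‖G (x + t • e)‖ ^ p := by gcongr
    refine (add_le_add h8 (mul_le_mul_of_nonneg_left (h6.trans h7) zero_le_two)).trans ?_
    rw [← mul_assoc, mul_one_div]
  have i1 : Integrable fun x => 2 * (L : ℝ) ^ 2 * ‖G (x + t • e)‖ ^ p := iT.const_mul _
  have i3 : Integrable fun x => 2 ^ p * (‖G (x + t • e)‖ ^ p + ‖G x‖ ^ p) :=
    (iT.add iN).const_mul _
  have i2 : Integrable fun x =>
      C * M * (2 ^ p * (‖G (x + t • e)‖ ^ p + ‖G x‖ ^ p) + |dq e t U x| ^ p) :=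
    (i3.add iU).const_mul _
  have i4 : Integrable fun x => 2 / c * ((∑ k, dq e t (fun x => pd k f (G x)) x *
          (2 * ζ x * pd k ζ x * dq e t u x + ζ x ^ 2 * dq e t (fun x => G x k) x)) +
        C * M * (2 ^ p * (‖G (x + t • e)‖ ^ p + ‖G x‖ ^ p) + |dq e t U x| ^ p)) :=
    (iS.add i2).const_mul _
  refine (integral_mono_of_nonneg (Eventually.of_forall fun x => sq_nonneg _)
    (i1.add i4) (Eventually.of_forall hle)).trans ?_
  simp only [Pi.add_apply]
  have hNt : ∫ x, ‖G (x + t • e)‖ ^ p = N :=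
    integral_add_right_eq_self (fun x => ‖G x‖ ^ p) (t • e)
  rw [integral_add i1 i4, integral_const_mul, integral_const_mul, integral_add iS i2, hΞ,
    integral_const_mul, integral_add i3 iU, integral_const_mul, integral_add iT iN, hNt, zero_add]
  gcongr

/-- The second derivatives of a weak solution, expressed through `V(∇u)`. -/
theorem IsGlobalSol.exists_locDiff_radial (hs : IsGlobalSol p f Ω u G) (hf : IsAdmissible p f)
    (hp : 2 ≤ p) (hΩ : IsOpen Ω) : ∃ W : Fin n → E n → E n, ∀ i j,
      LocDiff Ω (EuclideanSpace.single i 1) (fun x => radial ((p - 2) / 2) (G x) j)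
        fun x => W i x j := by
  have hV := fun j => hs.memLp_radial (by linarith) j
  have hex : ∀ i j, ∃ g, LocDiff Ω (EuclideanSpace.single i 1)
      (fun x => radial ((p - 2) / 2) (G x) j) g := by
    intro i j
    refine exists_locDiff hΩ (fun K _ => (hV j).restrict K) fun K hK hKΩ => ?_
    obtain ⟨ζ, hζ, -, O, hO, hKO, hone⟩ := exists_cutoff hK hΩ hKΩ
    obtain ⟨C, hC⟩ := hs.exists_dq_radial_bound hf hp hΩ hζ i j
    have hm := hζ.isBumpFun.memLp_mul (hV j)
    obtain ⟨g, hg, hw⟩ := exists_isWeakDeriv_of_dq_bounded hm _ C hC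
    exact ⟨g, hg.restrict K, (LocDiff.of_isWeakDeriv hm hg hw).congr_of_eqOn hK (Set.subset_univ _)
      hO hKO fun x hx => by rw [hone x hx, one_mul]⟩
  choose g hg using hex
  exact ⟨fun i x => WithLp.toLp 2 fun j => g i j x, fun i j => hg i j⟩

end

/-! ### Second derivatives off the zero set of ∇u. -/

section

open Filter Topology ENNReal

variable {n : ℕ} {p : ℝ} {f : E n → ℝ} {Ω : Set (E n)} {u : E n → ℝ} {G : E n → E n}

/-- Continuously differentiable functions with compact support that vanish near the origin. -/
structure IsAnnular {F : Type*} [NormedAddCommGroup F] [NormedSpace ℝ F] (h : F → ℝ) : Prop where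
  contDiff : ContDiff ℝ 1 h
  compact : HasCompactSupport h
  zero : ∀ᶠ x in 𝓝 0, h x = 0

/-- On norms the two maps act by the inverse powers p/2 and 2/p, and both keep directions. -/
theorem radial_radial (hp : 0 < p) (x : E n) :
    radial (2 / p - 1) (radial ((p - 2) / 2) x) = x := by
  rcases eq_or_ne x 0 with rfl | hx
  · simp [radial_zero]
  · have h0 : 0 < ‖x‖ := norm_pos_iff.2 hx
    rw [radial, norm_radial hx, radial, smul_smul, ← Real.rpow_mul h0.le, ← Real.rpow_add h0]
    have : ((p - 2) / 2 + 1) * (2 / p - 1) + (p - 2) / 2 = 0 := by field_simp; ring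
    rw [this, Real.rpow_zero, one_smul]

theorem radial_ne_zero {a : ℝ} {x : E n} (hx : x ≠ 0) : radial a x ≠ 0 :=
  smul_ne_zero (Real.rpow_pos_of_pos (norm_pos_iff.2 hx) _).ne' hx

theorem continuousAt_radial_zero {a : ℝ} (ha : 0 < a + 1) :
    ContinuousAt (radial (n := n) a) 0 := by
  rw [ContinuousAt, radial_zero, tendsto_zero_iff_norm_tendsto_zero]
  have h1 : Tendsto (fun x : E n => ‖x‖ ^ (a + 1)) (𝓝 0) (𝓝 0) := by
    have : ContinuousAt (fun x : E n => ‖x‖ ^ (a + 1)) 0 :=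
      continuous_norm.continuousAt.rpow_const (Or.inr ha.le)
    simpa [ContinuousAt, ha.ne'] using this
  refine squeeze_zero (fun _ => norm_nonneg _) (fun x => ?_) h1
  rcases eq_or_ne x 0 with rfl | hx
  · simp [radial_zero, ha.ne']
  · exact (norm_radial hx).le

theorem differentiableAt_radial {a : ℝ} {x : E n} (hx : x ≠ 0) :
    DifferentiableAt ℝ (radial a) x :=
  ((contDiffOn_radial a).contDiffAt (isOpen_compl_singleton.mem_nhds hx)).differentiableAt
    one_ne_zero

/-- For a + 1 > 0 the power map is continuous at 0 with value 0 and tends to infinity at infinity.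
So both vanishing conditions survive composition, and a failure of smoothness at the origin is not
seen. -/
theorem IsAnnular.comp_radial {F : E n → ℝ} (hF : IsAnnular F) {a : ℝ} (ha : 0 < a + 1) :
    IsAnnular fun x => F (radial a x) := by
  have hz : ∀ᶠ x in 𝓝 (0 : E n), F (radial a x) = 0 := by
    have h := continuousAt_radial_zero (n := n) ha
    rw [ContinuousAt, radial_zero] at h
    exact h.eventually hF.zero
  refine ⟨contDiff_iff_contDiffAt.2 fun x => ?_, ?_, hz⟩
  · rcases eq_or_ne x 0 with rfl | hx
    · exact (contDiffAt_const (c := (0 : ℝ))).congr_of_eventuallyEq hz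
    · exact hF.contDiff.contDiffAt.comp x
        ((contDiffOn_radial a).contDiffAt (isOpen_compl_singleton.mem_nhds hx))
  · obtain ⟨R, hR⟩ := hF.compact.isCompact.isBounded.exists_norm_le
    refine HasCompactSupport.intro
      (isCompact_closedBall (0 : E n) (max R 0 ^ (a + 1)⁻¹)) fun x hx => ?_
    by_contra hne
    have h1 := hR _ (subset_tsupport _ hne)
    apply hx
    rw [mem_closedBall_zero_iff]
    rcases eq_or_ne x 0 with rfl | hx0
    · simpa using by positivity
    · rw [norm_radial hx0] at h1
      calc ‖x‖ = (‖x‖ ^ (a + 1)) ^ (a + 1)⁻¹ := by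
            rw [← Real.rpow_mul (norm_nonneg x), mul_inv_cancel₀ ha.ne', Real.rpow_one]
        _ ≤ _ := Real.rpow_le_rpow (by positivity) (h1.trans (le_max_left _ _)) (by positivity)

theorem IsAnnular.exists_bound {F : E n → ℝ} (hF : IsAnnular F) (d : ℝ) :
    ∃ C, 0 ≤ C ∧ ∀ x, |F x| ≤ C * ‖x‖ ^ d := by
  have hc : Continuous fun x : E n => F x * ‖x‖ ^ (-d) := by
    rw [continuous_iff_continuousAt]
    intro x
    rcases eq_or_ne x 0 with rfl | hx
    · have : (fun x : E n => F x * ‖x‖ ^ (-d)) =ᶠ[𝓝 0] fun _ => 0 := by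
        filter_upwards [hF.zero] with x hx
        simp [hx]
      exact continuousAt_const.congr this.symm
    · exact hF.contDiff.continuous.continuousAt.mul
        (continuous_norm.continuousAt.rpow_const (Or.inl (norm_ne_zero_iff.2 hx)))
  obtain ⟨C, hC⟩ := (hF.compact.mul_right (f' := fun x => ‖x‖ ^ (-d))).exists_bound_of_continuous hc
  refine ⟨C, (norm_nonneg _).trans (hC 0), fun x => ?_⟩
  rcases eq_or_ne x 0 with rfl | hx
  · rw [hF.zero.self_of_nhds, abs_zero]
    exact mul_nonneg ((norm_nonneg _).trans (hC 0)) (by positivity)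
  · have h0 : 0 < ‖x‖ := norm_pos_iff.2 hx
    have h1 : |F x| * ‖x‖ ^ (-d) ≤ C := by
      simpa [Pi.mul_apply, abs_mul, abs_of_pos (Real.rpow_pos_of_pos h0 _)] using hC x
    rwa [Real.rpow_neg h0.le, ← div_eq_mul_inv, div_le_iff₀ (Real.rpow_pos_of_pos h0 _)] at h1

/-- `A i` is the derivative of the field `G` in the `i`-th direction on the set where `G` does not
vanish, in the sense of the chain rule for annular functions. -/
structure HasSecondDeriv (p : ℝ) (Ω : Set (E n)) (G : E n → E n) (A : Fin n → E n → E n) :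
    Prop where
  zero : ∀ i x, G x = 0 → A i x = 0
  aestronglyMeasurable : ∀ K, IsCompact K → K ⊆ Ω → ∀ i j,
    AEStronglyMeasurable (fun x => A i x j) (volume.restrict K)
  energy : ∀ K, IsCompact K → K ⊆ Ω → ∀ i,
    MemLp (fun x => ‖G x‖ ^ ((p - 2) / 2) * ‖A i x‖) 2 (volume.restrict K)
  chain : ∀ F : E n → ℝ, IsAnnular F → ∀ i,
    LocDiff Ω (EuclideanSpace.single i 1) (fun x => F (G x)) fun x => fderiv ℝ F (G x) (A i x)

/-- G is recovered from V(G) by the inverse power map, which for p > 2 is not differentiable at 0.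
Its derivative applied to that of V(G) defines `A` off the zero set of G, and 0 is used on that set.
Annular functions do not see a neighbourhood of 0, so their composition with the inverse map is
Lipschitz and the chain rule for V(G) applies. -/
theorem IsGlobalSol.exists_hasSecondDeriv (hs : IsGlobalSol p f Ω u G) (hf : IsAdmissible p f)
    (hp : 2 ≤ p) (hΩ : IsOpen Ω) : ∃ A, HasSecondDeriv p Ω G A := by
  classical
  obtain ⟨W, hW⟩ := hs.exists_locDiff_radial hf hp hΩ
  set V : E n → E n := fun x => radial ((p - 2) / 2) (G x) with hV
  have hb : 0 < 2 / p - 1 + 1 := by rw [sub_add_cancel]; positivity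
  have hGm : MeasurableSet {x | G x ≠ 0} :=
    hs.measurable_grad (measurableSet_singleton (0 : E n)).compl
  have hVm : Measurable V := (measurable_radial _).comp hs.measurable_grad
  have hcomp : ∀ x, G x ≠ 0 → ∀ v j, fderiv ℝ (radial (2 / p - 1)) (V x) v j =
      fderiv ℝ (fun y => radial (2 / p - 1) y j) (V x) v := by
    intro x hx v j
    have h1 := (differentiableAt_radial (a := 2 / p - 1)
      (radial_ne_zero (a := (p - 2) / 2) hx)).hasFDerivAt
    have h2 := ((EuclideanSpace.proj j : E n →L[ℝ] ℝ).hasFDerivAt.comp (V x) h1)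
    have h3 : fderiv ℝ (fun y => radial (2 / p - 1) y j) (V x) = _ := h2.fderiv
    rw [h3]
    rfl
  have hmeas : ∀ K, IsCompact K → K ⊆ Ω → ∀ i j, AEStronglyMeasurable
      (fun x => (if G x = 0 then 0 else fderiv ℝ (radial (2 / p - 1)) (V x) (W i x) : E n) j)
      (volume.restrict K) := by
    intro K hK hKΩ i j
    have h1 := aestronglyMeasurable_fderiv_apply (W := W i) (fun y => radial (2 / p - 1) y j)
      (hVm.aestronglyMeasurable (μ := volume.restrict K))
      (fun l => ((hW i l).memLp_deriv K hK hKΩ).1)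
    refine (h1.indicator hGm).congr (Eventually.of_forall fun x => ?_)
    by_cases hx : G x = 0
    · simp [hx]
    · simp only [Set.indicator, Set.mem_ofPred_eq, ne_eq, hx, not_false_eq_true, if_true, if_false]
      exact (hcomp x hx _ _).symm
  refine ⟨fun i x => if G x = 0 then 0 else fderiv ℝ (radial (2 / p - 1)) (V x) (W i x),
    fun i x hx => if_pos hx, hmeas, ?_, ?_⟩
  · intro K hK hKΩ i
    obtain ⟨C, hC, hbd⟩ := (isHomog_radial (n := n) (2 / p - 1)).fderiv.exists_bound
      ((contDiffOn_radial _).continuousOn_fderiv_of_isOpen isOpen_compl_singleton le_rfl)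
    have hWm : MemLp (W i) 2 (volume.restrict K) :=
      memLp_of_components fun j => (hW i j).memLp_deriv K hK hKΩ
    have hAm : AEStronglyMeasurable
        (fun x => (if G x = 0 then 0 else fderiv ℝ (radial (2 / p - 1)) (V x) (W i x) : E n))
        (volume.restrict K) := by
      have : Continuous fun z : Fin n → ℝ => (WithLp.toLp 2 z : E n) := PiLp.continuous_toLp 2 _
      exact this.comp_aestronglyMeasurable
        (aemeasurable_pi_iff.2 fun j => (hmeas K hK hKΩ i j).aemeasurable).aestronglyMeasurable
    refine (hWm.norm.const_mul C).mono
      ((hs.measurable_grad.norm.pow_const _).aestronglyMeasurable.mul hAm.norm)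
      (Eventually.of_forall fun x => ?_)
    rw [Real.norm_of_nonneg (by positivity), Real.norm_of_nonneg (by positivity)]
    by_cases hx : G x = 0
    · simp only [hx, if_true, norm_zero, mul_zero]; positivity
    · simp only [hx, if_false]
      have h0 : 0 < ‖G x‖ := norm_pos_iff.2 hx
      have h1 := hbd (V x) (radial_ne_zero hx)
      -- Since |V| = |G|^{p/2}, the size |V|^{2/p-1} of the derivative of the inverse map is
      -- |G|^{-(p-2)/2}, which cancels the weight in the energy.
      have h2 : ‖V x‖ ^ (2 / p - 1 + 1 - 1) = ‖G x‖ ^ (-((p - 2) / 2)) := by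
        rw [hV, norm_radial hx, ← Real.rpow_mul h0.le]
        congr 1
        field_simp
        ring
      rw [h2] at h1
      calc _ ≤ ‖G x‖ ^ ((p - 2) / 2) * (C * ‖G x‖ ^ (-((p - 2) / 2)) * ‖W i x‖) := by
            gcongr
            exact ((fderiv ℝ (radial (2 / p - 1)) (V x)).le_opNorm _).trans
              (mul_le_mul_of_nonneg_right h1 (norm_nonneg _))
        _ = (‖G x‖ ^ ((p - 2) / 2) * ‖G x‖ ^ (-((p - 2) / 2))) * (C * ‖W i x‖) := by ring
        _ = _ := by rw [← Real.rpow_add h0, add_neg_cancel, Real.rpow_zero, one_mul]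
  · intro F hF i
    have hFr := hF.comp_radial hb
    obtain ⟨L, hL⟩ := hFr.contDiff.lipschitzWith_of_hasCompactSupport hFr.compact one_ne_zero
    have h1 := LocDiff.comp (V := V) (W := W i) (hW i) hL (hFr.contDiff.differentiable one_ne_zero)
    have e1 : (fun x => F (radial (2 / p - 1) (V x))) = fun x => F (G x) := by
      funext x
      rw [hV, radial_radial (by linarith)]
    rw [e1] at h1
    refine h1.congr_deriv (Eventually.of_forall fun x => ?_)
    by_cases hx : G x = 0
    · simp only [hx, if_true, map_zero]
      have h2 : (fun y => F (radial (2 / p - 1) y)) =ᶠ[𝓝 (V x)] fun _ => 0 := by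
        rw [hV]; simp only [hx, radial_zero]; exact hFr.zero
      rw [h2.fderiv_eq]
      simp
    · simp only [hx, if_false]
      have h2 := (differentiableAt_radial (a := 2 / p - 1)
        (radial_ne_zero (a := (p - 2) / 2) hx)).hasFDerivAt
      have h3 := (hF.contDiff.differentiable one_ne_zero
        (radial (2 / p - 1) (V x))).hasFDerivAt.comp (V x) h2
      have h4 : fderiv ℝ (fun y => F (radial (2 / p - 1) y)) (V x) = _ := h3.fderiv
      rw [h4]
      have h5 : radial (2 / p - 1) (V x) = G x := radial_radial (by linarith) _
      rw [h5]
      rfl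

theorem IsAdmissible.nonneg (hf : IsAdmissible p f) (η : E n) : 0 ≤ f η := by
  rcases eq_or_ne η 0 with rfl | h
  · exact hf.map_zero.ge
  · exact (hf.pos η h).le

theorem IsAdmissible.continuous (hf : IsAdmissible p f) (hp : 0 < p) : Continuous f := by
  rw [continuous_iff_continuousAt]
  intro x
  rcases eq_or_ne x 0 with rfl | hx
  · obtain ⟨c, C, -, -, h⟩ := hf.exists_bounds
    rw [ContinuousAt, hf.map_zero]
    have h1 : Tendsto (fun x : E n => C * ‖x‖ ^ p) (𝓝 0) (𝓝 0) := by
      have : ContinuousAt (fun x : E n => C * ‖x‖ ^ p) 0 :=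
        continuousAt_const.mul (continuous_norm.continuousAt.rpow_const (Or.inr hp.le))
      simpa [ContinuousAt, hp.ne'] using this
    refine squeeze_zero hf.nonneg (fun x => ?_) h1
    rcases eq_or_ne x 0 with rfl | hx
    · simp [hf.map_zero, hp.ne']
    · exact (h x hx).2
  · exact (hf.differentiableAt hx).continuousAt

/-- Because `f` is continuous with f(0) = 0 and f(η) ≥ c |η|^p, the factor H(f(η)) vanishes both for
small and for large η. Hence `M` may be singular at the origin. -/
theorem IsAdmissible.isAnnular_mul (hf : IsAdmissible p f) (hp : 0 < p) {M : E n → ℝ}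
    (hM : ContDiffOn ℝ 1 M {0}ᶜ) {H : ℝ → ℝ} (hH : IsAnnular H) :
    IsAnnular fun η => M η * H (f η) := by
  have hz : ∀ᶠ η in 𝓝 (0 : E n), M η * H (f η) = 0 := by
    have h := (hf.continuous hp).continuousAt (x := 0)
    rw [ContinuousAt, hf.map_zero] at h
    filter_upwards [h.eventually hH.zero] with η hη
    rw [hη, mul_zero]
  refine ⟨contDiff_iff_contDiffAt.2 fun x => ?_, ?_, hz⟩
  · rcases eq_or_ne x 0 with rfl | hx
    · exact (contDiffAt_const (c := (0 : ℝ))).congr_of_eventuallyEq hz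
    · have hnhds := isOpen_compl_singleton.mem_nhds hx
      exact (hM.contDiffAt hnhds).mul (hH.contDiff.contDiffAt.comp x
        ((hf.contDiffOn.of_le one_le_two).contDiffAt hnhds))
  · obtain ⟨c, C, hc, -, h⟩ := hf.exists_bounds
    obtain ⟨R, hR⟩ := hH.compact.isCompact.isBounded.exists_norm_le
    refine HasCompactSupport.intro (isCompact_closedBall (0 : E n) ((max R 0 / c) ^ p⁻¹))
      fun x hx => ?_
    by_contra hne
    apply hx
    rw [mem_closedBall_zero_iff]
    rcases eq_or_ne x 0 with rfl | hx0
    · simpa using by positivity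
    · have h1 := hR _ (subset_tsupport _ (right_ne_zero_of_mul hne))
      have h2 : ‖x‖ ^ p ≤ max R 0 / c := by
        rw [le_div_iff₀ hc, mul_comm]
        exact (h x hx0).1.trans ((le_abs_self _).trans (h1.trans (le_max_left _ _)))
      calc ‖x‖ = (‖x‖ ^ p) ^ p⁻¹ := by
            rw [← Real.rpow_mul (norm_nonneg x), mul_inv_cancel₀ hp.ne', Real.rpow_one]
        _ ≤ _ := Real.rpow_le_rpow (by positivity) h2 (by positivity)

theorem HasSecondDeriv.locDiff_mul {A : Fin n → E n → E n} (hA : HasSecondDeriv p Ω G A)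
    (hf : IsAdmissible p f) (hp : 0 < p) {M : E n → ℝ} (hM : ContDiffOn ℝ 1 M {0}ᶜ) {H : ℝ → ℝ}
    (hH : IsAnnular H) (i : Fin n) :
    LocDiff Ω (EuclideanSpace.single i 1) (fun x => M (G x) * H (f (G x))) fun x =>
      fderiv ℝ M (G x) (A i x) * H (f (G x)) +
        M (G x) * (deriv H (f (G x)) * fderiv ℝ f (G x) (A i x)) := by
  refine (hA.chain _ (hf.isAnnular_mul hp hM hH) i).congr_deriv (Eventually.of_forall fun x => ?_)
  by_cases hx : G x = 0
  · simp [hA.zero i x hx]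
  · have h1 := ((hM.contDiffAt (isOpen_compl_singleton.mem_nhds hx)).differentiableAt
      one_ne_zero).hasFDerivAt
    have h2 := (hH.contDiff.differentiable one_ne_zero (f (G x))).hasDerivAt.comp_hasFDerivAt (G x)
      (hf.differentiableAt hx).hasFDerivAt
    have h3 : fderiv ℝ (fun η => M η * H (f η)) (G x) = _ := (h1.mul h2).fderiv
    simp only [h3]
    simp only [Function.comp_apply, add_apply, smul_apply, smul_eq_mul]
    ring

end

/-! ### Cutoff functions of s = f(∇u) and bounds uniform in the parameter. -/

section

open Filter Topology ENNReal

open Real (smoothTransition)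

theorem deriv_smoothTransition_nonneg (x : ℝ) : 0 ≤ deriv smoothTransition x :=
  Real.smoothTransition.monotone.deriv_nonneg

theorem deriv_smoothTransition_of_nonpos {x : ℝ} (hx : x ≤ 0) : deriv smoothTransition x = 0 :=
  IsLocalMin.deriv_eq_zero (Eventually.of_forall fun y => by
    rw [Real.smoothTransition.zero_of_nonpos hx]; exact Real.smoothTransition.nonneg y)

theorem deriv_smoothTransition_of_one_le {x : ℝ} (hx : 1 ≤ x) : deriv smoothTransition x = 0 :=
  IsLocalMax.deriv_eq_zero (Eventually.of_forall fun y => by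
    rw [Real.smoothTransition.one_of_one_le hx]; exact Real.smoothTransition.le_one y)

theorem exists_deriv_smoothTransition_le :
    ∃ R : ℝ, 0 ≤ R ∧ ∀ x, deriv smoothTransition x ≤ R := by
  have hc : Continuous (deriv smoothTransition) :=
    (Real.smoothTransition.contDiff (n := 1)).continuous_deriv le_rfl
  obtain ⟨R, hR⟩ := isCompact_Icc.exists_bound_of_continuousOn (s := Set.Icc (0 : ℝ) 1)
    hc.continuousOn
  refine ⟨max R 0, le_max_right _ _, fun x => ?_⟩
  rcases le_total x 0 with h | h
  · rw [deriv_smoothTransition_of_nonpos h]; exact le_max_right _ _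
  rcases le_total 1 x with h' | h'
  · rw [deriv_smoothTransition_of_one_le h']; exact le_max_right _ _
  · exact (le_abs_self _).trans ((hR x ⟨h, h'⟩).trans (le_max_left _ _))

/-- A smooth approximation, as `m → ∞`, of the indicator function of `(a, ∞)`. -/
def cut (a m s : ℝ) : ℝ :=
  smoothTransition (m * (s - a) - 1) * (1 - smoothTransition (m⁻¹ * s - 1))

/-- A bound for the negative part of the derivative of `cut a m`. -/
def tail (a m s : ℝ) : ℝ :=
  smoothTransition (m * (s - a) - 1) * (deriv smoothTransition (m⁻¹ * s - 1) * m⁻¹)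

theorem cut_nonneg (a m s : ℝ) : 0 ≤ cut a m s :=
  mul_nonneg (Real.smoothTransition.nonneg _) (sub_nonneg.2 (Real.smoothTransition.le_one _))

theorem cut_le_one (a m s : ℝ) : cut a m s ≤ 1 :=
  mul_le_one₀ (Real.smoothTransition.le_one _) (sub_nonneg.2 (Real.smoothTransition.le_one _))
    (sub_le_self _ (Real.smoothTransition.nonneg _))

theorem cut_of_le {a m s : ℝ} (hm : 0 < m) (h : s ≤ a + m⁻¹) : cut a m s = 0 := by
  rw [cut, Real.smoothTransition.zero_of_nonpos, zero_mul]
  have := mul_le_mul_of_nonneg_left (sub_le_iff_le_add'.2 h) hm.le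
  rw [mul_inv_cancel₀ hm.ne'] at this
  linarith

theorem cut_of_ge {a m s : ℝ} (hm : 0 < m) (h : 2 * m ≤ s) : cut a m s = 0 := by
  rw [cut, Real.smoothTransition.one_of_one_le (x := m⁻¹ * s - 1), sub_self, mul_zero]
  have := mul_le_mul_of_nonneg_left h (inv_pos.2 hm).le
  have h2 : m⁻¹ * (2 * m) = 2 := by field_simp
  linarith

theorem cut_eventuallyEq_one {a m s : ℝ} (hm : 0 < m) (h1 : 2 * m⁻¹ < s - a) (h2 : s < m) :
    cut a m =ᶠ[𝓝 s] fun _ => 1 := by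
  filter_upwards [eventually_gt_nhds (show a + 2 * m⁻¹ < s by linarith), eventually_lt_nhds h2]
    with x hx1 hx2
  rw [cut, Real.smoothTransition.one_of_one_le, Real.smoothTransition.zero_of_nonpos, sub_zero,
    one_mul]
  · have := mul_lt_mul_of_pos_left hx2 (inv_pos.2 hm)
    rw [inv_mul_cancel₀ hm.ne'] at this
    linarith
  · have := mul_lt_mul_of_pos_left (show 2 * m⁻¹ < x - a by linarith) hm
    rw [mul_left_comm, mul_inv_cancel₀ hm.ne'] at this
    linarith

theorem eventually_cut {a s : ℝ} (h : a < s) :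
    ∀ᶠ m : ℝ in atTop, 0 < m ∧ cut a m =ᶠ[𝓝 s] fun _ => 1 := by
  have h1 : Tendsto (fun m : ℝ => 2 * m⁻¹) atTop (𝓝 0) := by
    simpa using tendsto_inv_atTop_zero.const_mul (2 : ℝ)
  filter_upwards [eventually_gt_atTop 0, h1.eventually_lt_const (sub_pos.2 h),
    eventually_gt_atTop s] with m h0 h2 h3
  exact ⟨h0, cut_eventuallyEq_one h0 h2 h3⟩

theorem contDiff_cut (a m : ℝ) : ContDiff ℝ 1 (cut a m) := by
  refine ContDiff.mul ?_ ?_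
  · exact (Real.smoothTransition.contDiff (n := 1)).comp
      ((contDiff_const.mul (contDiff_id.sub contDiff_const)).sub contDiff_const)
  · exact contDiff_const.sub ((Real.smoothTransition.contDiff (n := 1)).comp
      ((contDiff_const.mul contDiff_id).sub contDiff_const))

theorem isAnnular_of_cut {a m : ℝ} (ha : 0 ≤ a) (hm : 0 < m) {h : ℝ → ℝ}
    (hh : ContDiffOn ℝ 1 h {0}ᶜ) : IsAnnular fun s => h s * cut a m s := by
  have hpos : 0 < a + m⁻¹ := by positivity
  have hz : ∀ᶠ s in 𝓝 (0 : ℝ), h s * cut a m s = 0 := by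
    filter_upwards [eventually_lt_nhds hpos] with s hs
    rw [cut_of_le hm hs.le, mul_zero]
  refine ⟨contDiff_iff_contDiffAt.2 fun s => ?_, ?_, hz⟩
  · rcases eq_or_ne s 0 with rfl | hs
    · exact (contDiffAt_const (c := (0 : ℝ))).congr_of_eventuallyEq hz
    · exact (hh.contDiffAt (isOpen_compl_singleton.mem_nhds hs)).mul (contDiff_cut a m).contDiffAt
  · refine HasCompactSupport.intro (isCompact_Icc (a := (0 : ℝ)) (b := 2 * m)) fun s hs => ?_
    rw [Set.mem_Icc, not_and_or, not_le, not_le] at hs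
    rcases hs with hs | hs
    · rw [cut_of_le hm (hs.le.trans hpos.le), mul_zero]
    · rw [cut_of_ge hm hs.le, mul_zero]

theorem isAnnular_cut {a m : ℝ} (ha : 0 ≤ a) (hm : 0 < m) : IsAnnular (cut a m) := by
  simpa using isAnnular_of_cut ha hm (h := fun _ => (1 : ℝ)) contDiffOn_const

/-- The derivative splits into a non-negative part from the rise near s = a and the part `tail` from
the descent at s of order m. -/
theorem deriv_cut (a m s : ℝ) : deriv (cut a m) s =
    deriv smoothTransition (m * (s - a) - 1) * m * (1 - smoothTransition (m⁻¹ * s - 1)) -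
      tail a m s := by
  have hd : ∀ x, HasDerivAt smoothTransition (deriv smoothTransition x) x := fun x =>
    ((Real.smoothTransition.contDiff (n := 1)).differentiable one_ne_zero x).hasDerivAt
  have h1 : HasDerivAt (fun s : ℝ => m * (s - a) - 1) m s := by
    simpa using (((hasDerivAt_id s).sub_const a).const_mul m).sub_const 1
  have h2 : HasDerivAt (fun s : ℝ => m⁻¹ * s - 1) m⁻¹ s := by
    simpa using ((hasDerivAt_id s).const_mul m⁻¹).sub_const 1
  have h3 := ((hd _).comp s h1).mul (((hd _).comp s h2).const_sub 1)
  have h4 : deriv (cut a m) s = _ := h3.deriv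
  rw [h4, tail]
  simp only [Function.comp_apply]
  ring

theorem tail_nonneg {a m : ℝ} (hm : 0 < m) (s : ℝ) : 0 ≤ tail a m s :=
  mul_nonneg (Real.smoothTransition.nonneg _)
    (mul_nonneg (deriv_smoothTransition_nonneg _) (inv_pos.2 hm).le)

theorem neg_tail_le_deriv_cut {a m : ℝ} (hm : 0 < m) (s : ℝ) :
    -tail a m s ≤ deriv (cut a m) s := by
  rw [deriv_cut]
  have := mul_nonneg (mul_nonneg (deriv_smoothTransition_nonneg (m * (s - a) - 1)) hm.le)
    (sub_nonneg.2 (Real.smoothTransition.le_one (m⁻¹ * s - 1)))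
  linarith

theorem tail_of_le {a m s : ℝ} (hm : 0 < m) (h : s ≤ a) : tail a m s = 0 := by
  rw [tail, Real.smoothTransition.zero_of_nonpos, zero_mul]
  nlinarith

theorem eventually_tail (a s : ℝ) : ∀ᶠ m : ℝ in atTop, tail a m s = 0 := by
  filter_upwards [eventually_gt_atTop 0, eventually_gt_atTop s] with m h0 h1
  rw [tail, deriv_smoothTransition_of_nonpos, zero_mul, mul_zero]
  have := mul_lt_mul_of_pos_left h1 (inv_pos.2 h0)
  rw [inv_mul_cancel₀ h0.ne'] at this
  linarith

theorem measurable_tail (a m : ℝ) : Measurable (tail a m) := by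
  unfold tail
  exact (Real.smoothTransition.continuous.measurable.comp (by fun_prop)).mul
    (((measurable_deriv _).comp (by fun_prop)).mul_const _)

theorem mul_deriv_smoothTransition_le {R : ℝ} (hR0 : 0 ≤ R)
    (hR : ∀ x, deriv smoothTransition x ≤ R) (y : ℝ) :
    y * deriv smoothTransition (y - 1) ≤ 2 * R := by
  rcases le_total 1 (y - 1) with h | h
  · rw [deriv_smoothTransition_of_one_le h, mul_zero]; positivity
  · exact mul_le_mul (by linarith) (hR _) (deriv_smoothTransition_nonneg _) (by norm_num)

/-- Scale invariance: both transitions have the form y ↦ T(y - 1) with y = m(s - a) or y = s/m, and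
T'(y - 1) vanishes for y ≥ 2, so y T'(y - 1) is bounded independently of m. This yields the
dominating functions for m → ∞. -/
theorem exists_cut_bounds : ∃ R : ℝ, 0 ≤ R ∧ ∀ a m s, 0 ≤ a → 0 < m → 0 ≤ s →
    s * tail a m s ≤ R ∧ (a ≤ s → (s - a) * |deriv (cut a m) s| ≤ R) := by
  obtain ⟨R, hR0, hR⟩ := exists_deriv_smoothTransition_le
  refine ⟨4 * R, by positivity, fun a m s ha hm hs => ?_⟩
  have h1 : s * tail a m s ≤ 2 * R := by
    have h := mul_deriv_smoothTransition_le hR0 hR (m⁻¹ * s)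
    calc s * tail a m s = smoothTransition (m * (s - a) - 1) *
          (m⁻¹ * s * deriv smoothTransition (m⁻¹ * s - 1)) := by rw [tail]; ring
      _ ≤ 1 * (m⁻¹ * s * deriv smoothTransition (m⁻¹ * s - 1)) :=
          mul_le_mul_of_nonneg_right (Real.smoothTransition.le_one _)
            (mul_nonneg (by positivity) (deriv_smoothTransition_nonneg _))
      _ ≤ _ := by linarith
  refine ⟨by linarith, fun has => ?_⟩
  have hsa : 0 ≤ s - a := sub_nonneg.2 has
  have h2 := mul_deriv_smoothTransition_le hR0 hR (m * (s - a))
  have h0 := mul_nonneg (mul_nonneg (deriv_smoothTransition_nonneg (m * (s - a) - 1)) hm.le)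
    (sub_nonneg.2 (Real.smoothTransition.le_one (m⁻¹ * s - 1)))
  have h3 : (s - a) * (deriv smoothTransition (m * (s - a) - 1) * m *
      (1 - smoothTransition (m⁻¹ * s - 1))) ≤ 2 * R := by
    calc _ = (m * (s - a) * deriv smoothTransition (m * (s - a) - 1)) *
          (1 - smoothTransition (m⁻¹ * s - 1)) := by ring
      _ ≤ (m * (s - a) * deriv smoothTransition (m * (s - a) - 1)) * 1 :=
          mul_le_mul_of_nonneg_left (sub_le_self _ (Real.smoothTransition.nonneg _))
            (mul_nonneg (by positivity) (deriv_smoothTransition_nonneg _))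
      _ ≤ _ := by linarith
  have h4 : (s - a) * tail a m s ≤ 2 * R :=
    (mul_le_mul_of_nonneg_right (by linarith) (tail_nonneg hm s)).trans h1
  have h5 : |deriv (cut a m) s| ≤ deriv smoothTransition (m * (s - a) - 1) * m *
      (1 - smoothTransition (m⁻¹ * s - 1)) + tail a m s := by
    rw [deriv_cut]
    refine (abs_sub _ _).trans ?_
    rw [abs_of_nonneg h0, abs_of_nonneg (tail_nonneg hm s)]
  calc _ ≤ (s - a) * (deriv smoothTransition (m * (s - a) - 1) * m *
      (1 - smoothTransition (m⁻¹ * s - 1)) + tail a m s) := mul_le_mul_of_nonneg_left h5 hsa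
    _ ≤ _ := by rw [mul_add]; linarith

theorem deriv_log_mul_cut {a m s : ℝ} (ha : 0 < a) (hs : 0 < s) :
    deriv (fun s => Real.log (s / a) * cut a m s) s =
      s⁻¹ * cut a m s + Real.log (s / a) * deriv (cut a m) s := by
  have h1 : HasDerivAt (fun s => Real.log (s / a)) s⁻¹ s := by
    have := ((hasDerivAt_id s).div_const a).log (div_pos hs ha).ne'
    have e : s⁻¹ = 1 / a / (s / a) := by field_simp
    rw [e]
    exact this
  exact (h1.mul ((contDiff_cut a m).differentiable one_ne_zero s).hasDerivAt).deriv

theorem isAnnular_log_mul_cut {a m : ℝ} (ha : 0 < a) (hm : 0 < m) :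
    IsAnnular fun s => Real.log (s / a) * cut a m s := by
  refine isAnnular_of_cut ha.le hm fun s hs => ?_
  exact ((contDiffAt_id.div_const a).log (div_ne_zero hs ha.ne')).contDiffWithinAt

theorem log_div_le {a s : ℝ} (ha : 0 < a) (hs : a ≤ s) :
    0 ≤ Real.log (s / a) ∧ Real.log (s / a) ≤ 2 * (√(s / a) - 1) := by
  have h1 : 1 ≤ s / a := (one_le_div ha).2 hs
  refine ⟨Real.log_nonneg h1, ?_⟩
  have h2 := Real.log_le_sub_one_of_pos (Real.sqrt_pos.2 (by linarith : 0 < s / a))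
  rw [Real.log_sqrt (by linarith)] at h2
  linarith

/-- Put r = √(s/a). For s > a one has log(s/a) ≤ 2(r - 1) and a r (r - 1) ≤ s - a, so the bound for
(s - a) times the derivative of `cut` controls the steep term. The decay in r is what later gives
domination by |∇u|^{(p-2)/2} |D²u|. -/
theorem exists_deriv_log_mul_cut_bound : ∃ R : ℝ, 0 ≤ R ∧ ∀ a m s, 0 < a → 0 < m → 0 < s →
    |deriv (fun s => Real.log (s / a) * cut a m s) s| ≤ R * (a * √(s / a))⁻¹ := by
  obtain ⟨R, hR0, hR⟩ := exists_cut_bounds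
  refine ⟨1 + 2 * R, by positivity, fun a m s ha hm hs => ?_⟩
  rw [deriv_log_mul_cut ha hs]
  rcases le_or_gt s a with h | h
  · have h1 : cut a m =ᶠ[𝓝 s] fun _ => 0 := by
      filter_upwards [eventually_lt_nhds (show s < a + m⁻¹ by linarith [inv_pos.2 hm])] with x hx
      exact cut_of_le hm hx.le
    rw [h1.deriv_eq, h1.self_of_nhds]
    simp only [mul_zero, deriv_const, add_zero, abs_zero]
    positivity
  · obtain ⟨hl0, hl⟩ := log_div_le ha h.le
    set r := √(s / a) with hr
    have hr1 : 1 < r := by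
      rw [hr, Real.lt_sqrt (by norm_num), one_pow]; exact (one_lt_div ha).2 h
    have hsr : s = a * r ^ 2 := by
      rw [hr, Real.sq_sqrt (by positivity)]; field_simp
    have h2 := (hR a m s ha.le hm hs.le).2 h.le
    have h3 : s⁻¹ * cut a m s ≤ (a * r)⁻¹ := by
      calc _ ≤ s⁻¹ * 1 := mul_le_mul_of_nonneg_left (cut_le_one _ _ _) (by positivity)
        _ = (a * r ^ 2)⁻¹ := by rw [hsr, mul_one]
        _ ≤ _ := by
          gcongr
          nlinarith
    have h4 : Real.log (s / a) * |deriv (cut a m) s| ≤ 2 * R * (a * r)⁻¹ := by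
      have h5 : (a * r) * (Real.log (s / a) * |deriv (cut a m) s|) ≤ 2 * R := by
        calc _ ≤ (a * r) * (2 * (r - 1) * |deriv (cut a m) s|) := by gcongr
          _ ≤ 2 * ((s - a) * |deriv (cut a m) s|) := by
            rw [hsr]
            have : 0 ≤ |deriv (cut a m) (a * r ^ 2)| := abs_nonneg _
            have h6 : a * r * (r - 1) ≤ a * r ^ 2 - a := by nlinarith
            nlinarith
          _ ≤ 2 * R := by linarith
      rw [← div_eq_mul_inv, le_div_iff₀ (by positivity)]
      linarith
    calc _ ≤ |s⁻¹ * cut a m s| + |Real.log (s / a) * deriv (cut a m) s| := abs_add_le _ _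
      _ = s⁻¹ * cut a m s + Real.log (s / a) * |deriv (cut a m) s| := by
        rw [abs_of_nonneg (mul_nonneg (by positivity) (cut_nonneg _ _ _)), abs_mul,
          abs_of_nonneg hl0]
      _ ≤ _ := by rw [add_mul, one_mul]; exact add_le_add h3 h4

end

/-! ### Local integrability, dominated limits and symmetry of the second derivatives. -/

section

open Filter Topology ENNReal

variable {n : ℕ} {p : ℝ} {f : E n → ℝ} {Ω : Set (E n)} {u : E n → ℝ} {G : E n → E n}
  {A : Fin n → E n → E n}

theorem integrable_of_support_subset {S : Set (E n)} {h : E n → ℝ}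
    (hh : IntegrableOn h S) (h0 : ∀ x, x ∉ S → h x = 0) : Integrable h :=
  (integrableOn_iff_integrable_of_support_subset fun x hx =>
    by_contra fun hxS => hx (h0 x hxS)).1 hh

theorem integrable_of_memLp_two {S : Set (E n)} (hS : IsCompact S) {h : E n → ℝ}
    (hh : MemLp h 2 (volume.restrict S)) (h0 : ∀ x, x ∉ S → h x = 0) : Integrable h := by
  have := isFiniteMeasure_restrict_of_isCompact hS
  exact integrable_of_support_subset (hh.integrable (by norm_num)) h0

theorem integrable_mul_of_memLp_two {S : Set (E n)} {h g : E n → ℝ}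
    (hh : MemLp h 2 (volume.restrict S)) (hg : MemLp g 2 (volume.restrict S))
    (h0 : ∀ x, x ∉ S → h x = 0) : Integrable fun x => h x * g x :=
  integrable_of_support_subset (hh.integrable_mul hg) fun x hx => by rw [h0 x hx, zero_mul]

theorem IsTest.integrable_mul {φ h : E n → ℝ} (hφ : IsTest Ω φ)
    (hh : IntegrableOn h (tsupport φ)) : Integrable fun x => h x * φ x := by
  obtain ⟨M, -, hM⟩ := hφ.isBumpFun.exists_abs_le
  exact integrable_of_support_subset (hh.mul_bdd (c := M)
    hφ.isBumpFun.continuous.aestronglyMeasurable (Eventually.of_forall hM)) fun x hx => by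
      rw [image_eq_zero_of_notMem_tsupport hx, mul_zero]

theorem IsTest.integrable_mul_fderiv {φ h : E n → ℝ} (hφ : IsTest Ω φ) (e : E n)
    (hh : IntegrableOn h (tsupport φ)) : Integrable fun x => h x * fderiv ℝ φ x e := by
  have hb := hφ.isBumpFun
  obtain ⟨M, hM⟩ := (hb.hasCompactSupport_fderiv e).exists_bound_of_continuous
    (hb.continuous_fderiv e)
  exact integrable_of_support_subset (hh.mul_bdd (c := M)
    (hb.continuous_fderiv e).aestronglyMeasurable (Eventually.of_forall hM)) fun x hx => by
      rw [fderiv_apply_eq_zero_of_notMem_tsupport e hx, mul_zero]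

/-- Weak derivatives pass to dominated pointwise limits. -/
theorem isWeakDerivOn_of_tendsto (hΩ : IsOpen Ω) {e : E n} {h g bh bg : E n → ℝ}
    {H D : ℝ → E n → ℝ} (hd : ∀ᶠ m in atTop, LocDiff Ω e (H m) (D m))
    (hbh : ∀ᶠ m in atTop, ∀ x, |H m x| ≤ bh x) (hbg : ∀ᶠ m in atTop, ∀ x, |D m x| ≤ bg x)
    (ih : ∀ K, IsCompact K → K ⊆ Ω → IntegrableOn bh K)
    (ig : ∀ K, IsCompact K → K ⊆ Ω → IntegrableOn bg K)
    (th : ∀ x, Tendsto (fun m => H m x) atTop (𝓝 (h x)))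
    (tg : ∀ x, Tendsto (fun m => D m x) atTop (𝓝 (g x))) : IsWeakDerivOn Ω e h g := by
  intro φ hφ
  have hb := hφ.isBumpFun
  have hcov : ∀ {F ψ : E n → ℝ}, (∀ x, x ∉ tsupport φ → ψ x = 0) →
      ∫ x, F x * ψ x = ∫ x in tsupport φ, F x * ψ x := fun {F ψ} h0 =>
    (setIntegral_eq_integral_of_forall_compl_eq_zero fun x hx => by rw [h0 x hx, mul_zero]).symm
  have hφ0 : ∀ x, x ∉ tsupport φ → φ x = 0 := fun x hx => image_eq_zero_of_notMem_tsupport hx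
  have hφ1 : ∀ x, x ∉ tsupport φ → fderiv ℝ φ x e = 0 := fun x hx =>
    fderiv_apply_eq_zero_of_notMem_tsupport e hx
  obtain ⟨M, hM0, hM⟩ := hb.exists_abs_le
  obtain ⟨M', hM'⟩ := (hb.hasCompactSupport_fderiv e).exists_bound_of_continuous
    (hb.continuous_fderiv e)
  have t1 : Tendsto (fun m => ∫ x, H m x * fderiv ℝ φ x e) atTop
      (𝓝 (∫ x, h x * fderiv ℝ φ x e)) := by
    simp only [hcov hφ1]
    refine tendsto_integral_filter_of_dominated_convergence (fun x => bh x * M') ?_ ?_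
      ((ih _ hφ.compact hφ.supp).mul_const _) (Eventually.of_forall fun x => (th x).mul_const _)
    · filter_upwards [hd] with m hm
      exact (hm.memLp _ hφ.compact).1.mul (hb.continuous_fderiv e).aestronglyMeasurable
    · filter_upwards [hbh] with m hm
      refine Eventually.of_forall fun x => ?_
      rw [norm_mul]
      exact mul_le_mul (hm x) (hM' x) (norm_nonneg _) ((abs_nonneg _).trans (hm x))
  have t2 : Tendsto (fun m => -∫ x, D m x * φ x) atTop (𝓝 (-∫ x, g x * φ x)) := by
    simp only [hcov hφ0]
    refine Tendsto.neg (tendsto_integral_filter_of_dominated_convergence (fun x => bg x * M) ?_ ?_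
      ((ig _ hφ.compact hφ.supp).mul_const _) (Eventually.of_forall fun x => (tg x).mul_const _))
    · filter_upwards [hd] with m hm
      exact (hm.memLp_deriv _ hφ.compact hφ.supp).1.mul hb.continuous.aestronglyMeasurable
    · filter_upwards [hbg] with m hm
      refine Eventually.of_forall fun x => ?_
      rw [norm_mul]
      exact mul_le_mul (hm x) (hM x) (norm_nonneg _) ((abs_nonneg _).trans (hm x))
  refine tendsto_nhds_unique (t1.congr' ?_) t2
  filter_upwards [hd] with m hm using hm.integral_mul_fderiv hΩ hφ

/-- The size of the second derivatives. -/
def size (A : Fin n → E n → E n) (x : E n) : ℝ := ∑ i, ‖A i x‖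

theorem size_nonneg (A : Fin n → E n → E n) (x : E n) : 0 ≤ size A x :=
  Finset.sum_nonneg fun _ _ => norm_nonneg _

theorem norm_le_size (A : Fin n → E n → E n) (i : Fin n) (x : E n) : ‖A i x‖ ≤ size A x :=
  Finset.single_le_sum (f := fun i => ‖A i x‖) (fun _ _ => norm_nonneg _) (Finset.mem_univ i)

theorem HasSecondDeriv.memLp_size (hA : HasSecondDeriv p Ω G A) {K : Set (E n)}
    (hK : IsCompact K) (hKΩ : K ⊆ Ω) :
    MemLp (fun x => ‖G x‖ ^ ((p - 2) / 2) * size A x) 2 (volume.restrict K) := by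
  simp only [size, Finset.mul_sum]
  exact memLp_finsetSum _ fun i _ => hA.energy K hK hKΩ i

theorem IsGlobalSol.memLp_rpow_half (hs : IsGlobalSol p f Ω u G) (hp : 0 < p) :
    MemLp (fun x => ‖G x‖ ^ (p / 2)) 2 := by
  have h := hs.memLp_grad.norm_rpow_div (ENNReal.ofReal (p / 2))
  have e : ENNReal.ofReal p / ENNReal.ofReal (p / 2) = 2 := by
    rw [← ENNReal.ofReal_div_of_pos (by positivity), show p / (p / 2) = 2 by field_simp]
    exact ENNReal.ofReal_ofNat 2
  rw [e, ENNReal.toReal_ofReal (by positivity)] at h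
  exact h

theorem rpow_le_one_add_rpow {r s t : ℝ} (hr : 0 ≤ r) (hs : 0 ≤ s) (hst : s ≤ t) :
    r ^ s ≤ 1 + r ^ t := by
  rcases le_total r 1 with h | h
  · exact (Real.rpow_le_one hr h hs).trans (le_add_of_nonneg_right (Real.rpow_nonneg hr _))
  · exact (Real.rpow_le_rpow_of_exponent_le h hst).trans (le_add_of_nonneg_left zero_le_one)

theorem IsGlobalSol.memLp_rpow (hs : IsGlobalSol p f Ω u G) (hp : 0 < p) {s : ℝ} (hs0 : 0 ≤ s)
    (hsp : s ≤ p / 2) {K : Set (E n)} (hK : IsCompact K) :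
    MemLp (fun x => ‖G x‖ ^ s) 2 (volume.restrict K) := by
  have h2 : MemLp (fun x => 1 + ‖G x‖ ^ (p / 2)) 2 (volume.restrict K) := by
    have := isFiniteMeasure_restrict_of_isCompact hK
    exact (memLp_const (1 : ℝ)).add ((hs.memLp_rpow_half hp).restrict K)
  refine h2.mono' (hs.measurable_grad.norm.pow_const s).aestronglyMeasurable
    (Eventually.of_forall fun x => ?_)
  rw [Real.norm_of_nonneg (by positivity)]
  exact rpow_le_one_add_rpow (norm_nonneg _) hs0 hsp

theorem rpow_half_mul_self {r s : ℝ} (hr : 0 ≤ r) (hs : 0 ≤ s) :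
    r ^ (s / 2) * r ^ (s / 2) = r ^ s := by
  rw [← Real.rpow_add_of_nonneg hr (by positivity) (by positivity), add_halves]

/-- Half of the weight goes with the second derivatives, square integrable by the energy bound; the
other half is locally square integrable since p - 2 ≤ p. -/
theorem IsGlobalSol.integrableOn_size (hs : IsGlobalSol p f Ω u G) (hp : 2 ≤ p)
    (hA : HasSecondDeriv p Ω G A) {K : Set (E n)} (hK : IsCompact K) (hKΩ : K ⊆ Ω) :
    IntegrableOn (fun x => ‖G x‖ ^ (p - 2) * size A x) K := by
  have h1 := (hs.memLp_rpow (by linarith) (s := (p - 2) / 2) (by linarith) (by linarith)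
    hK).integrable_mul (hA.memLp_size hK hKΩ)
  refine h1.congr (Eventually.of_forall fun x => ?_)
  simp only [Pi.mul_apply]
  rw [← mul_assoc, rpow_half_mul_self (norm_nonneg _) (by linarith)]

theorem HasSecondDeriv.integrableOn_size_sq (hp : 2 ≤ p)
    (hA : HasSecondDeriv p Ω G A) {K : Set (E n)} (hK : IsCompact K) (hKΩ : K ⊆ Ω) :
    IntegrableOn (fun x => ‖G x‖ ^ (p - 2) * size A x ^ 2) K := by
  have h1 := (hA.memLp_size hK hKΩ).integrable_mul (hA.memLp_size hK hKΩ)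
  refine h1.congr (Eventually.of_forall fun x => ?_)
  simp only [Pi.mul_apply]
  rw [← rpow_half_mul_self (s := p - 2) (norm_nonneg (G x)) (by linarith)]
  ring

theorem HasSecondDeriv.size_eq_zero (hA : HasSecondDeriv p Ω G A) {x : E n} (hx : G x = 0) :
    size A x = 0 := Finset.sum_eq_zero fun i _ => by rw [hA.zero i x hx, norm_zero]

theorem HasSecondDeriv.aestronglyMeasurable_fderiv (hA : HasSecondDeriv p Ω G A)
    (hG : Measurable G) (F : E n → ℝ) {K : Set (E n)} (hK : IsCompact K) (hKΩ : K ⊆ Ω)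
    (i : Fin n) : AEStronglyMeasurable (fun x => fderiv ℝ F (G x) (A i x)) (volume.restrict K) :=
  aestronglyMeasurable_fderiv_apply F hG.aestronglyMeasurable
    fun j => hA.aestronglyMeasurable K hK hKΩ i j

theorem HasSecondDeriv.locDiff_comp (hA : HasSecondDeriv p Ω G A)
    (hf : IsAdmissible p f) (hp : 0 < p) {H : ℝ → ℝ} (hH : IsAnnular H) (i : Fin n) :
    LocDiff Ω (EuclideanSpace.single i 1) (fun x => H (f (G x))) fun x =>
      deriv H (f (G x)) * fderiv ℝ f (G x) (A i x) := by
  simpa using hA.locDiff_mul hf hp (M := fun _ => 1) contDiffOn_const hH i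

theorem IsGlobalSol.locDiff (hs : IsGlobalSol p f Ω u G) (hp : 2 ≤ p) (hΩ : IsOpen Ω)
    (i : Fin n) : LocDiff Ω (EuclideanSpace.single i 1) u fun x => G x i := by
  have h2 : (2 : ℝ≥0∞) ≤ ENNReal.ofReal p := by
    rw [← ENNReal.ofReal_ofNat]; exact ENNReal.ofReal_le_ofReal hp
  refine (hs.weakGrad i).locDiff hΩ (fun K hK => ?_) fun K hK => ?_ <;>
  · have := isFiniteMeasure_restrict_of_isCompact hK
    first
    | exact (hs.memLp.restrict K).mono_exponent h2
    | exact ((hs.memLp_grad_apply i).restrict K).mono_exponent h2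

theorem locallyIntegrableOn_of_isCompact (hΩ : IsOpen Ω) {F : Type*} [NormedAddCommGroup F]
    {h : E n → F} (hh : ∀ K, IsCompact K → K ⊆ Ω → IntegrableOn h K) : LocallyIntegrableOn h Ω :=
  (locallyIntegrableOn_iff hΩ.isLocallyClosed).2 fun K hK hc => hh K hc hK

theorem fderiv_coord (j : Fin n) (x v : E n) : fderiv ℝ (fun η : E n => η j) x v = v j := by
  have h := ((EuclideanSpace.proj j : E n →L[ℝ] ℝ).hasFDerivAt (x := x)).fderiv
  have h2 : fderiv ℝ (fun η : E n => η j) x = (EuclideanSpace.proj j : E n →L[ℝ] ℝ) := h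
  rw [h2]; rfl

theorem contDiff_coord (j : Fin n) : ContDiff ℝ 1 fun η : E n => η j :=
  (EuclideanSpace.proj j : E n →L[ℝ] ℝ).contDiff

/-- Let c = φ H(f(∇u)). The null Lagrangian identity gives ∫ ∂ᵢc ∂ⱼu = ∫ ∂ⱼc ∂ᵢu, while ∂ᵢ(c ∂ⱼu)
and ∂ⱼ(c ∂ᵢu) have integral zero. Subtracting leaves the antisymmetric part of `A`. -/
theorem IsGlobalSol.integral_symm (hs : IsGlobalSol p f Ω u G) (hf : IsAdmissible p f)
    (hp : 2 ≤ p) (hΩ : IsOpen Ω) (hA : HasSecondDeriv p Ω G A) {H : ℝ → ℝ} (hH : IsAnnular H)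
    {φ : E n → ℝ} (hφ : IsTest Ω φ) (i j : Fin n) :
    ∫ x, φ x * ((A i x j - A j x i) * H (f (G x))) = 0 := by
  have hp0 : 0 < p := by linarith
  have h0 : ∀ x, x ∉ tsupport φ → φ x = 0 := fun x hx => image_eq_zero_of_notMem_tsupport hx
  have h0' : ∀ k x, x ∉ tsupport φ → fderiv ℝ φ x (EuclideanSpace.single k 1) = 0 :=
    fun k x hx => fderiv_apply_eq_zero_of_notMem_tsupport _ hx
  let c : Fin n → E n → ℝ := fun k x => fderiv ℝ φ x (EuclideanSpace.single k 1) * H (f (G x)) +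
    φ x * (deriv H (f (G x)) * fderiv ℝ f (G x) (A k x))
  have hc : ∀ k, LocDiff Set.univ (EuclideanSpace.single k 1) (fun x => φ x * H (f (G x))) (c k) :=
    fun k => (hA.locDiff_comp hf hp0 hH k).mul_test hΩ hφ
  have hc0 : ∀ k x, x ∉ tsupport φ → c k x = 0 := fun k x hx => by
    simp only [c, h0 x hx, h0' k x hx, zero_mul, add_zero]
  let b : Fin n → Fin n → E n → ℝ := fun k l x =>
    fderiv ℝ φ x (EuclideanSpace.single k 1) * (G x l * H (f (G x))) +
      φ x * (A k x l * H (f (G x)) + G x l * (deriv H (f (G x)) * fderiv ℝ f (G x) (A k x)))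
  have hb : ∀ k l, LocDiff Set.univ (EuclideanSpace.single k 1)
      (fun x => φ x * (G x l * H (f (G x)))) (b k l) := by
    intro k l
    have h1 := hA.locDiff_mul hf hp0 (M := fun η => η l) (contDiff_coord l).contDiffOn hH k
    simp only [fderiv_coord] at h1
    exact h1.mul_test hΩ hφ
  have hb0 : ∀ k l x, x ∉ tsupport φ → b k l x = 0 := fun k l x hx => by
    simp only [b, h0 x hx, h0' k x hx, zero_mul, add_zero]
  have e1 := LocDiff.integral_mul_eq_integral_mul hΩ hφ.compact hφ.supp (hc i) (hc j)
    (hs.locDiff hp hΩ i) (hs.locDiff hp hΩ j) (fun x hx => by rw [h0 x hx, zero_mul])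
    (hc0 i) (hc0 j)
  have e2 := fun k l => (hb k l).integral_deriv_eq_zero hφ.compact
    (fun x hx => by rw [h0 x hx, zero_mul]) (hb0 k l)
  have ib : ∀ k l, Integrable fun x => b k l x := fun k l => integrable_of_memLp_two hφ.compact
    ((hb k l).memLp_deriv _ hφ.compact (Set.subset_univ _)) (hb0 k l)
  have ic : ∀ k l, Integrable fun x => c k x * G x l := fun k l => integrable_mul_of_memLp_two
    ((hc k).memLp_deriv _ hφ.compact (Set.subset_univ _))
    ((hs.locDiff hp hΩ l).memLp_deriv _ hφ.compact hφ.supp) (hc0 k)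
  have i1 : Integrable fun x => b i j x - c i x * G x j := (ib i j).sub (ic i j)
  have i2 : Integrable fun x => b j i x - c j x * G x i := (ib j i).sub (ic j i)
  have e3 : ∀ x, φ x * ((A i x j - A j x i) * H (f (G x))) =
      (b i j x - c i x * G x j) - (b j i x - c j x * G x i) := by
    intro x
    simp only [b, c]
    ring
  simp only [e3]
  rw [integral_sub i1 i2, integral_sub (ib i j) (ic i j), integral_sub (ib j i) (ic j i), e1,
    e2, e2]
  ring

theorem abs_apply_le_norm {m : ℕ} (z : E m) (j : Fin m) : |z j| ≤ ‖z‖ := PiLp.norm_apply_le z j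

/-- The matrix of second derivatives is symmetric. -/
theorem IsGlobalSol.ae_symm (hs : IsGlobalSol p f Ω u G) (hf : IsAdmissible p f)
    (hp : 2 ≤ p) (hΩ : IsOpen Ω) (hA : HasSecondDeriv p Ω G A) :
    ∀ᵐ x, x ∈ Ω → ∀ i j, A i x j = A j x i := by
  have hp0 : 0 < p := by linarith
  -- The factor `cut` makes the difference locally integrable; as m grows it becomes 1 at every
  -- point where G ≠ 0, and where G = 0 both entries are zero.
  have key : ∀ i j, ∀ m : ℕ, ∀ᵐ x, x ∈ Ω →
      (A i x j - A j x i) * cut 0 (m + 1) (f (G x)) = 0 := by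
    intro i j m
    have hH : IsAnnular (cut 0 (m + 1 : ℝ)) := isAnnular_cut le_rfl (by positivity)
    have hF := hf.isAnnular_mul hp0 (M := fun _ => 1) contDiffOn_const hH
    obtain ⟨C, hC, hb⟩ := hF.exists_bound ((p - 2) / 2)
    refine hΩ.ae_eq_zero_of_integral_contDiff_smul_eq_zero ?_ fun φ h1 h2 h3 =>
      hs.integral_symm hf hp hΩ hA hH ⟨h1, h2, h3⟩ i j
    refine locallyIntegrableOn_of_isCompact hΩ fun K hK hKΩ => ?_
    have := isFiniteMeasure_restrict_of_isCompact hK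
    have hm := ((hA.memLp_size hK hKΩ).integrable (by norm_num)).const_mul (2 * C)
    refine hm.mono' (((hA.aestronglyMeasurable K hK hKΩ i j).sub
      (hA.aestronglyMeasurable K hK hKΩ j i)).mul
      ((contDiff_cut _ _).continuous.measurable.comp
        ((hf.continuous hp0).measurable.comp hs.measurable_grad)).aestronglyMeasurable)
      (Eventually.of_forall fun x => ?_)
    have h1 := hb (G x)
    rw [one_mul] at h1
    have h2 : |A i x j - A j x i| ≤ 2 * size A x := by
      have := abs_sub (A i x j) (A j x i)
      linarith [(abs_apply_le_norm (A i x) j).trans (norm_le_size A i x),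
        (abs_apply_le_norm (A j x) i).trans (norm_le_size A j x)]
    rw [Real.norm_eq_abs, abs_mul]
    calc _ ≤ 2 * size A x * (C * ‖G x‖ ^ ((p - 2) / 2)) :=
          mul_le_mul h2 h1 (abs_nonneg _) (by linarith [size_nonneg A x])
      _ = _ := by ring
  have h1 := ae_all_iff.2 fun i => ae_all_iff.2 fun j => ae_all_iff.2 (key i j)
  filter_upwards [h1] with x hx hxΩ i j
  by_cases h0 : G x = 0
  · rw [hA.zero i x h0, hA.zero j x h0]; rfl
  · have h2 := (tendsto_atTop_add_const_right atTop (1 : ℝ) tendsto_natCast_atTop_atTop).eventually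
      (eventually_cut (hf.pos _ h0))
    obtain ⟨m, hm⟩ := h2.exists
    have h3 := hx i j m hxΩ
    rw [hm.2.self_of_nhds, mul_one] at h3
    linarith

end

/-! ### The equation in non-divergence form and the basic integral identity. -/

section

open Filter Topology ENNReal

variable {n : ℕ} {p : ℝ} {f : E n → ℝ} {Ω : Set (E n)} {u : E n → ℝ} {G : E n → E n}
  {A : Fin n → E n → E n}

theorem IsAdmissible.exists_fderiv_pd_bound (hf : IsAdmissible p f) :
    ∃ C : ℝ, 0 < C ∧ ∀ η, η ≠ 0 → ∀ k v,
      |fderiv ℝ (pd k f) η v| ≤ C * ‖η‖ ^ (p - 2) * ‖v‖ := by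
  obtain ⟨C, hC, hb⟩ := hf.exists_hessian_bound
  refine ⟨C, hC, fun η hη k v => ?_⟩
  have h1 : fderiv ℝ (pd k f) η v =
      fderiv ℝ (fderiv ℝ f) η v (EuclideanSpace.single k 1) := by
    have h := (hf.differentiableAt_fderiv hη).hasFDerivAt.clm_apply
      (hasFDerivAt_const (EuclideanSpace.single k (1 : ℝ)) η)
    have h2 : fderiv ℝ (pd k f) η = _ := h.fderiv
    rw [h2]
    simp
  rw [h1]
  calc |fderiv ℝ (fderiv ℝ f) η v (EuclideanSpace.single k 1)|
      ≤ ‖fderiv ℝ (fderiv ℝ f) η‖ * ‖v‖ * ‖EuclideanSpace.single k (1 : ℝ)‖ :=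
        (fderiv ℝ (fderiv ℝ f) η).le_opNorm₂ v (EuclideanSpace.single k 1)
    _ = ‖fderiv ℝ (fderiv ℝ f) η‖ * ‖v‖ := by simp
    _ ≤ _ := mul_le_mul_of_nonneg_right (hb η hη) (norm_nonneg v)

theorem IsAdmissible.exists_fderiv_le_mul (hf : IsAdmissible p f) (hp : 2 ≤ p) :
    ∃ C : ℝ, 0 < C ∧ ∀ η, η ≠ 0 → ∀ v, |fderiv ℝ f η v| ≤ C * f η * ‖η‖⁻¹ * ‖v‖ := by
  obtain ⟨C, hC, hb⟩ := hf.exists_fderiv_bound hp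
  obtain ⟨c, _, hc, -, h⟩ := hf.exists_bounds
  refine ⟨C / c, by positivity, fun η hη v => ?_⟩
  have h0 : 0 < ‖η‖ := norm_pos_iff.2 hη
  refine ((fderiv ℝ f η).le_opNorm v).trans (mul_le_mul_of_nonneg_right ?_ (norm_nonneg v))
  refine (hb η).trans ?_
  rw [Real.rpow_sub_one h0.ne']
  calc C * (‖η‖ ^ p / ‖η‖) = C / c * (c * ‖η‖ ^ p) * ‖η‖⁻¹ := by field_simp
    _ ≤ _ := by gcongr; exact (h η hη).1

theorem IsAdmissible.abs_pd_le {C : ℝ} (hb : ∀ η, ‖fderiv ℝ f η‖ ≤ C * ‖η‖ ^ (p - 1))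
    (k : Fin n) (η : E n) : |pd k f η| ≤ C * ‖η‖ ^ (p - 1) :=
  ((fderiv ℝ f η).le_opNorm _).trans (by simpa using hb η)

/-- The product rule holds for f_k(∇u) cut off near 0 and ∞. Since s times the derivative of `cut 0
m` is bounded independently of m, all derivatives are dominated by a multiple of |∇u|^{p-2} |D²u|,
and m → ∞ removes the cutoff. -/
theorem IsGlobalSol.isWeakDerivOn_pd (hs : IsGlobalSol p f Ω u G) (hf : IsAdmissible p f)
    (hp : 2 ≤ p) (hΩ : IsOpen Ω) (hA : HasSecondDeriv p Ω G A) (i k : Fin n) :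
    IsWeakDerivOn Ω (EuclideanSpace.single i 1) (fun x => pd k f (G x))
      fun x => fderiv ℝ (pd k f) (G x) (A i x) := by
  have hp0 : 0 < p := by linarith
  obtain ⟨C₁, hC₁, hb₁⟩ := hf.exists_fderiv_bound hp
  obtain ⟨C₂, hC₂, hb₂⟩ := hf.exists_fderiv_pd_bound
  obtain ⟨C₃, hC₃, hb₃⟩ := hf.exists_fderiv_le_mul hp
  obtain ⟨R, hR0, hR⟩ := exists_cut_bounds
  refine isWeakDerivOn_of_tendsto hΩ
    (bh := fun x => |pd k f (G x)|)
    (bg := fun x => (C₂ + C₁ * C₃ * R) * (‖G x‖ ^ (p - 2) * size A x))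
    (H := fun m x => pd k f (G x) * cut 0 m (f (G x)))
    ((eventually_gt_atTop 0).mono fun m hm =>
      hA.locDiff_mul hf hp0 (hf.contDiffOn_pd k) (isAnnular_cut le_rfl hm) i)
    (Eventually.of_forall fun m x => ?_) ?_ (fun K hK _ => ?_)
    (fun K hK hKΩ => (hs.integrableOn_size hp hA hK hKΩ).const_mul _) (fun x => ?_) fun x => ?_
  · rw [abs_mul, abs_of_nonneg (cut_nonneg _ _ _)]
    exact mul_le_of_le_one_right (abs_nonneg _) (cut_le_one _ _ _)
  · filter_upwards [eventually_gt_atTop 0] with m hm x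
    by_cases hx : G x = 0
    · simp [hA.zero i x hx, hA.size_eq_zero hx]
    have h0 : 0 < ‖G x‖ := norm_pos_iff.2 hx
    have hfx := hf.pos _ hx
    have hAi := norm_le_size A i x
    have e1 : |fderiv ℝ (pd k f) (G x) (A i x) * cut 0 m (f (G x))| ≤
        C₂ * (‖G x‖ ^ (p - 2) * size A x) := by
      rw [abs_mul, abs_of_nonneg (cut_nonneg _ _ _)]
      calc _ ≤ |fderiv ℝ (pd k f) (G x) (A i x)| :=
            mul_le_of_le_one_right (abs_nonneg _) (cut_le_one _ _ _)
        _ ≤ C₂ * ‖G x‖ ^ (p - 2) * ‖A i x‖ := hb₂ _ hx _ _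
        _ ≤ C₂ * ‖G x‖ ^ (p - 2) * size A x := by gcongr
        _ = _ := by ring
    have e2 : |pd k f (G x) * (deriv (cut 0 m) (f (G x)) * fderiv ℝ f (G x) (A i x))| ≤
        C₁ * C₃ * R * (‖G x‖ ^ (p - 2) * size A x) := by
      have h1 := (hR 0 m _ le_rfl hm hfx.le).2 hfx.le
      rw [sub_zero] at h1
      have h2 : ‖G x‖ ^ (p - 2) = ‖G x‖ ^ (p - 1) * ‖G x‖⁻¹ := by
        rw [← div_eq_mul_inv, ← Real.rpow_sub_one h0.ne']
        ring_nf
      rw [abs_mul, abs_mul]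
      calc _ ≤ (C₁ * ‖G x‖ ^ (p - 1)) * (|deriv (cut 0 m) (f (G x))| *
            (C₃ * f (G x) * ‖G x‖⁻¹ * size A x)) := by
            gcongr
            · exact IsAdmissible.abs_pd_le hb₁ k _
            · exact (hb₃ _ hx _).trans (by gcongr)
        _ = C₁ * C₃ * (f (G x) * |deriv (cut 0 m) (f (G x))|) *
            (‖G x‖ ^ (p - 2) * size A x) := by rw [h2]; ring
        _ ≤ _ := by
          have := size_nonneg A x
          gcongr
    rw [add_mul]
    exact (abs_add_le _ _).trans (add_le_add e1 e2)
  · have f2 : 1 ≤ ENNReal.ofReal (p / (p - 1)) := by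
      rw [ENNReal.one_le_ofReal, le_div_iff₀ (by linarith)]; linarith
    exact ((hs.memLp_pd hf hp k).locallyIntegrable f2).integrableOn_isCompact hK |>.abs
  · by_cases hx : G x = 0
    · have : pd k f (G x) = 0 := by simp [pd, hx, hf.fderiv_zero hp]
      simp [this]
    · refine tendsto_nhds_of_eventually_eq ?_
      filter_upwards [eventually_cut (hf.pos _ hx)] with m hm
      rw [hm.2.self_of_nhds, mul_one]
  · by_cases hx : G x = 0
    · simp [hA.zero i x hx]
    · refine tendsto_nhds_of_eventually_eq ?_
      filter_upwards [eventually_cut (hf.pos _ hx)] with m hm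
      rw [hm.2.self_of_nhds, hm.2.deriv_eq, deriv_const, zero_mul, mul_zero, mul_one, add_zero]

theorem IsGlobalSol.integrableOn_fderiv_pd (hs : IsGlobalSol p f Ω u G) (hf : IsAdmissible p f)
    (hp : 2 ≤ p) (hA : HasSecondDeriv p Ω G A) (i k : Fin n) {K : Set (E n)} (hK : IsCompact K)
    (hKΩ : K ⊆ Ω) : IntegrableOn (fun x => fderiv ℝ (pd k f) (G x) (A i x)) K := by
  obtain ⟨C, hC, hb⟩ := hf.exists_fderiv_pd_bound
  refine ((hs.integrableOn_size hp hA hK hKΩ).const_mul C).mono'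
    (hA.aestronglyMeasurable_fderiv hs.measurable_grad _ hK hKΩ i)
    (Eventually.of_forall fun x => ?_)
  by_cases hx : G x = 0
  · simp [hA.zero i x hx, hA.size_eq_zero hx]
  · calc _ ≤ C * ‖G x‖ ^ (p - 2) * ‖A i x‖ := hb _ hx _ _
      _ ≤ C * ‖G x‖ ^ (p - 2) * size A x := by gcongr; exact norm_le_size A i x
      _ = _ := by ring

/-- The equation in non-divergence form. -/
theorem IsGlobalSol.ae_trace (hs : IsGlobalSol p f Ω u G) (hf : IsAdmissible p f)
    (hp : 2 ≤ p) (hΩ : IsOpen Ω) (hA : HasSecondDeriv p Ω G A) :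
    ∀ᵐ x, x ∈ Ω → ∑ k, fderiv ℝ (pd k f) (G x) (A k x) = 0 := by
  refine hΩ.ae_eq_zero_of_integral_contDiff_smul_eq_zero
    (locallyIntegrableOn_of_isCompact hΩ fun K hK hKΩ => integrable_finsetSum _ fun k _ =>
      hs.integrableOn_fderiv_pd hf hp hA k k hK hKΩ) fun φ h1 h2 h3 => ?_
  have hφ : IsTest Ω φ := ⟨h1, h2, h3⟩
  have f2 : 1 ≤ ENNReal.ofReal (p / (p - 1)) := by
    rw [ENNReal.one_le_ofReal, le_div_iff₀ (by linarith)]; linarith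
  have i1 : ∀ k, Integrable fun x => fderiv ℝ (pd k f) (G x) (A k x) * φ x := fun k =>
    hφ.integrable_mul (hs.integrableOn_fderiv_pd hf hp hA k k hφ.compact hφ.supp)
  have i2 : ∀ k, Integrable fun x => pd k f (G x) * pd k φ x := fun k =>
    hφ.integrable_mul_fderiv _
      (((hs.memLp_pd hf hp k).locallyIntegrable f2).integrableOn_isCompact hφ.compact)
  have e1 := hs.eqn φ hφ
  rw [integral_finsetSum _ fun k _ => i2 k] at e1
  have e2 : ∀ x, φ x • ∑ k, fderiv ℝ (pd k f) (G x) (A k x) =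
      ∑ k, fderiv ℝ (pd k f) (G x) (A k x) * φ x := fun x => by
    rw [smul_eq_mul, mul_comm, Finset.sum_mul]
  simp only [e2]
  rw [integral_finsetSum _ fun k _ => i1 k, ← neg_eq_zero, ← Finset.sum_neg_distrib, ← e1]
  exact Finset.sum_congr rfl fun k _ => (hs.isWeakDerivOn_pd hf hp hΩ hA k k φ hφ).symm

/-- The support of K is compact and stays away from 0, so one large m serves it throughout. It
allows Df(∇u) to be replaced by a field to which the annular chain rule applies. -/
theorem IsAnnular.exists_cut_eq_one {K : ℝ → ℝ} (hK : IsAnnular K) :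
    ∃ m : ℝ, 0 < m ∧ ∀ s ∈ tsupport K, 0 ≤ s → cut 0 m =ᶠ[𝓝 s] fun _ => 1 := by
  obtain ⟨R, hR⟩ := hK.compact.isCompact.isBounded.exists_norm_le
  have h0 : (0 : ℝ) ∉ tsupport K := notMem_tsupport_iff_eventuallyEq.2 hK.zero
  obtain ⟨r, hr, hball⟩ := Metric.isOpen_iff.1 (isClosed_tsupport K).isOpen_compl 0 h0
  have hm : 0 < max (3 / r) (R + 1) := lt_max_of_lt_left (by positivity)
  refine ⟨max (3 / r) (R + 1), hm, fun s hs hs0 => cut_eventuallyEq_one hm ?_ ?_⟩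
  · have h1 : r ≤ s := by
      by_contra h
      push Not at h
      exact hball (by rw [Metric.mem_ball, dist_zero_right, Real.norm_of_nonneg hs0]; exact h) hs
    have h2 : (max (3 / r) (R + 1))⁻¹ ≤ (3 / r)⁻¹ := inv_anti₀ (by positivity) (le_max_left _ _)
    rw [inv_div] at h2
    linarith
  · have := (le_abs_self s).trans (hR s hs)
    exact lt_of_lt_of_le (by linarith) (le_max_right _ _)

/-- The identity obtained by testing the differentiated equation with `φ Df(∇u) K(f(∇u))`. -/
theorem IsGlobalSol.integral_core (hs : IsGlobalSol p f Ω u G) (hf : IsAdmissible p f)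
    (hp : 2 ≤ p) (hΩ : IsOpen Ω) (hA : HasSecondDeriv p Ω G A) {K : ℝ → ℝ} (hK : IsAnnular K)
    {φ : E n → ℝ} (hφ : IsTest Ω φ) :
    (Integrable fun x => ∑ j, ∑ k, (pd k φ x * (pd j f (G x) * K (f (G x))) +
      φ x * (fderiv ℝ (pd j f) (G x) (A k x) * K (f (G x)) +
        pd j f (G x) * (deriv K (f (G x)) * fderiv ℝ f (G x) (A k x)))) *
      fderiv ℝ (pd k f) (G x) (A j x)) ∧
    ∫ x, ∑ j, ∑ k, (pd k φ x * (pd j f (G x) * K (f (G x))) +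
      φ x * (fderiv ℝ (pd j f) (G x) (A k x) * K (f (G x)) +
        pd j f (G x) * (deriv K (f (G x)) * fderiv ℝ f (G x) (A k x)))) *
      fderiv ℝ (pd k f) (G x) (A j x) = 0 := by
  have hp0 : 0 < p := by linarith
  obtain ⟨m, hm, hmK⟩ := hK.exists_cut_eq_one
  let c : Fin n → Fin n → E n → ℝ := fun j k x => pd k φ x * (pd j f (G x) * K (f (G x))) +
      φ x * (fderiv ℝ (pd j f) (G x) (A k x) * K (f (G x)) +
        pd j f (G x) * (deriv K (f (G x)) * fderiv ℝ f (G x) (A k x)))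
  -- Derivatives of the cut off field f_k(∇u) `cut`; they agree with those of f_k(∇u) wherever some
  -- entry of `c` is nonzero.
  let b : Fin n → Fin n → E n → ℝ := fun k j x =>
    fderiv ℝ (pd k f) (G x) (A j x) * cut 0 m (f (G x)) +
      pd k f (G x) * (deriv (cut 0 m) (f (G x)) * fderiv ℝ f (G x) (A j x))
  have hb : ∀ k j, LocDiff Ω (EuclideanSpace.single j 1)
      (fun x => pd k f (G x) * cut 0 m (f (G x))) (b k j) := fun k j =>
    hA.locDiff_mul hf hp0 (hf.contDiffOn_pd k) (isAnnular_cut le_rfl hm) j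
  have hc : ∀ j k, LocDiff Set.univ (EuclideanSpace.single k 1)
      (fun x => φ x * (pd j f (G x) * K (f (G x)))) (c j k) := fun j k =>
    (hA.locDiff_mul hf hp0 (hf.contDiffOn_pd j) hK k).mul_test hΩ hφ
  have h0 : ∀ x, x ∉ tsupport φ → φ x = 0 := fun x hx => image_eq_zero_of_notMem_tsupport hx
  have hc0 : ∀ j k x, x ∉ tsupport φ → c j k x = 0 := fun j k x hx => by
    have h1 : pd k φ x = 0 := fderiv_apply_eq_zero_of_notMem_tsupport _ hx
    simp only [c, h0 x hx, h1, zero_mul, add_zero]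
  have hsupp : ∀ j k x, c j k x ≠ 0 → f (G x) ∈ tsupport K := by
    intro j k x hx
    by_contra hn
    apply hx
    have h1 : K (f (G x)) = 0 := image_eq_zero_of_notMem_tsupport hn
    have h2 : deriv K (f (G x)) = 0 := by
      rw [(notMem_tsupport_iff_eventuallyEq.1 hn).deriv_eq]
      exact deriv_const _ _
    simp only [c, h1, h2, mul_zero, zero_mul, add_zero]
  have hcut : ∀ x, f (G x) ∈ tsupport K → ∀ k j, b k j x = fderiv ℝ (pd k f) (G x) (A j x) := by
    intro x hx k j
    have h1 := hmK _ hx (hf.nonneg _)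
    simp only [b]
    rw [h1.deriv_eq, h1.self_of_nhds, deriv_const, zero_mul, mul_zero, mul_one, add_zero]
  have hcb : ∀ j k x, c j k x * b k j x = c j k x * fderiv ℝ (pd k f) (G x) (A j x) := by
    intro j k x
    by_cases h : c j k x = 0
    · rw [h, zero_mul, zero_mul]
    · rw [hcut x (hsupp j k x h)]
  have hi : ∀ j k l i, Integrable fun x => c j k x * b l i x := fun j k l i =>
    integrable_mul_of_memLp_two ((hc j k).memLp_deriv _ hφ.compact (Set.subset_univ _))
      ((hb l i).memLp_deriv _ hφ.compact hφ.supp) (hc0 j k)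
  -- Exchanging the two derivatives turns the sum of ∂_k c_j ∂_j b_k over k into ∂_j c_j times the
  -- divergence of b, which vanishes where it matters by `IsGlobalSol.ae_trace`.
  have hswap : ∀ j k, ∫ x, c j j x * b k k x = ∫ x, c j k x * b k j x := fun j k =>
    LocDiff.integral_mul_eq_integral_mul hΩ hφ.compact hφ.supp (hc j j) (hc j k) (hb k j) (hb k k)
      (fun x hx => by rw [h0 x hx, zero_mul]) (hc0 j j) (hc0 j k)
  have hi' : ∀ j k, Integrable fun x => c j k x * fderiv ℝ (pd k f) (G x) (A j x) := fun j k => by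
    simpa only [hcb] using hi j k k j
  refine ⟨integrable_finsetSum _ fun j _ => integrable_finsetSum _ fun k _ => hi' j k, ?_⟩
  change ∫ x, ∑ j, ∑ k, c j k x * fderiv ℝ (pd k f) (G x) (A j x) = 0
  rw [integral_finsetSum _ fun j _ => integrable_finsetSum _ fun k _ => hi' j k]
  refine Finset.sum_eq_zero fun j _ => ?_
  rw [integral_finsetSum _ fun k _ => hi' j k]
  have e1 : ∀ k, ∫ x, c j k x * fderiv ℝ (pd k f) (G x) (A j x) = ∫ x, c j j x * b k k x :=
    fun k => by rw [hswap]; simp only [hcb]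
  rw [Finset.sum_congr rfl fun k _ => e1 k, ← integral_finsetSum _ fun k _ => hi j j k k]
  refine integral_eq_zero_of_ae ?_
  filter_upwards [hs.ae_trace hf hp hΩ hA] with x hx
  rw [← Finset.mul_sum, Pi.zero_apply]
  by_cases h : c j j x = 0
  · rw [h, zero_mul]
  · have hxΩ : x ∈ Ω := by
      by_contra hn
      exact h (hc0 j j x fun hxs => hn (hφ.supp hxs))
    rw [Finset.sum_congr rfl fun k _ => hcut x (hsupp j j x h) k k, hx hxΩ, mul_zero]

end

/-! ### The pointwise inequality and its integrated form for log f(∇u). -/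

section

open Filter Topology ENNReal

open Matrix in
/-- The trace inequality in the form in which it enters the estimate for `log f(∇u)`. -/
theorem mul_dotProduct_le_trace_sq {n : ℕ} {p : ℝ} (hn : 2 ≤ n) (hp : (n : ℝ) ≤ p)
    {B a : Matrix (Fin n) (Fin n) ℝ} (ha : a.IsSymm) (hB : B.PosDef) (htr : (a * B).trace = 0)
    {η w g : Fin n → ℝ} {F : ℝ} (hF : 0 < F) (hη : η ≠ 0) (h1 : B *ᵥ η = (p - 1) • w)
    (h2 : η ⬝ᵥ w = p * F) (h3 : a *ᵥ w = F • g) :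
    F * (g ⬝ᵥ (B *ᵥ g)) ≤ ((B * a) ^ 2).trace := by
  have hp2 : 2 ≤ p := le_trans (by exact_mod_cast hn) hp
  have hBs : Bᵀ = B := by
    have := hB.isHermitian
    rwa [IsHermitian, conjTranspose_eq_transpose_of_trivial] at this
  have hsymm : ∀ (M : Matrix (Fin n) (Fin n) ℝ), Mᵀ = M → ∀ y z : Fin n → ℝ,
      y ⬝ᵥ (M *ᵥ z) = (M *ᵥ y) ⬝ᵥ z := fun M hM y z => by
    rw [dotProduct_mulVec, ← mulVec_transpose, hM]
  -- The inequality is used with ζ = η, the gradient. Then the numerator is (p-1)² F² ⟨Bg, g⟩ and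
  -- the denominator (p-1) p F, so the factor p/(p-1) cancels exactly.
  have h4 := trace_sq_sub_nonneg hn hp ha hB htr hη
  have e1 : (B * a * B * a * B) *ᵥ η = ((p - 1) * F) • (B *ᵥ (a *ᵥ (B *ᵥ g))) := by
    simp only [← mulVec_mulVec]
    rw [h1, mulVec_smul, h3]
    simp only [mulVec_smul, smul_smul]
  have e2 : η ⬝ᵥ ((B * a * B * a * B) *ᵥ η) = (p - 1) ^ 2 * F ^ 2 * (g ⬝ᵥ (B *ᵥ g)) := by
    rw [e1, dotProduct_smul, hsymm B hBs, h1, smul_dotProduct, hsymm a ha, h3, smul_dotProduct]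
    simp only [smul_eq_mul]
    ring
  have e3 : η ⬝ᵥ (B *ᵥ η) = (p - 1) * (p * F) := by
    rw [h1, dotProduct_smul, h2, smul_eq_mul]
  rw [e2, e3] at h4
  have e4 : p / (p - 1) * ((p - 1) ^ 2 * F ^ 2 * (g ⬝ᵥ (B *ᵥ g)) / ((p - 1) * (p * F))) =
      F * (g ⬝ᵥ (B *ᵥ g)) := by
    have : p - 1 ≠ 0 := by linarith
    have : p ≠ 0 := by linarith
    field_simp
  rw [e4] at h4
  linarith

open Matrix in
-- The right side is the integrand of `IsGlobalSol.integral_core`, with Q = Ba the derivative of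
-- Df(∇u). The terms with `d` and `K'` are computed from Qw = F Bg; the term φ K tr Q² is bounded
-- below by `mul_dotProduct_le_trace_sq`.
theorem core_pointwise {n : ℕ} {p : ℝ} (hn : 2 ≤ n) (hp : (n : ℝ) ≤ p)
    {B a Q : Matrix (Fin n) (Fin n) ℝ} (ha : a.IsSymm) (hB : B.PosDef) (htr : (a * B).trace = 0)
    (hQ : Q = B * a) {η w g d : Fin n → ℝ} {F φ K K' : ℝ} (hF : 0 < F) (hφ : 0 ≤ φ) (hK : 0 ≤ K)
    (hη : η ≠ 0) (h1 : B *ᵥ η = (p - 1) • w) (h2 : η ⬝ᵥ w = p * F) (h3 : a *ᵥ w = F • g) :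
    K * F * (d ⬝ᵥ (B *ᵥ g)) + φ * (K * F + K' * F ^ 2) * (g ⬝ᵥ (B *ᵥ g)) ≤
      ∑ j, ∑ k, (d k * (w j * K) + φ * (Q j k * K + w j * (K' * (F * g k)))) * Q k j := by
  have h5 := mul_dotProduct_le_trace_sq hn hp ha hB htr hF hη h1 h2 h3
  rw [← hQ] at h5
  have hQw : Q *ᵥ w = F • (B *ᵥ g) := by
    rw [hQ, ← mulVec_mulVec, h3, mulVec_smul]
  have e0 : ∀ y : Fin n → ℝ, ∑ j, ∑ k, y k * (w j * Q k j) = F * (y ⬝ᵥ (B *ᵥ g)) := by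
    intro y
    have : y ⬝ᵥ (Q *ᵥ w) = F * (y ⬝ᵥ (B *ᵥ g)) := by rw [hQw, dotProduct_smul, smul_eq_mul]
    rw [← this, Finset.sum_comm]
    simp only [dotProduct, mulVec, Finset.mul_sum]
    refine Finset.sum_congr rfl fun k _ => Finset.sum_congr rfl fun j _ => by ring
  have etr : ∑ j, ∑ k, Q j k * Q k j = (Q ^ 2).trace := by
    simp only [pow_two, trace, diag_apply, mul_apply]
  have e1 : ∑ j, ∑ k, (d k * (w j * K) + φ * (Q j k * K + w j * (K' * (F * g k)))) * Q k j =
      K * (∑ j, ∑ k, d k * (w j * Q k j)) + φ * K * (∑ j, ∑ k, Q j k * Q k j) +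
        φ * K' * F * ∑ j, ∑ k, g k * (w j * Q k j) := by
    simp only [Finset.mul_sum, ← Finset.sum_add_distrib]
    refine Finset.sum_congr rfl fun j _ => Finset.sum_congr rfl fun k _ => by ring
  rw [e1, e0, e0, etr]
  have h6 := mul_le_mul_of_nonneg_left h5 (mul_nonneg hφ hK)
  linarith

variable {n : ℕ} {p : ℝ} {f : E n → ℝ} {Ω : Set (E n)} {u : E n → ℝ} {G : E n → E n}
  {A : Fin n → E n → E n}

/-- The gradient of `log f(G)` on the set where `G` does not vanish. -/
def logGrad (f : E n → ℝ) (G : E n → E n) (A : Fin n → E n → E n) (x : E n) : E n :=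
  WithLp.toLp 2 fun i => fderiv ℝ f (G x) (A i x) / f (G x)

theorem logGrad_apply (x : E n) (i : Fin n) :
    logGrad f G A x i = fderiv ℝ f (G x) (A i x) / f (G x) := rfl

theorem HasSecondDeriv.logGrad_eq_zero (hA : HasSecondDeriv p Ω G A) {x : E n} (hx : G x = 0) :
    logGrad f G A x = 0 := by
  ext i
  simp [logGrad_apply, hA.zero i x hx]

/-- `∑ f_{jk}(∇u) g_j d_k`. -/
def hessForm (f : E n → ℝ) (G : E n → E n) (x g d : E n) : ℝ :=
  ∑ k, ∑ j, hess f (G x) j k * g j * d k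

theorem IsAdmissible.hessForm_eq (hf : IsAdmissible p f) {x : E n} (hx : G x ≠ 0) (g d : E n) :
    hessForm f G x g d = WithLp.ofLp d ⬝ᵥ ((hess f (G x)).mulVec (WithLp.ofLp g)) := by
  simp only [hessForm, dotProduct, Matrix.mulVec, Finset.mul_sum]
  refine Finset.sum_congr rfl fun k _ => Finset.sum_congr rfl fun j _ => ?_
  rw [(hf.hess_symm hx).apply k j]
  ring

/-- The Caccioppoli type inequality for `log f(∇u)`. -/
theorem IsGlobalSol.integral_cut_le (hs : IsGlobalSol p f Ω u G) (hf : IsAdmissible p f)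
    (hn : 2 ≤ n) (hp : (n : ℝ) ≤ p) (hΩ : IsOpen Ω) (hA : HasSecondDeriv p Ω G A) {k ℓ : ℝ → ℝ}
    (hk : IsAnnular k) (hk0 : ∀ s, 0 ≤ k s) (hℓ : ∀ s, -ℓ s ≤ deriv k s)
    {φ : E n → ℝ} (hφ : IsTest Ω φ) (hφ0 : ∀ x, 0 ≤ φ x) {d : E n → E n}
    (hd : ∀ x i, d x i = pd i φ x)
    (hint : Integrable fun x => k (f (G x)) * hessForm f G x (logGrad f G A x) (d x) -
      φ x * (f (G x) * ℓ (f (G x))) * hessForm f G x (logGrad f G A x) (logGrad f G A x)) :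
    ∫ x, k (f (G x)) * hessForm f G x (logGrad f G A x) (d x) -
      φ x * (f (G x) * ℓ (f (G x))) *
        hessForm f G x (logGrad f G A x) (logGrad f G A x) ≤ 0 := by
  have hp2 : 2 ≤ p := le_trans (by exact_mod_cast hn) hp
  -- The weight K(s) = k(s)/s is chosen because sK + s²K' = s k', so the term quadratic in the
  -- gradient of log f(∇u) has the sign of k'.
  have hK : IsAnnular fun s => s⁻¹ * k s := by
    refine ⟨contDiff_iff_contDiffAt.2 fun s => ?_, hk.compact.mul_left, ?_⟩
    · rcases eq_or_ne s 0 with rfl | hs0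
      · refine (contDiffAt_const (c := (0 : ℝ))).congr_of_eventuallyEq ?_
        filter_upwards [hk.zero] with s hs0
        rw [hs0, mul_zero]
      · exact (contDiffAt_inv ℝ hs0).mul hk.contDiff.contDiffAt
    · filter_upwards [hk.zero] with s hs0
      rw [hs0, mul_zero]
  have hK' : ∀ s, s ≠ 0 → deriv (fun s => s⁻¹ * k s) s = -(s ^ 2)⁻¹ * k s + s⁻¹ * deriv k s :=
    fun s hs0 => ((hasDerivAt_inv hs0).mul
      (hk.contDiff.differentiable one_ne_zero s).hasDerivAt).deriv
  obtain ⟨i1, h1⟩ := hs.integral_core hf hp2 hΩ hA hK hφ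
  rw [← h1]
  refine integral_mono_ae hint i1 ?_
  filter_upwards [hs.ae_symm hf hp2 hΩ hA, hs.ae_trace hf hp2 hΩ hA] with x hsy htr
  by_cases hx : G x = 0
  · have e1 : ∀ y, hessForm f G x 0 y = 0 := fun y => by simp [hessForm]
    have e2 : ∀ j, A j x = 0 := fun j => hA.zero j x hx
    simp only [hA.logGrad_eq_zero hx, e1, e2, map_zero, mul_zero, sub_zero, Finset.sum_const_zero,
      le_refl]
  by_cases hxφ : x ∈ tsupport φ
  swap
  · have e1 : φ x = 0 := image_eq_zero_of_notMem_tsupport hxφ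
    have e2 : ∀ k, pd k φ x = 0 := fun k => fderiv_apply_eq_zero_of_notMem_tsupport _ hxφ
    have e3 : ∀ y, hessForm f G x y (d x) = 0 := fun y => by simp [hessForm, hd, e2]
    simp only [e1, e2, e3, zero_mul, mul_zero, sub_zero, add_zero, Finset.sum_const_zero, le_refl]
  have hxΩ := hφ.supp hxφ
  specialize hsy hxΩ
  specialize htr hxΩ
  have hF := hf.pos _ hx
  set B := hess f (G x) with hB
  let a : Matrix (Fin n) (Fin n) ℝ := Matrix.of fun j l => A j x l
  have ha : a.IsSymm := by ext i j; exact hsy j i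
  have hQ : ∀ k j, fderiv ℝ (pd k f) (G x) (A j x) = (B * a) k j := by
    intro k j
    rw [fderiv_pd, Matrix.mul_apply]
    exact Finset.sum_congr rfl fun l _ => by rw [hsy j l]; rfl
  have htr' : (a * B).trace = 0 := by
    rw [Matrix.trace_mul_comm]
    simp only [hQ] at htr
    exact htr
  have h3 : a.mulVec (fun l => pd l f (G x)) = f (G x) • WithLp.ofLp (logGrad f G A x) := by
    funext k
    rw [Pi.smul_apply, smul_eq_mul, logGrad_apply, mul_div_cancel₀ _ hF.ne', fderiv_apply_eq_sum]
    rfl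
  have hg : ∀ k, fderiv ℝ f (G x) (A k x) = f (G x) * logGrad f G A x k := fun k => by
    rw [logGrad_apply, mul_div_cancel₀ _ hF.ne']
  have hcore := core_pointwise hn hp (K := (f (G x))⁻¹ * k (f (G x)))
    (K' := deriv (fun s => s⁻¹ * k s) (f (G x))) (d := WithLp.ofLp (d x)) (φ := φ x) ha
    (hf.hess_posDef hx) htr' rfl hF (hφ0 x) (mul_nonneg (inv_nonneg.2 hF.le) (hk0 _))
    (η := WithLp.ofLp (G x)) (w := fun l => pd l f (G x)) (g := WithLp.ofLp (logGrad f G A x))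
    (fun h => hx (by ext i; exact congrFun h i))
    (funext fun j => hf.hess_mulVec_self hx j) (hf.sum_pd_mul_self hx) h3
  rw [← hf.hessForm_eq hx, ← hf.hessForm_eq hx, hK' _ hF.ne'] at hcore
  simp only [hQ, hg, ← hd]
  rw [hK' _ hF.ne']
  refine le_trans ?_ hcore
  have hpos : 0 ≤ hessForm f G x (logGrad f G A x) (logGrad f G A x) := by
    rw [hf.hessForm_eq hx]
    simpa using (hf.hess_posDef hx).posSemidef.dotProduct_mulVec_nonneg
      (WithLp.ofLp (logGrad f G A x))
  have e1 : (f (G x))⁻¹ * k (f (G x)) * f (G x) = k (f (G x)) := by field_simp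
  have e2 : (f (G x))⁻¹ * k (f (G x)) * f (G x) + (-(f (G x) ^ 2)⁻¹ * k (f (G x)) +
      (f (G x))⁻¹ * deriv k (f (G x))) * f (G x) ^ 2 = f (G x) * deriv k (f (G x)) := by
    field_simp
    ring
  rw [e2, e1]
  have h6 : -(f (G x) * ℓ (f (G x))) ≤ f (G x) * deriv k (f (G x)) := by
    rw [← mul_neg]; exact mul_le_mul_of_nonneg_left (hℓ _) hF.le
  have h7 := mul_le_mul_of_nonneg_right (mul_le_mul_of_nonneg_left h6 (hφ0 x)) hpos
  linarith

end

/-! ### Removing the cutoffs: the inequality for truncated logarithms. -/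

section

open Filter Topology ENNReal

variable {n : ℕ} {p : ℝ} {f : E n → ℝ} {Ω : Set (E n)} {u : E n → ℝ} {G : E n → E n}
  {A : Fin n → E n → E n}

theorem IsAdmissible.exists_hessForm_bound (hf : IsAdmissible p f) :
    ∃ C : ℝ, 0 < C ∧ ∀ (G : E n → E n) x (g d : E n), G x ≠ 0 →
      |hessForm f G x g d| ≤ C * ‖G x‖ ^ (p - 2) * (∑ j, |g j|) * ∑ k, |d k| := by
  obtain ⟨C, hC, hb⟩ := hf.exists_fderiv_pd_bound
  refine ⟨C, hC, fun G x g d hx => ?_⟩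
  have h1 : ∀ j k, |hess f (G x) j k| ≤ C * ‖G x‖ ^ (p - 2) := fun j k => by
    have : |hess f (G x) j k| ≤ _ := hb _ hx j (EuclideanSpace.single k 1)
    simpa using this
  rw [Finset.mul_sum]
  refine (Finset.abs_sum_le_sum_abs _ _).trans (Finset.sum_le_sum fun k _ => ?_)
  rw [Finset.mul_sum, Finset.sum_mul]
  refine (Finset.abs_sum_le_sum_abs _ _).trans (Finset.sum_le_sum fun j _ => ?_)
  rw [abs_mul, abs_mul]
  gcongr
  exact h1 j k

theorem IsAdmissible.exists_norm_ge (hf : IsAdmissible p f) (hp : 0 < p) {σ : ℝ} (hσ : 0 < σ) :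
    ∃ r : ℝ, 0 < r ∧ ∀ η, σ < f η → η ≠ 0 ∧ r ≤ ‖η‖ := by
  obtain ⟨_, C, -, hC, h⟩ := hf.exists_bounds
  refine ⟨(σ / C) ^ p⁻¹, by positivity, fun η hη => ?_⟩
  have h0 : η ≠ 0 := by
    rintro rfl
    rw [hf.map_zero] at hη
    linarith
  refine ⟨h0, ?_⟩
  have h1 : σ / C ≤ ‖η‖ ^ p := by
    rw [div_le_iff₀ hC, mul_comm]
    exact hη.le.trans (h η h0).2
  calc _ ≤ (‖η‖ ^ p) ^ p⁻¹ := Real.rpow_le_rpow (by positivity) h1 (by positivity)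
    _ = ‖η‖ := by rw [← Real.rpow_mul (norm_nonneg _), mul_inv_cancel₀ hp.ne', Real.rpow_one]

/-- Where f(∇u) > σ the gradient is bounded away from 0, so the factor |∇u|^{-1} costs only a
constant and the weight |∇u|^{(p-2)/2} can be inserted freely; the latter form is square integrable.
-/
theorem IsAdmissible.exists_logGrad_bound (hf : IsAdmissible p f) (hp : 2 ≤ p) {σ : ℝ}
    (hσ : 0 < σ) : ∃ C : ℝ, 0 < C ∧ ∀ (G : E n → E n) (A : Fin n → E n → E n) x i,
      σ < f (G x) → |logGrad f G A x i| ≤ C * size A x ∧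
        |logGrad f G A x i| ≤ C * (‖G x‖ ^ ((p - 2) / 2) * size A x) := by
  obtain ⟨C, hC, hb⟩ := hf.exists_fderiv_le_mul hp
  obtain ⟨r, hr, hN⟩ := hf.exists_norm_ge (by linarith) hσ
  refine ⟨max (C * r⁻¹) (C * r⁻¹ * (r⁻¹) ^ ((p - 2) / 2)), lt_max_of_lt_left (by positivity),
    fun G A x i hx => ?_⟩
  obtain ⟨h0, hrx⟩ := hN _ hx
  have hF := hf.pos _ h0
  have hG0 : 0 < ‖G x‖ := norm_pos_iff.2 h0
  have hsz := size_nonneg A x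
  have h1 : |logGrad f G A x i| ≤ C * r⁻¹ * size A x := by
    rw [logGrad_apply, abs_div, abs_of_pos hF, div_le_iff₀ hF]
    calc _ ≤ C * f (G x) * ‖G x‖⁻¹ * ‖A i x‖ := hb _ h0 _
      _ ≤ C * f (G x) * r⁻¹ * size A x := by
          gcongr
          exact norm_le_size A i x
      _ = _ := by ring
  refine ⟨h1.trans (by gcongr; exact le_max_left _ _), h1.trans ?_⟩
  have h2 : 1 ≤ (r⁻¹) ^ ((p - 2) / 2) * ‖G x‖ ^ ((p - 2) / 2) := by
    rw [← Real.mul_rpow (by positivity) hG0.le]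
    refine Real.one_le_rpow ?_ (by linarith)
    rw [inv_mul_eq_div, one_le_div hr]
    exact hrx
  calc _ = C * r⁻¹ * size A x * 1 := by ring
    _ ≤ C * r⁻¹ * size A x * ((r⁻¹) ^ ((p - 2) / 2) * ‖G x‖ ^ ((p - 2) / 2)) := by gcongr
    _ = (C * r⁻¹ * (r⁻¹) ^ ((p - 2) / 2)) * (‖G x‖ ^ ((p - 2) / 2) * size A x) := by ring
    _ ≤ _ := by gcongr; exact le_max_right _ _

/-- The gradient of `max (log f(G)) θ`. -/
def truncGrad (f : E n → ℝ) (G : E n → E n) (A : Fin n → E n → E n) (θ : ℝ) (x : E n) : E n :=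
  if Real.exp θ < f (G x) then logGrad f G A x else 0

theorem HasSecondDeriv.aestronglyMeasurable_logGrad (hA : HasSecondDeriv p Ω G A)
    (hG : Measurable G) (hf : IsAdmissible p f) (hp : 0 < p) {K : Set (E n)} (hK : IsCompact K)
    (hKΩ : K ⊆ Ω) (i : Fin n) :
    AEStronglyMeasurable (fun x => logGrad f G A x i) (volume.restrict K) :=
  (hA.aestronglyMeasurable_fderiv hG f hK hKΩ i).mul
    ((hf.continuous hp).measurable.comp hG).inv.aestronglyMeasurable

theorem measurable_hess (hG : Measurable G) (j k : Fin n) : Measurable fun x => hess f (G x) j k :=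
  (measurable_fderiv_apply_const ℝ (pd j f) (EuclideanSpace.single k (1 : ℝ))).comp hG

theorem aestronglyMeasurable_hessForm (hG : Measurable G) {ν : Measure (E n)} {g d : E n → E n}
    (hg : ∀ i, AEStronglyMeasurable (fun x => g x i) ν)
    (hd : ∀ i, AEStronglyMeasurable (fun x => d x i) ν) :
    AEStronglyMeasurable (fun x => hessForm f G x (g x) (d x)) ν :=
  Finset.aestronglyMeasurable_fun_sum _ fun k _ => Finset.aestronglyMeasurable_fun_sum _ fun j _ =>
    ((measurable_hess hG j k).aestronglyMeasurable.mul (hg j)).mul (hd k)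

theorem HasSecondDeriv.memLp_truncGrad (hA : HasSecondDeriv p Ω G A) (hG : Measurable G)
    (hf : IsAdmissible p f) (hp : 2 ≤ p) (θ : ℝ) {K : Set (E n)} (hK : IsCompact K) (hKΩ : K ⊆ Ω) :
    MemLp (truncGrad f G A θ) 2 (volume.restrict K) := by
  obtain ⟨C, hC, hb⟩ := hf.exists_logGrad_bound hp (Real.exp_pos θ)
  refine memLp_of_components fun i => ((hA.memLp_size hK hKΩ).const_mul C).mono' ?_
    (Eventually.of_forall fun x => ?_)
  · have hm : MeasurableSet {x | Real.exp θ < f (G x)} :=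
      measurableSet_lt measurable_const ((hf.continuous (by linarith)).measurable.comp hG)
    refine ((hA.aestronglyMeasurable_logGrad hG hf (by linarith) hK hKΩ i).indicator hm).congr
      (Eventually.of_forall fun x => ?_)
    by_cases hx : Real.exp θ < f (G x) <;> simp [truncGrad, hx, Set.indicator]
  · by_cases hx : Real.exp θ < f (G x)
    · simp only [truncGrad, hx, if_true]
      exact (hb G A x i hx).2
    · simp only [truncGrad, hx, if_false, PiLp.zero_apply, norm_zero]
      have := size_nonneg A x
      positivity

theorem IsAdmissible.exists_sqrt_bound (hf : IsAdmissible p f) {σ : ℝ} (hσ : 0 < σ) :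
    ∃ C : ℝ, 0 < C ∧ ∀ η, √(f η / σ) ≤ C * ‖η‖ ^ (p / 2) := by
  obtain ⟨_, C, -, hC, h⟩ := hf.exists_bounds
  refine ⟨√(C / σ), by positivity, fun η => ?_⟩
  rcases eq_or_ne η 0 with rfl | hη
  · simp only [hf.map_zero, zero_div, Real.sqrt_zero]; positivity
  · calc √(f η / σ) ≤ √(C / σ * ‖η‖ ^ p) := by
          apply Real.sqrt_le_sqrt
          rw [div_mul_eq_mul_div]
          exact div_le_div_of_nonneg_right (h η hη).2 hσ.le
      _ = _ := by
          rw [Real.sqrt_mul (by positivity), Real.sqrt_eq_rpow (‖η‖ ^ p),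
            ← Real.rpow_mul (norm_nonneg _)]
          ring_nf

/-- Splitting off the constant θ leaves a function that vanishes where f(η) ≤ e^θ and can be
approximated by annular ones. -/
theorem IsAdmissible.truncLog_eq (hf : IsAdmissible p f) (θ : ℝ) (η : E n) :
    truncLog f θ η = (if Real.exp θ < f η then Real.log (f η / Real.exp θ) else 0) + θ := by
  rw [truncLog]
  by_cases hη : η = 0
  · simp [hη, hf.map_zero, (Real.exp_pos θ).le.not_gt]
  · have h0 := hf.pos η hη
    by_cases h : Real.exp θ < f η
    · have h1 := (Real.lt_log_iff_exp_lt h0).2 h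
      simp [hη, h, h1.le, Real.log_div h0.ne' (Real.exp_pos θ).ne']
    · have h1 := mt (Real.lt_log_iff_exp_lt h0).1 h
      simp [hη, h, not_lt.1 h1]

theorem IsAdmissible.exists_truncLog_bound (hf : IsAdmissible p f) (θ : ℝ) :
    ∃ C : ℝ, 0 < C ∧ ∀ η,
      |if Real.exp θ < f η then Real.log (f η / Real.exp θ) else 0| ≤ C * ‖η‖ ^ (p / 2) := by
  obtain ⟨C, hC, hb⟩ := hf.exists_sqrt_bound (Real.exp_pos θ)
  refine ⟨2 * C, by positivity, fun η => ?_⟩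
  by_cases h : Real.exp θ < f η
  · obtain ⟨h1, h2⟩ := log_div_le (Real.exp_pos θ) h.le
    rw [if_pos h, abs_of_nonneg h1]
    linarith [hb η]
  · rw [if_neg h, abs_zero]; positivity

theorem IsGlobalSol.memLp_truncLog (hs : IsGlobalSol p f Ω u G) (hf : IsAdmissible p f)
    (hp : 0 < p) (θ : ℝ) {K : Set (E n)} (hK : IsCompact K) :
    MemLp (fun x => truncLog f θ (G x)) 2 (volume.restrict K) := by
  have := isFiniteMeasure_restrict_of_isCompact hK
  obtain ⟨C, hC, hb⟩ := hf.exists_truncLog_bound θ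
  simp only [hf.truncLog_eq]
  refine MemLp.add ?_ (memLp_const θ)
  have hm := (hf.continuous hp).measurable.comp hs.measurable_grad
  refine ((hs.memLp_rpow hp (by positivity) le_rfl hK).const_mul C).mono' ?_
    (Eventually.of_forall fun x => hb _)
  exact (Measurable.ite (measurableSet_lt measurable_const hm)
    (Real.measurable_log.comp (hm.div_const _)) measurable_const).aestronglyMeasurable

/-- The functions log(s/σ) `cut σ m s` are annular and converge to the positive part. The zero of
log(s/σ) at s = σ offsets the steep rise of `cut`, so the derivatives are dominated and no
contribution concentrates on the level set. -/
theorem IsGlobalSol.isWeakDerivOn_posPart_log (hs : IsGlobalSol p f Ω u G) (hf : IsAdmissible p f)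
    (hp : 2 ≤ p) (hΩ : IsOpen Ω) (hA : HasSecondDeriv p Ω G A) (θ : ℝ) (i : Fin n) :
    IsWeakDerivOn Ω (EuclideanSpace.single i 1)
      (fun x => if Real.exp θ < f (G x) then Real.log (f (G x) / Real.exp θ) else 0)
      fun x => truncGrad f G A θ x i := by
  have hp0 : 0 < p := by linarith
  set σ := Real.exp θ with hσ
  have hσ0 : 0 < σ := Real.exp_pos θ
  obtain ⟨C₁, hC₁, hb₁⟩ := hf.exists_sqrt_bound hσ0
  obtain ⟨C₃, hC₃, hb₃⟩ := hf.exists_fderiv_le_mul hp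
  obtain ⟨R, hR0, hR⟩ := exists_deriv_log_mul_cut_bound
  have hlow : ∀ m s, 0 < m → s ≤ σ →
      (fun s => Real.log (s / σ) * cut σ m s) =ᶠ[𝓝 s] fun _ => 0 := by
    intro m s hm hs
    filter_upwards [eventually_lt_nhds (show s < σ + m⁻¹ by linarith [inv_pos.2 hm])] with y hy
    rw [cut_of_le hm hy.le, mul_zero]
  refine isWeakDerivOn_of_tendsto hΩ
    (bh := fun x => 2 * C₁ * ‖G x‖ ^ (p / 2))
    (bg := fun x => R * C₃ * C₁ * (‖G x‖ ^ ((p - 2) / 2) * size A x))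
    (H := fun m x => Real.log (f (G x) / σ) * cut σ m (f (G x)))
    ((eventually_gt_atTop 0).mono fun m hm =>
      hA.locDiff_comp hf hp0 (isAnnular_log_mul_cut hσ0 hm) i)
    ?_ ?_ (fun K hK _ => ?_) (fun K hK hKΩ => ?_) (fun x => ?_) fun x => ?_
  · filter_upwards [eventually_gt_atTop 0] with m hm x
    rcases le_or_gt (f (G x)) σ with h | h
    · have h1 : Real.log (f (G x) / σ) * cut σ m (f (G x)) = 0 := (hlow m _ hm h).self_of_nhds
      rw [h1, abs_zero]
      positivity
    · obtain ⟨h1, h2⟩ := log_div_le hσ0 h.le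
      rw [abs_of_nonneg (mul_nonneg h1 (cut_nonneg _ _ _))]
      calc _ ≤ Real.log (f (G x) / σ) := mul_le_of_le_one_right h1 (cut_le_one _ _ _)
        _ ≤ _ := by linarith [hb₁ (G x)]
  · filter_upwards [eventually_gt_atTop 0] with m hm x
    by_cases hx : G x = 0
    · simp [hA.zero i x hx, hA.size_eq_zero hx]
    have h0 : 0 < ‖G x‖ := norm_pos_iff.2 hx
    have hF := hf.pos _ hx
    have hsz := size_nonneg A x
    set r := √(f (G x) / σ) with hr
    have hr0 : 0 < r := Real.sqrt_pos.2 (by positivity)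
    have hfr : f (G x) = σ * r * r := by
      rw [hr, mul_assoc, Real.mul_self_sqrt (by positivity)]; field_simp
    have h1 : |fderiv ℝ f (G x) (A i x)| ≤ C₃ * f (G x) * ‖G x‖⁻¹ * size A x :=
      (hb₃ _ hx _).trans (by gcongr; exact norm_le_size A i x)
    rw [abs_mul]
    calc _ ≤ R * (σ * r)⁻¹ * (C₃ * f (G x) * ‖G x‖⁻¹ * size A x) :=
          mul_le_mul (hR σ m _ hσ0 hm hF) h1 (abs_nonneg _) (by positivity)
      _ = R * C₃ * r * (‖G x‖⁻¹ * size A x) := by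
          rw [hfr]; field_simp
      _ ≤ R * C₃ * (C₁ * ‖G x‖ ^ (p / 2)) * (‖G x‖⁻¹ * size A x) := by
          gcongr
          exact hb₁ _
      _ = R * C₃ * C₁ * (‖G x‖ ^ (p / 2) / ‖G x‖ * size A x) := by ring
      _ = _ := by
          rw [← Real.rpow_sub_one h0.ne']
          ring_nf
  · have := isFiniteMeasure_restrict_of_isCompact hK
    exact ((hs.memLp_rpow hp0 (by positivity) le_rfl hK).integrable (by norm_num)).const_mul _
  · have := isFiniteMeasure_restrict_of_isCompact hK
    exact ((hA.memLp_size hK hKΩ).integrable (by norm_num)).const_mul _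
  · refine tendsto_nhds_of_eventually_eq ?_
    by_cases h : σ < f (G x)
    · filter_upwards [eventually_cut h] with m hm
      rw [hm.2.self_of_nhds, mul_one, if_pos h]
    · filter_upwards [eventually_gt_atTop 0] with m hm
      rw [if_neg h]
      exact (hlow m _ hm (not_lt.1 h)).self_of_nhds
  · refine tendsto_nhds_of_eventually_eq ?_
    by_cases h : σ < f (G x)
    · filter_upwards [eventually_cut h] with m hm
      have hF : 0 < f (G x) := hσ0.trans h
      rw [deriv_log_mul_cut hσ0 hF, hm.2.deriv_eq, hm.2.self_of_nhds, deriv_const, mul_zero,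
        add_zero, mul_one, truncGrad, if_pos h, logGrad_apply, inv_mul_eq_div]
    · filter_upwards [eventually_gt_atTop 0] with m hm
      rw [(hlow m _ hm (not_lt.1 h)).deriv_eq, deriv_const, zero_mul, truncGrad, if_neg h,
        PiLp.zero_apply]

/-- The differential inequality for `max (log f(∇u)) θ`. -/
theorem IsGlobalSol.integral_truncGrad_le (hs : IsGlobalSol p f Ω u G) (hf : IsAdmissible p f)
    (hn : 2 ≤ n) (hp : (n : ℝ) ≤ p) (hΩ : IsOpen Ω) (hA : HasSecondDeriv p Ω G A) (θ : ℝ)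
    {φ : E n → ℝ} (hφ : IsTest Ω φ) (hφ0 : ∀ x, 0 ≤ φ x) {d : E n → E n}
    (hd : ∀ x i, d x i = pd i φ x) :
    (Integrable fun x => hessForm f G x (truncGrad f G A θ x) (d x)) ∧
      ∫ x, hessForm f G x (truncGrad f G A θ x) (d x) ≤ 0 := by
  have hp2 : 2 ≤ p := le_trans (by exact_mod_cast hn) hp
  have hp0 : 0 < p := by linarith
  set σ := Real.exp θ with hσ
  have hσ0 : 0 < σ := Real.exp_pos θ
  obtain ⟨C₁, hC₁, hb₁⟩ := hf.exists_logGrad_bound (n := n) hp2 hσ0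
  obtain ⟨C₂, hC₂, hb₂⟩ := hf.exists_hessForm_bound
  obtain ⟨R, hR0, hR⟩ := exists_cut_bounds
  obtain ⟨M, hM0, hM⟩ := hφ.isBumpFun.exists_abs_le
  have hdb : ∃ D, 0 ≤ D ∧ ∀ x, ∑ k, |d x k| ≤ D := by
    have h1 : ∀ k, ∃ D, ∀ x, ‖fderiv ℝ φ x (EuclideanSpace.single k 1)‖ ≤ D := fun k =>
      (hφ.isBumpFun.hasCompactSupport_fderiv _).exists_bound_of_continuous
        (hφ.isBumpFun.continuous_fderiv _)
    choose D hD using h1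
    refine ⟨∑ k, D k, Finset.sum_nonneg fun k _ => (norm_nonneg _).trans (hD k 0), fun x =>
      Finset.sum_le_sum fun k _ => ?_⟩
    rw [hd]
    exact hD k x
  obtain ⟨D, hD0, hD⟩ := hdb
  set S := tsupport φ with hS
  have hd0 : ∀ x, x ∉ S → d x = 0 := fun x hx => by
    ext k
    rw [hd]
    exact fderiv_apply_eq_zero_of_notMem_tsupport _ hx
  have hz : ∀ x g, x ∉ S → hessForm f G x g (d x) = 0 := fun x g hx => by
    simp [hessForm, hd0 x hx]
  have hφz : ∀ x, x ∉ S → φ x = 0 := fun x hx => image_eq_zero_of_notMem_tsupport hx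
  -- The integrand of `IsGlobalSol.integral_cut_le` for k = `cut σ m`. The rise of `cut` has already
  -- been discarded by its sign; only the descent, bounded by `tail`, is kept, and it vanishes
  -- pointwise as m → ∞.
  let J : ℝ → E n → ℝ := fun m x => cut σ m (f (G x)) * hessForm f G x (logGrad f G A x) (d x) -
    φ x * (f (G x) * tail σ m (f (G x))) *
      hessForm f G x (logGrad f G A x) (logGrad f G A x)
  -- A bound independent of m. Its terms are locally integrable by the energy bound; the quadratic
  -- one uses that s `tail σ m s` is bounded.
  let bd : E n → ℝ := fun x => C₂ * (n * C₁) * D * (‖G x‖ ^ (p - 2) * size A x) +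
    M * R * C₂ * (n * C₁) ^ 2 * (‖G x‖ ^ (p - 2) * size A x ^ 2)
  have ibd : Integrable bd (volume.restrict S) :=
    ((hs.integrableOn_size hp2 hA hφ.compact hφ.supp).const_mul _).add
      ((hA.integrableOn_size_sq hp2 hφ.compact hφ.supp).const_mul _)
  have hJz : ∀ m x, x ∉ S → J m x = 0 := fun m x hx => by
    simp only [J, hz x _ hx, hφz x hx, mul_zero, zero_mul, sub_zero]
  have hJlow : ∀ m x, 0 < m → f (G x) ≤ σ → J m x = 0 := fun m x hm hx => by
    simp only [J, cut_of_le hm (hx.trans (le_add_of_nonneg_right (inv_pos.2 hm).le)),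
      tail_of_le hm hx, mul_zero, zero_mul, sub_zero]
  have hJb : ∀ m x, 0 < m → ‖J m x‖ ≤ bd x := by
    intro m x hm
    have hsz := size_nonneg A x
    rcases le_or_gt (f (G x)) σ with h | h
    · rw [hJlow m x hm h, norm_zero]
      simp only [bd]
      positivity
    · have hF : 0 < f (G x) := hσ0.trans h
      have hx : G x ≠ 0 := by
        intro h0
        rw [h0, hf.map_zero] at hF
        exact lt_irrefl _ hF
      have hg : ∑ j, |logGrad f G A x j| ≤ n * C₁ * size A x := by
        calc _ ≤ ∑ _j : Fin n, C₁ * size A x := Finset.sum_le_sum fun j _ => (hb₁ G A x j h).1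
          _ = _ := by rw [Finset.sum_const, Finset.card_univ, Fintype.card_fin, nsmul_eq_mul]; ring
      have hg0 : 0 ≤ ∑ j, |logGrad f G A x j| := Finset.sum_nonneg fun _ _ => abs_nonneg _
      have h1 : |hessForm f G x (logGrad f G A x) (d x)| ≤
          C₂ * ‖G x‖ ^ (p - 2) * (n * C₁ * size A x) * D :=
        (hb₂ G x _ _ hx).trans (by gcongr; exact hD x)
      have h2 : |hessForm f G x (logGrad f G A x) (logGrad f G A x)| ≤
          C₂ * ‖G x‖ ^ (p - 2) * (n * C₁ * size A x) * (n * C₁ * size A x) :=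
        (hb₂ G x _ _ hx).trans (by gcongr)
      have h3 : |cut σ m (f (G x))| ≤ 1 := by
        rw [abs_of_nonneg (cut_nonneg _ _ _)]; exact cut_le_one _ _ _
      have h4 : |f (G x) * tail σ m (f (G x))| ≤ R := by
        rw [abs_of_nonneg (mul_nonneg hF.le (tail_nonneg hm _))]
        exact (hR σ m _ hσ0.le hm hF.le).1
      calc ‖J m x‖ ≤ |cut σ m (f (G x)) * hessForm f G x (logGrad f G A x) (d x)| +
            |φ x * (f (G x) * tail σ m (f (G x))) *
              hessForm f G x (logGrad f G A x) (logGrad f G A x)| := abs_sub _ _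
        _ ≤ 1 * (C₂ * ‖G x‖ ^ (p - 2) * (n * C₁ * size A x) * D) +
            M * R * (C₂ * ‖G x‖ ^ (p - 2) * (n * C₁ * size A x) * (n * C₁ * size A x)) := by
          rw [abs_mul, abs_mul, abs_mul]
          gcongr
          exact hM x
        _ = _ := by simp only [bd]; ring
  have hlg := fun i => hA.aestronglyMeasurable_logGrad hs.measurable_grad hf hp0 hφ.compact
    hφ.supp i
  have hdm : ∀ i, AEStronglyMeasurable (fun x => d x i) (volume.restrict S) := fun i => by
    simp only [hd]
    exact (hφ.isBumpFun.continuous_fderiv _).aestronglyMeasurable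
  have hfG := (hf.continuous hp0).measurable.comp hs.measurable_grad
  have hJm : ∀ m, AEStronglyMeasurable (J m) (volume.restrict S) := fun m =>
    (((contDiff_cut σ m).continuous.measurable.comp hfG).aestronglyMeasurable.mul
      (aestronglyMeasurable_hessForm hs.measurable_grad hlg hdm)).sub
    ((hφ.isBumpFun.continuous.aestronglyMeasurable.mul
      (hfG.mul ((measurable_tail σ m).comp hfG)).aestronglyMeasurable).mul
      (aestronglyMeasurable_hessForm hs.measurable_grad hlg hlg))
  have hle : ∀ m, 0 < m → ∫ x in S, J m x ≤ 0 := by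
    intro m hm
    have i1 : Integrable (J m) := integrable_of_support_subset
      (ibd.mono' (hJm m) (Eventually.of_forall fun x => hJb m x hm)) (hJz m)
    rw [setIntegral_eq_integral_of_forall_compl_eq_zero (hJz m)]
    exact hs.integral_cut_le hf hn hp hΩ hA (isAnnular_cut hσ0.le hm)
      (cut_nonneg σ m) (neg_tail_le_deriv_cut hm) hφ hφ0 hd i1
  have hlim : ∀ x, Tendsto (fun m => J m x) atTop
      (𝓝 (hessForm f G x (truncGrad f G A θ x) (d x))) := by
    intro x
    refine tendsto_nhds_of_eventually_eq ?_
    by_cases h : σ < f (G x)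
    · filter_upwards [eventually_cut h, eventually_tail σ (f (G x))] with m h1 h2
      simp only [J, h1.2.self_of_nhds, h2, mul_zero, zero_mul, sub_zero, one_mul]
      rw [truncGrad, if_pos h]
    · filter_upwards [eventually_gt_atTop 0] with m hm
      rw [hJlow m x hm (not_lt.1 h), truncGrad, if_neg h]
      simp [hessForm]
  have hmeas : ∀ i, AEStronglyMeasurable (fun x => truncGrad f G A θ x i) (volume.restrict S) :=
    fun i => ((EuclideanSpace.proj i : E n →L[ℝ] ℝ).continuous.comp_aestronglyMeasurable
      (hA.memLp_truncGrad hs.measurable_grad hf hp2 θ hφ.compact hφ.supp).1)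
  have hbd' : ∀ x, ‖hessForm f G x (truncGrad f G A θ x) (d x)‖ ≤ bd x := fun x =>
    le_of_tendsto (hlim x).norm ((eventually_gt_atTop 0).mono fun m hm => hJb m x hm)
  refine ⟨integrable_of_support_subset (ibd.mono'
    (aestronglyMeasurable_hessForm hs.measurable_grad hmeas hdm)
    (Eventually.of_forall hbd')) fun x hx => hz x _ hx, ?_⟩
  rw [← setIntegral_eq_integral_of_forall_compl_eq_zero (s := S) fun x hx => hz x _ hx]
  refine le_of_tendsto (tendsto_integral_filter_of_dominated_convergence bd
    (Eventually.of_forall hJm) ?_ ibd (Eventually.of_forall hlim))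
    ((eventually_gt_atTop 0).mono hle)
  filter_upwards [eventually_gt_atTop 0] with m hm
  exact Eventually.of_forall fun x => hJb m x hm

end

/-! ### From representatives to the statement about weak solutions. -/

section

open Filter Topology ENNReal

variable {n : ℕ} {p : ℝ} {f : E n → ℝ} {Ω : Set (E n)} {u : E n → ℝ} {G : E n → E n}
  {A : Fin n → E n → E n}

theorem IsBumpFun.integral_fderiv_eq_zero {φ : E n → ℝ} (hφ : IsBumpFun φ) (e : E n) :
    ∫ x, fderiv ℝ φ x e = 0 := by
  have i1 : Integrable fun x => fderiv ℝ φ x e :=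
    (hφ.continuous_fderiv e).integrable_of_hasCompactSupport (hφ.hasCompactSupport_fderiv e)
  have i2 : Integrable φ := hφ.continuous.integrable_of_hasCompactSupport hφ.compact
  have h := integral_mul_fderiv_eq_neg_fderiv_mul_of_integrable (𝕜 := ℝ) (μ := volume)
    (f := fun _ : E n => (1 : ℝ)) (g := φ) (v := e) (by simp) (by simpa using i1)
    (by simpa using i2) (fun _ _ => differentiableAt_const _) fun x _ => hφ.differentiable x
  simpa using h

theorem IsGlobalSol.isWeakDerivOn_truncLog (hs : IsGlobalSol p f Ω u G) (hf : IsAdmissible p f)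
    (hp : 2 ≤ p) (hΩ : IsOpen Ω) (hA : HasSecondDeriv p Ω G A) (θ : ℝ) (i : Fin n) :
    IsWeakDerivOn Ω (EuclideanSpace.single i 1) (fun x => truncLog f θ (G x))
      fun x => truncGrad f G A θ x i := by
  intro φ hφ
  have hb := hφ.isBumpFun
  have := isFiniteMeasure_restrict_of_isCompact hφ.compact
  have i0 : IntegrableOn (fun x => truncLog f θ (G x)) (tsupport φ) :=
    (hs.memLp_truncLog hf (by linarith) θ hφ.compact).integrable (by norm_num)
  have i1 := hφ.integrable_mul_fderiv (EuclideanSpace.single i 1) i0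
  have i2 : Integrable fun x => θ * fderiv ℝ φ x (EuclideanSpace.single i 1) :=
    ((hb.continuous_fderiv _).integrable_of_hasCompactSupport
      (hb.hasCompactSupport_fderiv _)).const_mul θ
  have h := hs.isWeakDerivOn_posPart_log hf hp hΩ hA θ i φ hφ
  have e : ∀ x, (if Real.exp θ < f (G x) then Real.log (f (G x) / Real.exp θ) else 0) *
      fderiv ℝ φ x (EuclideanSpace.single i 1) =
      truncLog f θ (G x) * fderiv ℝ φ x (EuclideanSpace.single i 1) -
        θ * fderiv ℝ φ x (EuclideanSpace.single i 1) := fun x => by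
    rw [hf.truncLog_eq]; ring
  simp only [e] at h
  rw [integral_sub i1 i2, integral_const_mul, hb.integral_fderiv_eq_zero, mul_zero, sub_zero] at h
  exact h

/-- Functions that locally agree with some `max (log f(∇u)) θ` are weak subsolutions. -/
theorem IsGlobalSol.isWeakSubsol (hs : IsGlobalSol p f Ω u G) (hf : IsAdmissible p f)
    (hn : 2 ≤ n) (hp : (n : ℝ) ≤ p) (hΩ : IsOpen Ω) (hA : HasSecondDeriv p Ω G A) {D : Set (E n)}
    (hD : IsOpen D) (hDΩ : D ⊆ Ω) {a : E n → Matrix (Fin n) (Fin n) ℝ} {ζ : E n → ℝ}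
    {g : E n → E n} (ha : ∀ᵐ x ∂(volume.restrict Ω), a x = coeff f (G x))
    (hloc : ∀ K, IsCompact K → K ⊆ D → ∃ θ, ∀ᵐ x ∂(volume.restrict K),
      ζ x = truncLog f θ (G x) ∧ g x = truncGrad f G A θ x) : IsWeakSubsol D a ζ := by
  have hp2 : 2 ≤ p := le_trans (by exact_mod_cast hn) hp
  have hζm : ∀ K, IsCompact K → K ⊆ D → MemLp ζ 2 (volume.restrict K) := fun K hK hKD => by
    obtain ⟨θ, hθ⟩ := hloc K hK hKD
    exact (hs.memLp_truncLog hf (by linarith) θ hK).ae_eq (hθ.mono fun x hx => hx.1.symm)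
  have hgm : ∀ K, IsCompact K → K ⊆ D → MemLp g 2 (volume.restrict K) := fun K hK hKD => by
    obtain ⟨θ, hθ⟩ := hloc K hK hKD
    exact (hA.memLp_truncGrad hs.measurable_grad hf hp2 θ hK (hKD.trans hDΩ)).ae_eq
      (hθ.mono fun x hx => hx.2.symm)
  have hset : ∀ {F : E n → ℝ} {φ : E n → ℝ}, IsTest D φ → (∀ x, x ∉ tsupport φ → F x = 0) →
      ∫ x in D, F x = ∫ x, F x := fun {F φ} hφ h0 =>
    setIntegral_eq_integral_of_forall_compl_eq_zero fun x hx => h0 x fun hxs => hx (hφ.supp hxs)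
  refine ⟨g, ⟨locallyIntegrableOn_of_isCompact hD fun K hK hKD => ?_,
    locallyIntegrableOn_of_isCompact hD fun K hK hKD => ?_, fun φ hφ i => ?_⟩,
    fun K hK hKD => ⟨hζm K hK hKD, hgm K hK hKD⟩, fun φ hφ hφ0 => ?_⟩
  · have := isFiniteMeasure_restrict_of_isCompact hK
    exact (hζm K hK hKD).integrable (by norm_num)
  · have := isFiniteMeasure_restrict_of_isCompact hK
    exact (hgm K hK hKD).integrable (by norm_num)
  -- Only the compact support of φ enters, so a level θ depending on φ is enough.
  · obtain ⟨θ, hθ⟩ := hloc _ hφ.compact hφ.supp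
    rw [ae_restrict_iff' hφ.compact.measurableSet] at hθ
    have h0 : ∀ x, x ∉ tsupport φ → pd i φ x = 0 := fun x hx =>
      fderiv_apply_eq_zero_of_notMem_tsupport _ hx
    have h1 : ∀ x, x ∉ tsupport φ → φ x = 0 := fun x hx => image_eq_zero_of_notMem_tsupport hx
    rw [hset hφ fun x hx => by rw [h0 x hx, mul_zero],
      hset hφ fun x hx => by rw [h1 x hx, mul_zero]]
    have e1 : ∫ x, ζ x * pd i φ x = ∫ x, truncLog f θ (G x) * pd i φ x := by
      refine integral_congr_ae ?_
      filter_upwards [hθ] with x hx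
      by_cases hxs : x ∈ tsupport φ
      · rw [(hx hxs).1]
      · rw [h0 x hxs, mul_zero, mul_zero]
    have e2 : ∫ x, g x i * φ x = ∫ x, truncGrad f G A θ x i * φ x := by
      refine integral_congr_ae ?_
      filter_upwards [hθ] with x hx
      by_cases hxs : x ∈ tsupport φ
      · rw [(hx hxs).2]
      · rw [h1 x hxs, mul_zero, mul_zero]
    rw [e1, e2]
    exact hs.isWeakDerivOn_truncLog hf hp2 hΩ hA θ i φ (hφ.mono hDΩ)
  · obtain ⟨θ, hθ⟩ := hloc _ hφ.compact hφ.supp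
    rw [ae_restrict_iff' hφ.compact.measurableSet] at hθ
    rw [ae_restrict_iff' hΩ.measurableSet] at ha
    have h0 : ∀ i x, x ∉ tsupport φ → pd i φ x = 0 := fun i x hx =>
      fderiv_apply_eq_zero_of_notMem_tsupport _ hx
    obtain ⟨i1, h1⟩ := hs.integral_truncGrad_le hf hn hp hΩ hA θ (hφ.mono hDΩ) hφ0
      (d := fun x => WithLp.toLp 2 fun i => pd i φ x) fun x i => rfl
    have heq : (fun x => hessForm f G x (truncGrad f G A θ x)
        (WithLp.toLp 2 fun i => pd i φ x)) =ᵐ[volume]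
        fun x => ∑ k, ∑ j, a x j k * g x j * pd k φ x := by
      filter_upwards [hθ, ha] with x hx hax
      refine Finset.sum_congr rfl fun k _ => Finset.sum_congr rfl fun j _ => ?_
      by_cases hxs : x ∈ tsupport φ
      · rw [(hx hxs).2, hax (hDΩ (hφ.supp hxs)), coeff]
        -- At zeros of G the value of the coefficient matrix is irrelevant, because the gradient of
        -- the truncation vanishes there.
        by_cases hG : G x = 0
        · have : truncGrad f G A θ x = 0 := by
            rw [truncGrad, if_neg]
            rw [hG, hf.map_zero]
            exact (Real.exp_pos θ).le.not_gt
          rw [this]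
          simp
        · rw [if_neg hG]
      · simp only [h0 _ x hxs, mul_zero]
    refine ⟨(i1.congr heq).integrableOn, ?_⟩
    rw [hset hφ fun x hx => by simp only [h0 _ x hx, mul_zero, Finset.sum_const_zero],
      ← integral_congr_ae heq]
    exact h1

theorem isOpen_nonvanishing (hΩ : IsOpen Ω) (G : E n → E n) : IsOpen (nonvanishing Ω G) := by
  rw [Metric.isOpen_iff]
  rintro x ⟨hx, c, hc, ρ, hρ, hae⟩
  obtain ⟨ε, hε, hball⟩ := Metric.isOpen_iff.1 hΩ x hx
  refine ⟨min ε (ρ / 2), lt_min hε (half_pos hρ), fun y hy => ⟨hball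
    (Metric.ball_subset_ball (min_le_left _ _) hy), c, hc, ρ / 2, half_pos hρ, ?_⟩⟩
  refine ae_restrict_of_ae_restrict_of_subset (Set.inter_subset_inter_left _ ?_) hae
  refine Metric.ball_subset_ball' ?_
  have := (Metric.mem_ball.1 hy).trans_le (min_le_right _ _)
  linarith

theorem exists_ae_le_norm_of_subset_nonvanishing (hΩ : IsOpen Ω) {G : E n → E n}
    {K : Set (E n)} (hK : IsCompact K) (hKD : K ⊆ nonvanishing Ω G) :
    ∃ c > 0, ∀ᵐ x ∂(volume.restrict K), c ≤ ‖G x‖ := by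
  refine hK.induction_on (p := fun s => ∃ c > 0, ∀ᵐ x ∂(volume.restrict s), c ≤ ‖G x‖)
    ⟨1, one_pos, by simp⟩ ?_ ?_ ?_
  · rintro s t hst ⟨c, hc, h⟩
    exact ⟨c, hc, ae_restrict_of_ae_restrict_of_subset hst h⟩
  · rintro s t ⟨c, hc, h⟩ ⟨c', hc', h'⟩
    refine ⟨min c c', lt_min hc hc', ?_⟩
    rw [ae_restrict_union_iff]
    exact ⟨h.mono fun x hx => (min_le_left _ _).trans hx,
      h'.mono fun x hx => (min_le_right _ _).trans hx⟩
  · intro x hx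
    obtain ⟨hxΩ, c, hc, ρ, hρ, h⟩ := hKD hx
    exact ⟨Metric.ball x ρ ∩ Ω, mem_nhdsWithin_of_mem_nhds
      ((Metric.isOpen_ball.inter hΩ).mem_nhds ⟨Metric.mem_ball_self hρ, hxΩ⟩), c, hc, h⟩

/-- Extend by zero and choose a measurable representative of the gradient; test functions supported
in Ω do not notice. -/
theorem IsPosWeakSol.exists_isGlobalSol (hs : IsPosWeakSol p f Ω u G) (hΩ : IsOpen Ω) :
    ∃ u' G', IsGlobalSol p f Ω u' G' ∧ ∀ᵐ x ∂(volume.restrict Ω), G' x = G x := by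
  have hG := hs.memLp_grad.1
  let G' : E n → E n := Ω.indicator (hG.mk G)
  have hGG' : ∀ᵐ x ∂(volume.restrict Ω), G' x = G x := by
    filter_upwards [hG.ae_eq_mk, ae_restrict_mem hΩ.measurableSet] with x h1 h2
    simp only [G', Set.indicator_of_mem h2, h1]
  have hset : ∀ {F : E n → ℝ} {φ : E n → ℝ}, IsTest Ω φ → (∀ x, x ∉ tsupport φ → F x = 0) →
      ∫ x in Ω, F x = ∫ x, F x := fun {F φ} hφ h0 =>
    setIntegral_eq_integral_of_forall_compl_eq_zero fun x hx => h0 x fun hxs => hx (hφ.supp hxs)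
  have h0 : ∀ {φ : E n → ℝ} (i : Fin n) x, x ∉ tsupport φ → pd i φ x = 0 := fun {φ} i x hx =>
    fderiv_apply_eq_zero_of_notMem_tsupport _ hx
  refine ⟨Ω.indicator u, G', ⟨fun i φ hφ => ?_, hG.stronglyMeasurable_mk.measurable.indicator
    hΩ.measurableSet, (memLp_indicator_iff_restrict hΩ.measurableSet).2 hs.memLp,
    (memLp_indicator_iff_restrict hΩ.measurableSet).2 (hs.memLp_grad.ae_eq hG.ae_eq_mk),
    fun φ hφ => ?_⟩, hGG'⟩
  · have h1 := hs.weakGrad.parts φ hφ i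
    have e1 : ∫ x, Ω.indicator u x * fderiv ℝ φ x (EuclideanSpace.single i 1) =
        ∫ x in Ω, u x * pd i φ x := by
      rw [← hset hφ fun x hx => by
        rw [fderiv_apply_eq_zero_of_notMem_tsupport _ hx, mul_zero]]
      refine setIntegral_congr_fun hΩ.measurableSet fun x hx => ?_
      simp only [Set.indicator_of_mem hx, pd]
    have e2 : ∫ x, G' x i * φ x = ∫ x in Ω, G x i * φ x := by
      rw [← hset hφ fun x hx => by rw [image_eq_zero_of_notMem_tsupport hx, mul_zero]]
      refine integral_congr_ae ?_
      filter_upwards [hGG'] with x hx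
      rw [hx]
    rw [e1, e2, h1]
  · rw [← hs.eqn φ hφ, ← hset hφ fun x hx => by
      simp only [h0 _ x hx, mul_zero, Finset.sum_const_zero]]
    refine integral_congr_ae ?_
    filter_upwards [hGG'] with x hx
    rw [hx]

theorem IsPosWeakSol.isWeakSubsol (hs : IsPosWeakSol p f Ω u G) (hf : IsAdmissible p f)
    (hn : 2 ≤ n) (hp : (n : ℝ) ≤ p) (hΩ : IsOpen Ω) :
    IsWeakSubsol (nonvanishing Ω G) (fun x => coeff f (G x)) (fun x => Real.log (f (G x))) ∧
      ∀ θ : ℝ, IsWeakSubsol Ω (fun x => coeff f (G x)) fun x => truncLog f θ (G x) := by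
  have hp2 : 2 ≤ p := le_trans (by exact_mod_cast hn) hp
  obtain ⟨u', G', hs', hG⟩ := hs.exists_isGlobalSol hΩ
  obtain ⟨A, hA⟩ := hs'.exists_hasSecondDeriv hf hp2 hΩ
  have ha : ∀ᵐ x ∂(volume.restrict Ω), coeff f (G x) = coeff f (G' x) :=
    hG.mono fun x hx => by rw [hx]
  refine ⟨hs'.isWeakSubsol hf hn hp hΩ hA (isOpen_nonvanishing hΩ G) (fun x hx => hx.1)
    (g := logGrad f G' A) ha fun K hK hKD => ?_, fun θ =>
    hs'.isWeakSubsol hf hn hp hΩ hA hΩ subset_rfl (g := truncGrad f G' A θ) ha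
      fun K hK hKΩ => ⟨θ, ?_⟩⟩
  · obtain ⟨c, hc, hae⟩ := exists_ae_le_norm_of_subset_nonvanishing hΩ hK hKD
    obtain ⟨c₀, _, hc₀, -, hb⟩ := hf.exists_bounds
    -- A level strictly below the lower bound log(c₀ c^p) for log f(∇u) on K, so the truncation is
    -- inactive almost everywhere on K.
    refine ⟨Real.log (c₀ * c ^ p) - 1, ?_⟩
    filter_upwards [hae, ae_restrict_of_ae_restrict_of_subset (hKD.trans fun x hx => hx.1) hG]
      with x hx hGx
    rw [← hGx] at hx ⊢
    have h0 : G' x ≠ 0 := norm_pos_iff.1 (hc.trans_le hx)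
    have hF := hf.pos _ h0
    have h1 : c₀ * c ^ p ≤ f (G' x) := by
      refine le_trans ?_ (hb _ h0).1
      gcongr
    have h2 : Real.log (c₀ * c ^ p) - 1 < Real.log (f (G' x)) := by
      have := Real.log_le_log (by positivity) h1
      linarith
    rw [truncLog, if_neg h0, max_eq_left h2.le, truncGrad,
      if_pos ((Real.lt_log_iff_exp_lt hF).1 h2)]
    exact ⟨rfl, rfl⟩
  · filter_upwards [ae_restrict_of_ae_restrict_of_subset hKΩ hG] with x hGx
    rw [hGx]
    exact ⟨rfl, rfl⟩

end

end FLaplace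

end

theorem lemma3p1 (n : ℕ) (hn : 2 ≤ n) (p : ℝ) (hp : (n : ℝ) ≤ p) :
    (∀ f : FLaplace.E n → ℝ, FLaplace.IsAdmissible p f →
      ∀ Ω : Set (FLaplace.E n), IsOpen Ω →
      ∀ (u : FLaplace.E n → ℝ) (G : FLaplace.E n → FLaplace.E n),
        FLaplace.IsPosWeakSol p f Ω u G →
        FLaplace.IsWeakSubsol (FLaplace.nonvanishing Ω G)
            (fun x => FLaplace.coeff f (G x)) (fun x => Real.log (f (G x))) ∧
        ∀ θ : ℝ, θ ≤ -1 →
          FLaplace.IsWeakSubsol Ω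
            (fun x => FLaplace.coeff f (G x)) (fun x => FLaplace.truncLog f θ (G x))) ∧
    (∀ (A B : Matrix (Fin n) (Fin n) ℝ), A.IsSymm → B.PosDef → (A * B).trace = 0 →
      ∀ ζ : Fin n → ℝ, ζ ≠ 0 →
        0 ≤ ((B * A) ^ 2).trace -
          p / (p - 1) *
            (dotProduct ζ ((B * A * B * A * B).mulVec ζ) / dotProduct ζ (B.mulVec ζ))) := by
  refine ⟨fun f hf Ω hΩ u G hs => ?_, fun A B hA hB hAB ζ hζ =>
    FLaplace.trace_sq_sub_nonneg hn hp hA hB hAB hζ⟩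
  have h := hs.isWeakSubsol hf hn hp hΩ
  exact ⟨h.1, fun θ _ => h.2 θ⟩
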